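/- Let $N\ge 2$ and let $Y=\{x\in\mathbb{R}^N:\sum_j x_j=0\}\cong\mathbb{R}^{N-1}$ with the Euclidean metric. Let $p_j=\frac{1}{\sqrt2}\bigl(e_j-\frac1N(1,\dots,1)\bigr)$, $1\le j\le N$, which are the vertices of a regular simplex in $Y$ with sides of length $1$. Put $F_j(x)=\frac12(x-p_j)+p_j$, let $K$ be the unique non-empty compact set with $K=\bigcup_{j=1}^N F_j(K)$, write $F_w=F_{w_1}\circ\dots\circ F_{w_m}$ for a finite word $w=w_1\cdots w_m$ in the letters $1,\dots,N$, let $V_0=\{p_1,\dots,p_N\}$ and $V_*=\bigcup_w F_w(V_0)$. A continuous function $u:K\to\mathbb{R}$ is harmonic if the energies $$\mathcal{E}_m(u)=\Bigl(\frac{N+2}{N}\Bigr)^m\sum_{x\sim_m y}\bigl(u(x)-u(y)\bigr)^2$$ are the same for all $m\ge0$, where $x\sim_m y$ means that $x,y\in F_w(V_0)$ for some word $w$ of length $m$. Let $\psi_j$ be the harmonic function with $\psi_j(p_j)=1$ and $\psi_j(p_k)=0$ for $k\ne j$, let $\Psi=\frac1{\sqrt2}\bigl((\psi_1,\dots,\psi_N)-\frac1N(1,\dots,1)\bigr)$,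 which is an injective map $K\to Y$, and let $X=\Psi(K)$ be the harmonic $N$-Sierpinski gasket. Let $T_j:Y\to Y$ be the linear map that multiplies the direction $p_j$ by $\frac{N}{N+2}$ and all orthogonal directions by $\frac1{N+2}$, let $S_j(x)=T_j(x-p_j)+p_j$, and let $\Gamma\subset Y$ be the unique non-empty compact set with $\Gamma=S_1(\Gamma)\cup S_2(\Gamma)$. For an infinite word $\omega=\omega_1\omega_2\cdots$ let $Z(\omega)=\lim_{m\to\infty}T_{[\omega]_m}T_{[\omega]_m}^{t}/\|T_{[\omega]_m}\|_{\mathrm{HS}}^2$ whenever the limit exists, where $T_{[\omega]_m}=T_{\omega_1}\cdots T_{\omega_m}$ and $\|\cdot\|_{\mathrm{HS}}$ is the Hilbert–Schmidt norm. For $x\in X\setminus\Psi(V_*)$ let $Z_*(x)=Z(\omega)$, where $\omega$ is the unique infinite word with $\Psi^{-1}(x)\in F_{\omega_1}\circ\cdots\circ F_{\omega_m}(K)$ for all $m$. Then $\Gamma$ is a geodesic in $X$ from $p_1$ to $p_2$ for the Euclidean metric: it is an arc of finite length contained in $X$ with end points $p_1,p_2$, and no curve in $X$ from $p_1$ to $p_2$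 is shorter. There is a $C^1$ function $g:[0,1]\to Y$ which maps $[0,1]$ injectively onto $\Gamma$, with $g(0)=p_1$ and $g(1)=p_2$, such that $Z_*(g(t))$ exists for almost every $t\in[0,1]$ and the length of $\Gamma$ is $$l(\Gamma)=\int_0^1\bigl\langle g'(t),Z_*(g(t))\,g'(t)\bigr\rangle^{1/2}\,dt .$$ Moreover $\frac13\le l(\Gamma)\le 2$. -/

import Mathlib

open Set Filter Topology MeasureTheory
open scoped ENNReal

namespace HarmonicGasket

/-! ### Curves, lengths, geodesics, attractors -/

section General

variable {E : Type*}

/-- The length of the curve `γ : [0,1] → E`: the supremum of the lengths of inscribed polygons. -/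
noncomputable def length [PseudoEMetricSpace E] (γ : ℝ → E) : ℝ≥0∞ :=
  eVariationOn γ (Icc 0 1)

/-- `γ` restricted to `[0,1]` is a simple (injective continuous) parametrization of the set `C`. -/
def IsSimpleParam [TopologicalSpace E] (γ : ℝ → E) (C : Set E) : Prop :=
  ContinuousOn γ (Icc 0 1) ∧ InjOn γ (Icc 0 1) ∧ γ '' Icc 0 1 = C

/-- The length `l(C)` of an arc `C`, i.e. the length of its simple parametrizations (they all have
the same length, as they differ by a monotone change of parameter); it is `∞` if `C` is no arc. -/
noncomputable def arcLength [PseudoEMetricSpace E] (C : Set E) : ℝ≥0∞ :=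
  ⨅ (γ : ℝ → E) (_ : IsSimpleParam γ C), length γ

/-- `C` is a geodesic from `a` to `b` in `X`: an arc contained in `X`, with end points `a` and `b`,
of finite length, and no longer than any curve in `X` from `a` to `b`. -/
def IsGeodesic [PseudoEMetricSpace E] (X C : Set E) (a b : E) : Prop :=
  C ⊆ X ∧ ∃ γ : ℝ → E, IsSimpleParam γ C ∧ γ 0 = a ∧ γ 1 = b ∧ length γ ≠ ∞ ∧
    ∀ σ : ℝ → E, ContinuousOn σ (Icc 0 1) → MapsTo σ (Icc 0 1) X → σ 0 = a → σ 1 = b →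
      length γ ≤ length σ

/-- `C` is a non-empty compact set with `C = ⋃ i, f i (C)`. -/
def IsAttractor [TopologicalSpace E] {ι : Type*} (f : ι → E → E) (C : Set E) : Prop :=
  C.Nonempty ∧ IsCompact C ∧ C = ⋃ i, f i '' C

/-- The attractor of an iterated function system: the non-empty compact set `C` with
`C = ⋃ i, f i (C)`. For finitely many contractions of a complete space there is exactly one
such set, so that the union below is over a one-element family. -/
def attractor [TopologicalSpace E] {ι : Type*} (f : ι → E → E) : Set E :=
  ⋃₀ {C | IsAttractor f C}

/-- `f_w = f_{w_1} ∘ ⋯ ∘ f_{w_m}` for a finite word `w = w_1 ⋯ w_m`. -/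
def wordMap {ι : Type*} (f : ι → E → E) : List ι → E → E
  | [] => id
  | i :: w => f i ∘ wordMap f w

end General

/-- The first `m` letters of an infinite word. -/
def trunc {ι : Type*} (ω : ℕ → ι) (m : ℕ) : List ι :=
  List.ofFn fun k : Fin m => ω k

/-! ### The Euclidean space `Y` and the classical gasket -/

/-- The hyperplane `{x : ∑ j, x j = 0}` of `ℝ^N`, with the Euclidean structure of `ℝ^N`. -/
def Y (N : ℕ) : Submodule ℝ (EuclideanSpace ℝ (Fin N)) where
  carrier := {x | ∑ j, x j = 0}
  add_mem' := by
    intro a b ha hb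
    simp only [mem_ofPred_eq, PiLp.add_apply, Finset.sum_add_distrib] at *
    rw [ha, hb, add_zero]
  zero_mem' := by simp
  smul_mem' := by
    intro c x hx
    simp only [mem_ofPred_eq, PiLp.smul_apply, smul_eq_mul, ← Finset.mul_sum] at *
    rw [hx, mul_zero]

instance (N : ℕ) : CompleteSpace (Y N) := FiniteDimensional.complete ℝ (Y N)

/-- The vertices `p_j = (e_j - (1, …, 1) / N) / √2` of a regular simplex of side `1` in `Y`. -/
noncomputable def p (N : ℕ) (j : Fin N) : Y N :=
  ⟨(Real.sqrt 2)⁻¹ • WithLp.toLp 2 (fun k : Fin N => (if k = j then 1 else 0) - 1 / (N : ℝ)), by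
    have hN : (N : ℝ) ≠ 0 := by
      have := j.pos
      positivity
    change ∑ k : Fin N, (Real.sqrt 2)⁻¹ * ((if k = j then 1 else 0) - 1 / (N : ℝ)) = 0
    rw [← Finset.mul_sum, Finset.sum_sub_distrib]
    simp [hN]⟩

/-- The maps `F_j x = (x - p_j) / 2 + p_j`. -/
noncomputable def F (N : ℕ) (j : Fin N) (x : Y N) : Y N :=
  (1 / 2 : ℝ) • (x - p N j) + p N j

/-- The classical `N`-Sierpinski gasket. -/
def K (N : ℕ) : Set (Y N) := attractor (F N)

/-- The set `V_* = ⋃_m V_m` of all points `F_w p_j`. -/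
def Vstar (N : ℕ) : Set (Y N) :=
  {y | ∃ (w : List (Fin N)) (j : Fin N), y = wordMap (F N) w (p N j)}

/-- The energy of level `m`,
`((N+2)/N)^m ∑ (u(x) - u(y))^2`, the sum over the ordered pairs `(x, y)` of points lying in a
common cell `F_w V_0` with `|w| = m`. (Two distinct points lie in at most one such cell, so the
sum may be organized by cells.) -/
noncomputable def energy (N m : ℕ) (u : Y N → ℝ) : ℝ :=
  (((N : ℝ) + 2) / N) ^ m * ∑ w : Fin m → Fin N, ∑ i : Fin N, ∑ j : Fin N,
    (u (wordMap (F N) (List.ofFn w) (p N i)) - u (wordMap (F N) (List.ofFn w) (p N j))) ^ 2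

/-- `u` is a harmonic function on `K`: it is continuous and its energies of all levels agree. (Only
the values of `u` on `K` matter; the limit of the energies is then automatically finite.) -/
def IsHarmonic (N : ℕ) (u : Y N → ℝ) : Prop :=
  ContinuousOn u (K N) ∧ ∀ m, energy N m u = energy N (m + 1) u

/-- `ψ_j` is the harmonic function on `K` that is `1` at `p_j` and `0` at the other `p_k`. It is
unique on `K`; its values off `K` are irrelevant and never used. -/
noncomputable def psi (N : ℕ) (j : Fin N) : Y N → ℝ :=
  Classical.epsilon fun u => IsHarmonic N u ∧ ∀ k, u (p N k) = if k = j then 1 else 0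

/-- `Ψ = ((ψ_1, …, ψ_N) - (1, …, 1) / N) / √2`. -/
noncomputable def Psi (N : ℕ) (y : Y N) : EuclideanSpace ℝ (Fin N) :=
  (Real.sqrt 2)⁻¹ • WithLp.toLp 2 (fun j : Fin N => psi N j y - 1 / (N : ℝ))

/-- The harmonic `N`-Sierpinski gasket `X = Ψ(K)`, as a subset of the hyperplane `Y`. -/
def X (N : ℕ) : Set (Y N) :=
  {x | (x : EuclideanSpace ℝ (Fin N)) ∈ Psi N '' K N}

/-- The set `Ψ(V_*)`, as a subset of the hyperplane `Y`. -/
def PsiVstar (N : ℕ) : Set (Y N) :=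
  {x | (x : EuclideanSpace ℝ (Fin N)) ∈ Psi N '' Vstar N}

/-! ### The affine maps and the curve `Γ` -/

/-- `T_j` multiplies the direction `p_j` by `N/(N+2)` and all orthogonal directions by
`1/(N+2)`. -/
noncomputable def T (N : ℕ) (j : Fin N) : Y N →L[ℝ] Y N :=
  ((N : ℝ) / (N + 2)) • (ℝ ∙ p N j).starProjection +
    (1 / ((N : ℝ) + 2)) • (ℝ ∙ p N j)ᗮ.starProjection

/-- `S_j x = T_j (x - p_j) + p_j`. -/
noncomputable def S (N : ℕ) (j : Fin N) (x : Y N) : Y N :=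
  T N j (x - p N j) + p N j

/-- The non-empty compact set `Γ = S_i(Γ) ∪ S_j(Γ)`. -/
def Gam (N : ℕ) (i j : Fin N) : Set (Y N) := attractor (fun b : Fin 2 => S N (![i, j] b))

/-! ### The metric `Z` -/

/-- The square of the Hilbert-Schmidt norm: the sum of the squares of the coefficients of the
matrix with respect to an orthonormal basis. -/
noncomputable def hsNormSq (N : ℕ) (A : Y N →L[ℝ] Y N) : ℝ :=
  ∑ a, ∑ b, (inner ℝ (stdOrthonormalBasis ℝ (Y N) a) (A (stdOrthonormalBasis ℝ (Y N) b))) ^ 2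

/-- `T_w = T_{w_1} ⋯ T_{w_m}`. -/
noncomputable def Tword (N : ℕ) (w : List (Fin N)) : Y N →L[ℝ] Y N :=
  (w.map (T N)).prod

/-- `Z_m(ω) = T_w T_wᵗ / ‖T_w‖²`, where `w` consists of the first `m` letters of `ω` and the norm
is the Hilbert-Schmidt norm. -/
noncomputable def Zm (N : ℕ) (ω : ℕ → Fin N) (m : ℕ) : Y N →L[ℝ] Y N :=
  (hsNormSq N (Tword N (trunc ω m)))⁻¹ •
    (Tword N (trunc ω m) * ContinuousLinearMap.adjoint (Tword N (trunc ω m)))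

/-- `Z(ω) = lim_m Z_m(ω)`, where the limit exists. -/
noncomputable def Z (N : ℕ) (ω : ℕ → Fin N) : Y N →L[ℝ] Y N :=
  limUnder atTop (Zm N ω)

/-- `Ψ(π(ω)) = x`, where `π(ω)` is the point of `⋂_m F_{ω_1 ⋯ ω_m}(K)`. -/
def IsAddress (N : ℕ) (ω : ℕ → Fin N) (x : Y N) : Prop :=
  ∃ y ∈ K N, (∀ m, y ∈ wordMap (F N) (trunc ω m) '' K N) ∧
    Psi N y = (x : EuclideanSpace ℝ (Fin N))

open Classical in
/-- `Z_* = Z ∘ π⁻¹ ∘ Ψ⁻¹`. Points of `X` outside `Ψ(V_*)` have exactly one address `ω`; at the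
countably many points of `Ψ(V_*)` one of the addresses is used. -/
noncomputable def Zstar (N : ℕ) (x : Y N) : Y N →L[ℝ] Y N :=
  if h : ∃ ω : ℕ → Fin N, IsAddress N ω x then Z N h.choose else 0

end HarmonicGasket

/-! Harmonic extension from a cell to its subcells is linear, and the maps `S_j` reproduce it:
barycentric coordinates composed with any `S_w` obey the extension rule (`bary_wordMap_S`). Hence
`Ψ` carries each `F_j` to `S_j`, so `X` is the attractor of all the `S_j` (`isAttractor_X`) and
contains `Γ`.

The vectors `p_2 - p_1` and `p_1 + p_2` span a space invariant under `T_1` and `T_2`. In these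
coordinates the linear parts act on slopes by Möbius maps that send `[-1,1]` onto `[-1,0]` and
`[0,1]`. So `Γ` is a convex curve parametrized by its own slope: `γ s` is the point at which a line
of slope `s` supports it, and `γ` is the fixed point of a contraction on such curves
(`exists_slopeCurve`). A corner would be one point belonging to two slopes. Both slope maps strictly
shrink a distance on `[-1,1]` (`slopeGap_slope_lt`), so pulling back a widest corner would give a
wider one. Without corners the slope is a continuous function of the abscissa, and `Γ` is the graph
of a `C^1` function.

Minimality is a convexity argument. Each point of `X` lies below some supporting line
(`X_subset_belowCurve`), while the points above all of them form a convex set. The nearest point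
projection onto this set, followed by the orthogonal projection to the plane of the edge, shortens
no less than a `1`-Lipschitz map does and sends a competing curve to one that runs through all of
`Γ` (`length_le_of_mapsTo_X`).

For the integral, follow the address of a point of `Γ`. The products `T_w` stretch the tangent much
more than their adjoints stretch the vectors orthogonal to the tangent at that point, so `Z_*` is
the projection onto the tangent (`tendsto_Zm`). Outside the countable set `Ψ(V_*)` the integrand is
thus the speed of the graph, which lies between `1` and `2`. -/

namespace HarmonicGasket

/-! ### Iterated function systems -/

section IFS

variable {E E' ι : Type*}

/-- A point of `A` farthest from `B`, if outside `B`, would be the image of a point of `A` even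
farther away. This one principle yields the uniqueness of attractors, the inclusions of `X` in the
simplex and of `Γ` in `X`, and the position of `X` below the curve; the term `B` in `hAf` allows for
cells already known to lie in `B`. -/
theorem subset_of_subset_iUnion_image [PseudoMetricSpace E] {f : ι → E → E} {ρ : ℝ}
    (hρ0 : 0 ≤ ρ) (hρ : ρ < 1) (hf : ∀ i x y, dist (f i x) (f i y) ≤ ρ * dist x y)
    {A B : Set E} (hA : IsCompact A) (hAf : A ⊆ B ∪ ⋃ i, f i '' A) (hB : IsClosed B)
    (hBne : B.Nonempty) (hBf : ∀ i, MapsTo (f i) B B) : A ⊆ B := by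
  rcases A.eq_empty_or_nonempty with rfl | hne
  · exact empty_subset _
  obtain ⟨a, haA, hmax⟩ := hA.exists_isMaxOn hne (Metric.continuous_infDist_pt B).continuousOn
  have hmax' : ∀ x ∈ A, Metric.infDist x B ≤ Metric.infDist a B := fun x hx => hmax hx
  have h0 : Metric.infDist a B ≤ 0 := by
    by_contra! hpos
    rcases hAf haA with haB | haU
    · rw [Metric.infDist_zero_of_mem haB] at hpos
      exact lt_irrefl _ hpos
    · obtain ⟨i, a', ha', rfl⟩ := mem_iUnion.1 haU
      set D := Metric.infDist (f i a') B
      -- The factor `2 / (1 + ρ)` exceeds `1`, but `ρ` times it is still less than `1`.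
      have h1 : Metric.infDist a' B < 2 * D / (1 + ρ) :=
        (hmax' a' ha').trans_lt (by rw [lt_div_iff₀ (by linarith)]; nlinarith)
      obtain ⟨b, hb, hab⟩ := (Metric.infDist_lt_iff hBne).1 h1
      have h2 : D ≤ ρ * dist a' b :=
        (Metric.infDist_le_dist_of_mem (hBf i hb)).trans (hf i a' b)
      rw [lt_div_iff₀ (by linarith)] at hab
      nlinarith [dist_nonneg (x := a') (y := b)]
  intro x hx
  have : Metric.infDist x B = 0 := le_antisymm ((hmax' x hx).trans h0) Metric.infDist_nonneg
  rw [← hB.closure_eq]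
  exact (Metric.mem_closure_iff_infDist_zero hBne).2 this

theorem IsAttractor.mapsTo [TopologicalSpace E] {f : ι → E → E} {C : Set E}
    (hC : IsAttractor f C) (i : ι) : MapsTo (f i) C C := by
  intro x hx
  rw [hC.2.2]
  exact mem_iUnion.2 ⟨i, mem_image_of_mem _ hx⟩

theorem IsAttractor.exists_eq [TopologicalSpace E] {f : ι → E → E} {C : Set E}
    (hC : IsAttractor f C) {x : E} (hx : x ∈ C) : ∃ i, ∃ y ∈ C, f i y = x := by
  rw [hC.2.2] at hx
  simpa using hx

theorem attractor_eq [MetricSpace E] {f : ι → E → E} {ρ : ℝ} (hρ0 : 0 ≤ ρ) (hρ : ρ < 1)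
    (hf : ∀ i x y, dist (f i x) (f i y) ≤ ρ * dist x y) {C : Set E} (hC : IsAttractor f C) :
    attractor f = C := by
  apply Subset.antisymm
  · refine sUnion_subset fun A hA => ?_
    exact subset_of_subset_iUnion_image hρ0 hρ hf hA.2.1 (by
      rw [← hA.2.2]; exact subset_union_right) hC.2.1.isClosed hC.1 hC.mapsTo
  · exact subset_sUnion_of_mem hC

theorem continuous_of_dist_le_mul [PseudoMetricSpace E] [PseudoMetricSpace E'] {f : E → E'} {ρ : ℝ}
    (hf : ∀ x y, dist (f x) (f y) ≤ ρ * dist x y) : Continuous f :=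
  (LipschitzWith.of_dist_le_mul (K := ρ.toNNReal) fun x y => (hf x y).trans
    (mul_le_mul_of_nonneg_right (Real.le_coe_toNNReal ρ) dist_nonneg)).continuous

/-- The orbit `B` of a fixed point of one of the maps satisfies `B = ⋃ i, f i '' B`, the empty word
being covered by `h₀`. It is bounded, and closure commutes with continuous images once it is
compact. -/
theorem isAttractor_closure_range [MetricSpace E] [ProperSpace E] [Fintype ι] {f : ι → E → E}
    {ρ : ℝ} (hρ0 : 0 ≤ ρ) (hρ : ρ < 1) (hf : ∀ i x y, dist (f i x) (f i y) ≤ ρ * dist x y)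
    {x₀ : E} {i₀ : ι} (h₀ : f i₀ x₀ = x₀) :
    IsAttractor f (closure (range fun w => wordMap f w x₀)) := by
  set B := range fun w => wordMap f w x₀
  have hBf : ⋃ i, f i '' B = B := by
    apply Subset.antisymm
    · refine iUnion_subset fun i => ?_
      rintro _ ⟨_, ⟨w, rfl⟩, rfl⟩
      exact ⟨i :: w, rfl⟩
    · rintro _ ⟨w, rfl⟩
      rcases w with _ | ⟨i, w⟩
      · exact mem_iUnion.2 ⟨i₀, x₀, ⟨[], rfl⟩, h₀⟩
      · exact mem_iUnion.2 ⟨i, _, ⟨w, rfl⟩, rfl⟩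
  set c := ∑ i, dist (f i x₀) x₀
  have hBb : B ⊆ Metric.closedBall x₀ (c / (1 - ρ)) := by
    rintro _ ⟨w, rfl⟩
    have hc : 0 ≤ c := Finset.sum_nonneg fun i _ => dist_nonneg
    induction w with
    | nil => exact Metric.mem_closedBall_self (div_nonneg hc (by linarith))
    | cons i w ih =>
      rw [Metric.mem_closedBall, le_div_iff₀ (by linarith)] at ih ⊢
      have h1 : dist (f i x₀) x₀ ≤ c :=
        Finset.single_le_sum (f := fun i => dist (f i x₀) x₀) (fun i _ => dist_nonneg)
          (Finset.mem_univ i)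
      have h2 : dist (f i (wordMap f w x₀)) x₀ ≤ ρ * dist (wordMap f w x₀) x₀ + c :=
        (dist_triangle _ (f i x₀) _).trans (add_le_add (hf _ _ _) h1)
      change dist (f i (wordMap f w x₀)) x₀ * (1 - ρ) ≤ c
      nlinarith
  have hcomp : IsCompact (closure B) :=
    (Metric.isBounded_closedBall.subset hBb).isCompact_closure
  have hcont : ∀ i, Continuous (f i) := fun i => continuous_of_dist_le_mul (hf i)
  refine ⟨⟨x₀, subset_closure ⟨[], rfl⟩⟩, hcomp, ?_⟩
  conv_lhs => rw [← hBf, closure_iUnion_of_finite]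
  congr 1
  ext1 i
  exact (image_closure_of_isCompact hcomp (hcont i).continuousOn).symm

theorem IsAttractor.fixedPoint_mem [MetricSpace E] {f : ι → E → E} {ρ : ℝ}
    (hρ0 : 0 ≤ ρ) (hρ : ρ < 1) (hf : ∀ i x y, dist (f i x) (f i y) ≤ ρ * dist x y) {C : Set E}
    (hC : IsAttractor f C) {i : ι} {x : E} (hx : f i x = x) : x ∈ C := by
  have := subset_of_subset_iUnion_image hρ0 hρ hf (A := {x}) isCompact_singleton (by
    refine subset_union_of_subset_right ?_ _
    rw [singleton_subset_iff]
    exact mem_iUnion.2 ⟨i, x, rfl, hx⟩) hC.2.1.isClosed hC.1 hC.mapsTo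
  exact this rfl

/-- A compact graph is the graph of a continuous function. -/
theorem continuousOn_of_isCompact_graph [MetricSpace E] [MetricSpace E'] {φ : E → E'} {A : Set E}
    (h : IsCompact ((fun x => (x, φ x)) '' A)) : ContinuousOn φ A := by
  rw [continuousOn_iff_isClosed]
  intro t ht
  refine ⟨Prod.fst '' ((fun x => (x, φ x)) '' A ∩ Prod.snd ⁻¹' t), ?_, ?_⟩
  · exact ((h.inter_right (ht.preimage continuous_snd)).image continuous_fst).isClosed
  · ext x
    constructor
    · rintro ⟨hx, hxA⟩
      exact ⟨⟨(x, φ x), ⟨mem_image_of_mem _ hxA, hx⟩, rfl⟩, hxA⟩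
    · rintro ⟨⟨_, ⟨⟨y, hy, rfl⟩, hyt⟩, rfl⟩, hxA⟩
      exact ⟨hyt, hxA⟩

/-- Two iterated function systems whose cells meet only at corresponding vertices are
semiconjugate. -/
theorem exists_semiconj [MetricSpace E] [MetricSpace E'] [ProperSpace E] [ProperSpace E']
    [Fintype ι] [Nonempty ι] {f : ι → E → E} {g : ι → E' → E'} {ρ : ℝ} (hρ0 : 0 ≤ ρ) (hρ : ρ < 1)
    (hf : ∀ i x y, dist (f i x) (f i y) ≤ ρ * dist x y)
    (hg : ∀ i x y, dist (g i x) (g i y) ≤ ρ * dist x y)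
    {C : Set E} (hC : IsAttractor f C) {p : ι → E} {q : ι → E'}
    (hfp : ∀ i, f i (p i) = p i) (hgq : ∀ i, g i (q i) = q i) (hp : Function.Injective p)
    (hfinj : ∀ i, Function.Injective (f i))
    (hfC : ∀ i j, i ≠ j → ∀ x ∈ C, ∀ y ∈ C, f i x = f j y → x = p j ∧ y = p i)
    (hgg : ∀ i j, g i (q j) = g j (q i)) :
    ∃ φ : E → E', ContinuousOn φ C ∧ (∀ i, φ (p i) = q i) ∧ (∀ i, ∀ x ∈ C, φ (f i x) = g i (φ x)) ∧
      IsAttractor g (φ '' C) := by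
  have hh : ∀ i (x y : E × E'), dist (Prod.map (f i) (g i) x) (Prod.map (f i) (g i) y)
      ≤ ρ * dist x y := by
    intro i x y
    rw [Prod.dist_eq, Prod.dist_eq, mul_max_of_nonneg _ _ hρ0]
    exact max_le_max (hf _ _ _) (hg _ _ _)
  obtain ⟨i₀⟩ := ‹Nonempty ι›
  -- The attractor `G` of the product maps will be the graph of `φ`. Its two projections are
  -- attractors again, so only single-valuedness is at stake.
  have hG := isAttractor_closure_range hρ0 hρ hh (x₀ := (p i₀, q i₀)) (i₀ := i₀)
    (by simp [hfp, hgq])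
  set G := closure (range fun w => wordMap (fun i => Prod.map (f i) (g i)) w (p i₀, q i₀))
  have hfst : IsAttractor f (Prod.fst '' G) := by
    refine ⟨hG.1.image _, hG.2.1.image continuous_fst, ?_⟩
    conv_lhs => rw [hG.2.2]
    rw [image_iUnion]
    simp only [image_image, Prod.map_fst]
  have hsnd : IsAttractor g (Prod.snd '' G) := by
    refine ⟨hG.1.image _, hG.2.1.image continuous_snd, ?_⟩
    conv_lhs => rw [hG.2.2]
    rw [image_iUnion]
    simp only [image_image, Prod.map_snd]
  have hfstC : Prod.fst '' G = C := by
    rw [← attractor_eq hρ0 hρ hf hfst, attractor_eq hρ0 hρ hf hC]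
  have hpC : ∀ i, p i ∈ C := fun i => hC.fixedPoint_mem hρ0 hρ hf (hfp i)
  have hGC : ∀ x y, (x, y) ∈ G → x ∈ C := fun x y h => hfstC ▸ mem_image_of_mem Prod.fst h
  -- The vertex `p j` lies in no cell other than the one with index `j`, so the fibre of `G` over it
  -- is contained in its own image under `g j`.
  have hpq : ∀ j y, (p j, y) ∈ G → y = q j := by
    intro j
    have hA : {y | (p j, y) ∈ G} ⊆ {q j} := by
      refine subset_of_subset_iUnion_image (f := fun _ : Unit => g j) hρ0 hρ (fun _ => hg j)
        ?_ ?_ isClosed_singleton (singleton_nonempty _) ?_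
      · have : {y | (p j, y) ∈ G} = Prod.snd '' (G ∩ Prod.fst ⁻¹' {p j}) := by
          ext y
          simp only [mem_ofPred_eq, mem_image, mem_inter_iff, mem_preimage, mem_singleton_iff,
            Prod.exists, exists_eq_right]
        rw [this]
        exact (hG.2.1.inter_right (isClosed_singleton.preimage continuous_fst)).image continuous_snd
      · intro y hy
        right
        obtain ⟨i, ⟨x', y'⟩, hxy, h⟩ := hG.exists_eq hy
        simp only [Prod.map_apply, Prod.mk.injEq] at h
        have hij : i = j := by
          by_contra hne
          have := (hfC i j hne x' (hGC _ _ hxy) (p j) (hpC j) (by rw [h.1, hfp])).2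
          exact hne (hp this).symm
        subst hij
        have : x' = p i := hfinj i (by rw [h.1, hfp])
        subst this
        exact mem_iUnion.2 ⟨(), y', hxy, h.2⟩
      · rintro _ _ rfl
        exact hgq j
    exact fun y hy => hA hy
  -- Consider the compact set of pairs of values over a common point. A pair coming from one cell is
  -- the image of such a pair; a pair coming from two cells sits over a common vertex, where `hpq`
  -- and `hgg` make its members equal.
  have huniq : ∀ x y y', (x, y) ∈ G → (x, y') ∈ G → y = y' := by
    have hA : {z : E' × E' | ∃ x, (x, z.1) ∈ G ∧ (x, z.2) ∈ G} ⊆ {z | z.1 = z.2} := by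
      refine subset_of_subset_iUnion_image (f := fun i => Prod.map (g i) (g i)) hρ0 hρ
        ?_ ?_ ?_ (isClosed_eq continuous_fst continuous_snd) ⟨(q i₀, q i₀), rfl⟩ ?_
      · intro i x y
        rw [Prod.dist_eq, Prod.dist_eq, mul_max_of_nonneg _ _ hρ0]
        exact max_le_max (hg _ _ _) (hg _ _ _)
      · have : {z : E' × E' | ∃ x, (x, z.1) ∈ G ∧ (x, z.2) ∈ G} =
            (fun a : (E × E') × (E × E') => (a.1.2, a.2.2)) ''
              ((G ×ˢ G) ∩ {a | a.1.1 = a.2.1}) := by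
          ext ⟨y, y'⟩
          constructor
          · rintro ⟨x, h1, h2⟩
            exact ⟨((x, y), (x, y')), ⟨⟨h1, h2⟩, rfl⟩, rfl⟩
          · rintro ⟨⟨⟨x, z⟩, ⟨x', z'⟩⟩, ⟨⟨h1, h2⟩, h3⟩, h4⟩
            simp only [mem_ofPred_eq, Prod.mk.injEq] at h3 h4 h1 h2
            obtain ⟨rfl, rfl⟩ := h4
            subst h3
            exact ⟨x, h1, h2⟩
        rw [this]
        exact ((hG.2.1.prod hG.2.1).inter_right (isClosed_eq (by fun_prop) (by fun_prop))).image
          (by fun_prop)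
      · rintro ⟨y, y'⟩ ⟨x, h1, h2⟩
        obtain ⟨i, ⟨x1, y1⟩, hxy1, h3⟩ := hG.exists_eq h1
        obtain ⟨j, ⟨x2, y2⟩, hxy2, h4⟩ := hG.exists_eq h2
        simp only [Prod.map_apply, Prod.mk.injEq] at h3 h4
        by_cases hij : i = j
        · subst hij
          have : x1 = x2 := hfinj i (by rw [h3.1, h4.1])
          subst this
          exact Or.inr (mem_iUnion.2 ⟨i, (y1, y2), ⟨x1, hxy1, hxy2⟩, by simp [h3.2, h4.2]⟩)
        · left
          obtain ⟨rfl, rfl⟩ := hfC i j hij x1 (hGC _ _ hxy1) x2 (hGC _ _ hxy2) (by rw [h3.1, h4.1])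
          change y = y'
          rw [← h3.2, ← h4.2, hpq _ _ hxy1, hpq _ _ hxy2, hgg]
      · rintro i ⟨y, y'⟩ h
        change y = y' at h
        subst h
        rfl
    intro x y y' h h'
    exact @hA (y, y') ⟨x, h, h'⟩
  have hex : ∀ x, ∃ y, x ∈ C → (x, y) ∈ G := by
    intro x
    by_cases hx : x ∈ C
    · rw [← hfstC] at hx
      obtain ⟨⟨x', y⟩, h, rfl⟩ := hx
      exact ⟨y, fun _ => h⟩
    · exact ⟨q i₀, fun h => absurd h hx⟩
  choose φ hφ using hex
  have hgraph : (fun x => (x, φ x)) '' C = G := by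
    apply Subset.antisymm
    · rintro _ ⟨x, hx, rfl⟩
      exact hφ x hx
    · rintro ⟨x, y⟩ h
      have hx := hGC _ _ h
      exact ⟨x, hx, by rw [huniq x y (φ x) h (hφ x hx)]⟩
  refine ⟨φ, continuousOn_of_isCompact_graph (hgraph ▸ hG.2.1), fun i => hpq i _ (hφ _ (hpC i)),
    fun i x hx => ?_, ?_⟩
  · exact huniq _ _ _ (hφ _ (hC.mapsTo i hx)) (hG.mapsTo i (hφ x hx))
  · have : φ '' C = Prod.snd '' G := by
      rw [← hgraph, image_image]
    rw [this]
    exact hsnd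

end IFS

/-! ### Lengths of curves -/

section Curves

variable {E : Type*}

theorem eVariationOn_mono_edist {α F : Type*} [LinearOrder α] [PseudoEMetricSpace E]
    [PseudoEMetricSpace F] {f : α → E} {g : α → F} {s : Set α}
    (h : ∀ x ∈ s, ∀ y ∈ s, edist (f x) (f y) ≤ edist (g x) (g y)) :
    eVariationOn f s ≤ eVariationOn g s :=
  iSup_mono fun u => Finset.sum_le_sum fun _ _ => h _ (u.2.2.2 _) _ (u.2.2.2 _)

/-- With `V` the variation and `W` the integral of the speed up to a point, increments satisfy `‖Δg‖
≤ ΔV ≤ ΔW` to the right. The outer terms agree up to `o(Δx)`, so `W - V` has derivative zero. -/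
theorem eVariationOn_eq_integral_norm [NormedAddCommGroup E] [NormedSpace ℝ E] [CompleteSpace E]
    {g g' : ℝ → E} (hg : ∀ t ∈ Icc (0 : ℝ) 1, HasDerivWithinAt g (g' t) (Icc 0 1) t)
    (hg' : Continuous g') :
    eVariationOn g (Icc 0 1) = ENNReal.ofReal (∫ t in (0 : ℝ)..1, ‖g' t‖) := by
  set W : ℝ → ℝ := fun x => ∫ t in (0 : ℝ)..x, ‖g' t‖ with hW
  have hint : ∀ a b, IntervalIntegrable (fun t => ‖g' t‖) volume a b := fun a b =>
    hg'.norm.intervalIntegrable a b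
  have hWsub : ∀ x y, W y - W x = ∫ t in x..y, ‖g' t‖ := fun x y =>
    intervalIntegral.integral_interval_sub_left (hint _ _) (hint _ _)
  have hWd : ∀ x, HasDerivAt W ‖g' x‖ x := fun x =>
    intervalIntegral.integral_hasDerivAt_right (hint _ _)
      hg'.norm.stronglyMeasurable.stronglyMeasurableAtFilter hg'.norm.continuousAt
  have hWmono : Monotone W := fun x y hxy => by
    rw [← sub_nonneg, hWsub]
    exact intervalIntegral.integral_nonneg hxy fun _ _ => norm_nonneg _
  have hgc : ContinuousOn g (Icc 0 1) := fun t ht => (hg t ht).continuousWithinAt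
  have hle : ∀ x ∈ Icc (0 : ℝ) 1, ∀ y ∈ Icc (0 : ℝ) 1, x ≤ y → ‖g y - g x‖ ≤ W y - W x := by
    intro x hx y hy hxy
    have hsub : Icc x y ⊆ Icc (0 : ℝ) 1 := Icc_subset_Icc hx.1 hy.2
    have : ∫ t in x..y, g' t = g y - g x := by
      refine intervalIntegral.integral_eq_sub_of_hasDeriv_right_of_le hxy (hgc.mono hsub) ?_
        (hg'.intervalIntegrable _ _)
      intro t ht
      have ht' : t ∈ Ioo (0 : ℝ) 1 := ⟨hx.1.trans_lt ht.1, ht.2.trans_le hy.2⟩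
      exact ((hg t (Ioo_subset_Icc_self ht')).hasDerivAt (Icc_mem_nhds ht'.1 ht'.2)).hasDerivWithinAt
    rw [← this, hWsub]
    exact intervalIntegral.norm_integral_le_integral_norm hxy
  have hledist : ∀ x ∈ Icc (0 : ℝ) 1, ∀ y ∈ Icc (0 : ℝ) 1, edist (g x) (g y) ≤ edist (W x) (W y) := by
    intro x hx y hy
    rw [edist_dist, edist_dist]
    apply ENNReal.ofReal_le_ofReal
    rcases le_total x y with h | h
    · rw [dist_comm, dist_comm (W x), dist_eq_norm, dist_eq_norm]
      exact (hle x hx y hy h).trans (le_abs_self _)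
    · rw [dist_eq_norm, dist_eq_norm]
      exact (hle y hy x hx h).trans (le_abs_self _)
  have hbv : ∀ a b, a ∈ Icc (0 : ℝ) 1 → b ∈ Icc (0 : ℝ) 1 → a ≤ b →
      eVariationOn g (Icc a b) ≤ ENNReal.ofReal (W b - W a) := by
    intro a b ha hb hab
    have hsub : Icc a b ⊆ Icc (0 : ℝ) 1 := Icc_subset_Icc ha.1 hb.2
    refine (eVariationOn_mono_edist fun x hx y hy => hledist x (hsub hx) y (hsub hy)).trans ?_
    have := (hWmono.monotoneOn (Icc a b)).eVariationOn_eq (left_mem_Icc.2 hab) (right_mem_Icc.2 hab)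
    rw [inter_self] at this
    exact this.le
  have h01 : (0 : ℝ) ∈ Icc (0 : ℝ) 1 := by simp
  have h11 : (1 : ℝ) ∈ Icc (0 : ℝ) 1 := by simp
  have hfin : ∀ a b, a ∈ Icc (0 : ℝ) 1 → b ∈ Icc (0 : ℝ) 1 → a ≤ b →
      eVariationOn g (Icc a b) ≠ ∞ := fun a b ha hb hab =>
    ne_top_of_le_ne_top ENNReal.ofReal_ne_top (hbv a b ha hb hab)
  set V : ℝ → ℝ := fun x => (eVariationOn g (Icc 0 x)).toReal with hV
  have hVsub : ∀ x ∈ Icc (0 : ℝ) 1, ∀ y ∈ Icc (0 : ℝ) 1, x ≤ y →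
      V y - V x = (eVariationOn g (Icc x y)).toReal := by
    intro x hx y hy hxy
    have := eVariationOn.Icc_add_Icc g (s := univ) hx.1 hxy (mem_univ x)
    simp only [univ_inter] at this
    rw [hV]
    simp only
    rw [← this, ENNReal.toReal_add (hfin _ _ h01 hx hx.1) (hfin _ _ hx hy hxy)]
    ring
  have hVle : ∀ x ∈ Icc (0 : ℝ) 1, ∀ y ∈ Icc (0 : ℝ) 1, x ≤ y →
      ‖g y - g x‖ ≤ V y - V x ∧ V y - V x ≤ W y - W x := by
    intro x hx y hy hxy
    rw [hVsub x hx y hy hxy]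
    constructor
    · rw [← dist_eq_norm, dist_edist]
      exact ENNReal.toReal_mono (hfin _ _ hx hy hxy)
        (eVariationOn.edist_le _ (right_mem_Icc.2 hxy) (left_mem_Icc.2 hxy))
    · exact ENNReal.toReal_le_of_le_ofReal (sub_nonneg.2 (hWmono hxy)) (hbv x y hx hy hxy)
  have hU : ∀ x ∈ Icc (0 : ℝ) 1, HasDerivWithinAt (fun x => W x - V x) 0 (Icc 0 1) x := by
    intro x hx
    rw [hasDerivWithinAt_iff_isLittleO]
    have h1 := hasDerivWithinAt_iff_isLittleO.1 ((hWd x).hasDerivWithinAt (s := Icc (0 : ℝ) 1))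
    have h2 := hasDerivWithinAt_iff_isLittleO.1 (hg x hx)
    refine Asymptotics.IsBigO.trans_isLittleO ?_ (h1.norm_left.add h2.norm_left)
    refine Asymptotics.IsBigO.of_bound 1 ?_
    filter_upwards [self_mem_nhdsWithin] with y hy
    rw [smul_zero, sub_zero, one_mul]
    refine le_trans ?_ (Real.le_norm_self _)
    simp only [smul_eq_mul, Real.norm_eq_abs]
    have hkey : ‖(y - x) • g' x‖ ≤ ‖g y - g x‖ + ‖g y - g x - (y - x) • g' x‖ := by
      have := norm_sub_le (g y - g x) (g y - g x - (y - x) • g' x)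
      simpa using this
    rw [norm_smul, Real.norm_eq_abs] at hkey
    rcases le_total x y with h | h
    · obtain ⟨h3, h4⟩ := hVle x hx y hy h
      rw [abs_of_nonneg (sub_nonneg.2 h)] at hkey
      rw [abs_of_nonneg (by linarith)]
      have := le_abs_self (W y - W x - (y - x) * ‖g' x‖)
      linarith
    · obtain ⟨h3, h4⟩ := hVle y hy x hx h
      rw [norm_sub_rev] at h3
      rw [abs_of_nonpos (sub_nonpos.2 h)] at hkey
      rw [abs_of_nonpos (by linarith)]
      have := neg_le_abs (W y - W x - (y - x) * ‖g' x‖)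
      linarith
  have hconst : W 1 - V 1 = W 0 - V 0 := by
    refine constant_of_derivWithin_zero (f := fun x => W x - V x) (a := 0) (b := 1) ?_ ?_ 1 h11
    · exact fun x hx => (hU x hx).differentiableWithinAt
    · intro x hx
      exact (hU x (Ico_subset_Icc_self hx)).derivWithin
        (uniqueDiffOn_Icc zero_lt_one x (Ico_subset_Icc_self hx))
  have hW0 : W 0 = 0 := by simp [hW]
  have hV0 : V 0 = 0 := by
    simp only [hV, Icc_self]
    rw [eVariationOn.subsingleton g subsingleton_singleton, ENNReal.toReal_zero]
  have : V 1 = W 1 := by linarith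
  rw [← ENNReal.ofReal_toReal (hfin 0 1 h01 h11 zero_le_one)]
  exact congrArg _ this

/-- If `σ t = g (τ t)` whenever `τ t ∈ [0,1]`, where `τ` is a continuous function with
`τ 0 = 0` and `τ 1 = 1`, then `σ` is at least as long as `g`. -/
theorem eVariationOn_le_of_eq_comp [PseudoEMetricSpace E] {g σ : ℝ → E} {τ : ℝ → ℝ}
    (hτ : ContinuousOn τ (Icc 0 1)) (h0 : τ 0 = 0) (h1 : τ 1 = 1)
    (h : ∀ t ∈ Icc (0 : ℝ) 1, τ t ∈ Icc (0 : ℝ) 1 → σ t = g (τ t)) :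
    eVariationOn g (Icc 0 1) ≤ eVariationOn σ (Icc 0 1) := by
  set A : ℝ → Set ℝ := fun u => Icc 0 1 ∩ τ ⁻¹' (Ici u)
  have hA : ∀ u, IsCompact (A u) := fun u =>
    isCompact_Icc.of_isClosed_subset (hτ.preimage_isClosed_of_isClosed isClosed_Icc isClosed_Ici)
      inter_subset_left
  have hne : ∀ u ∈ Icc (0 : ℝ) 1, (A u).Nonempty := fun u hu =>
    ⟨1, by simp, by simpa [h1] using hu.2⟩
  have hbdd : ∀ u, BddBelow (A u) := fun u => ⟨0, fun t ht => ht.1.1⟩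
  -- `θ u` is the first time at which `τ` reaches the level `u`. It is a monotone right inverse of
  -- `τ`; it may jump, which is harmless for the variation of a composition.
  set θ : ℝ → ℝ := fun u => sInf (A u)
  have hθ : ∀ u ∈ Icc (0 : ℝ) 1, θ u ∈ A u := fun u hu => (hA u).sInf_mem (hne u hu)
  have hτθ : ∀ u ∈ Icc (0 : ℝ) 1, τ (θ u) = u := by
    intro u hu
    obtain ⟨h2, h3⟩ := hθ u hu
    obtain ⟨t, ht, htu⟩ := intermediate_value_Icc h2.1 (hτ.mono (Icc_subset_Icc_right h2.2))
      (show u ∈ Icc (τ 0) (τ (θ u)) from ⟨by rw [h0]; exact hu.1, h3⟩)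
    have : θ u ≤ t := csInf_le (hbdd u) ⟨⟨ht.1, ht.2.trans h2.2⟩, htu.ge⟩
    rw [le_antisymm this ht.2, htu]
  have hmono : MonotoneOn θ (Icc 0 1) := fun u _ w hw huw =>
    csInf_le_csInf (hbdd u) (hne w hw) (inter_subset_inter_right _ (preimage_mono (Ici_subset_Ici.2 huw)))
  have heq : EqOn g (σ ∘ θ) (Icc 0 1) := by
    intro u hu
    have := h (θ u) (hθ u hu).1 (by rw [hτθ u hu]; exact hu)
    rw [Function.comp_apply, this, hτθ u hu]
  rw [eVariationOn.eq_of_eqOn heq]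
  exact eVariationOn.comp_le_of_monotoneOn σ θ hmono fun u hu => (hθ u hu).1

/-- The length of an arc that is a graph over `[0,1]`. -/
theorem arcLength_eq [PseudoEMetricSpace E] {g : ℝ → E} {C : Set E} {ξ : E → ℝ}
    (hg : IsSimpleParam g C) (hξ : Continuous ξ) (hξg : ∀ t ∈ Icc (0 : ℝ) 1, ξ (g t) = t) :
    arcLength C = length g := by
  apply le_antisymm
  · exact iInf₂_le g hg
  · refine le_iInf₂ fun σ hσ => ?_
    have hmem : ∀ t ∈ Icc (0 : ℝ) 1, ∃ u ∈ Icc (0 : ℝ) 1, g u = σ t := by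
      intro t ht
      have : σ t ∈ C := hσ.2.2 ▸ mem_image_of_mem _ ht
      rwa [← hg.2.2] at this
    -- The change of parameter between the two parametrizations. Being continuous and injective on
    -- an interval, it is strictly monotone in one direction or the other.
    set φ := ξ ∘ σ
    have hσφ : EqOn σ (g ∘ φ) (Icc 0 1) := by
      intro t ht
      obtain ⟨u, hu, h⟩ := hmem t ht
      simp only [φ, Function.comp_apply, ← h, hξg u hu]
    have hφ : ContinuousOn φ (Icc 0 1) := hξ.comp_continuousOn hσ.1
    have hφinj : InjOn φ (Icc 0 1) := by
      intro t ht t' ht' h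
      apply hσ.2.1 ht ht'
      rw [hσφ ht, hσφ ht', Function.comp_apply, Function.comp_apply, h]
    have himg : φ '' Icc 0 1 = Icc 0 1 := by
      rw [image_comp, hσ.2.2, ← hg.2.2, image_image]
      exact (image_congr hξg).trans (image_id' _)
    have : eVariationOn σ (Icc 0 1) = eVariationOn g (Icc 0 1) := by
      rw [eVariationOn.eq_of_eqOn hσφ]
      rcases hφ.strictMonoOn_of_injOn_Icc' zero_le_one hφinj with h | h
      · rw [eVariationOn.comp_eq_of_monotoneOn g φ h.monotoneOn, himg]
      · rw [eVariationOn.comp_eq_of_antitoneOn g φ h.antitoneOn, himg]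
    exact this.ge

end Curves

/-! ### Nearest point projections -/

/-- The sum of the two angle inequalities is `‖π x - π y‖² ≤ ⟨x - y, π x - π y⟩`, and Cauchy–Schwarz
gives the Lipschitz bound. The angle inequality is kept in the conclusion because it later places `π
x` on a supporting line. -/
theorem exists_convex_projection {E : Type*} [NormedAddCommGroup E] [InnerProductSpace ℝ E]
    [CompleteSpace E] {C : Set E} (hne : C.Nonempty) (hC : IsClosed C) (hconv : Convex ℝ C) :
    ∃ π : E → E, LipschitzWith 1 π ∧ ∀ x, π x ∈ C ∧ ∀ c ∈ C, inner ℝ (x - π x) (c - π x) ≤ 0 := by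
  have h : ∀ x, ∃ y, y ∈ C ∧ ∀ c ∈ C, inner ℝ (x - y) (c - y) ≤ 0 := by
    intro x
    obtain ⟨y, hy, hxy⟩ := exists_norm_eq_iInf_of_complete_convex hne hC.isComplete hconv x
    exact ⟨y, hy, (norm_eq_iInf_iff_real_inner_le_zero hconv hy).1 hxy⟩
  choose π hπ using h
  refine ⟨π, LipschitzWith.of_dist_le_mul fun x y => ?_, hπ⟩
  have h1 := (hπ x).2 (π y) (hπ y).1
  have h2 := (hπ y).2 (π x) (hπ x).1
  have h3 : ‖π x - π y‖ ^ 2 ≤ inner ℝ (x - y) (π x - π y) := by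
    rw [← real_inner_self_eq_norm_sq]
    have e : inner ℝ (x - y) (π x - π y) - inner ℝ (π x - π y) (π x - π y)
        = -inner ℝ (x - π x) (π y - π x) - inner ℝ (y - π y) (π x - π y) := by
      simp only [inner_sub_left, inner_sub_right]
      ring
    linarith
  have h4 := real_inner_le_norm (x - y) (π x - π y)
  rw [NNReal.coe_one, one_mul, dist_eq_norm, dist_eq_norm]
  by_contra! hlt
  have h5 : 0 ≤ ‖x - y‖ := norm_nonneg _
  nlinarith

/-! ### The simplex and the affine maps -/

section Simplex

variable {N : ℕ}

theorem inner_smulY_right (x y : Y N) (c : ℝ) : inner ℝ x (c • y) = c * inner ℝ x y :=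
  real_inner_smul_right x y c

theorem inner_smulY_left (x y : Y N) (c : ℝ) : inner ℝ (c • x) y = c * inner ℝ x y :=
  real_inner_smul_left x y c

theorem cast_ne_zero_of_fin (j : Fin N) : (N : ℝ) ≠ 0 := by
  have := j.pos
  positivity

theorem p_apply (j k : Fin N) :
    (p N j : EuclideanSpace ℝ (Fin N)) k = (Real.sqrt 2)⁻¹ * ((if k = j then 1 else 0) - 1 / (N : ℝ)) :=
  rfl

theorem sum_coe_eq_zero (x : Y N) : ∑ k, (x : EuclideanSpace ℝ (Fin N)) k = 0 := x.2

theorem inner_p (j : Fin N) (x : Y N) :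
    inner ℝ (p N j) x = (Real.sqrt 2)⁻¹ * (x : EuclideanSpace ℝ (Fin N)) j := by
  rw [Submodule.coe_inner, PiLp.inner_apply]
  simp only [p_apply, RCLike.inner_apply, conj_trivial]
  have : ∀ k, (x : EuclideanSpace ℝ (Fin N)) k *
      ((Real.sqrt 2)⁻¹ * ((if k = j then 1 else 0) - 1 / (N : ℝ))) =
      (Real.sqrt 2)⁻¹ * (if k = j then (x : EuclideanSpace ℝ (Fin N)) k else 0) -
      (Real.sqrt 2)⁻¹ * (1 / (N : ℝ)) * (x : EuclideanSpace ℝ (Fin N)) k := by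
    intro k
    split_ifs <;> ring
  simp only [this, Finset.sum_sub_distrib, ← Finset.mul_sum, sum_coe_eq_zero]
  simp

theorem inner_p_p (i j : Fin N) :
    inner ℝ (p N i) (p N j) = ((if i = j then 1 else 0) - 1 / (N : ℝ)) / 2 := by
  rw [inner_p, p_apply, ← mul_assoc, ← mul_inv, Real.mul_self_sqrt zero_le_two]
  ring

theorem ext_inner_p {x y : Y N} (h : ∀ j, inner ℝ (p N j) x = inner ℝ (p N j) y) : x = y := by
  apply Subtype.ext
  ext j
  have := h j
  rw [inner_p, inner_p] at this
  exact mul_left_cancel₀ (by positivity) this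

theorem sum_inner_p (x : Y N) : ∑ j, inner ℝ (p N j) x = 0 := by
  simp only [inner_p, ← Finset.mul_sum, sum_coe_eq_zero, mul_zero]

theorem sum_p : ∑ j, p N j = 0 := by
  refine ext_inner_p fun i => ?_
  rw [inner_sum, inner_zero_right, ← sum_inner_p (p N i)]
  exact Finset.sum_congr rfl fun j _ => real_inner_comm _ _

/-- The barycentric coordinates with respect to the points `p_j`. -/
noncomputable def bary (j : Fin N) (x : Y N) : ℝ := 2 * inner ℝ (p N j) x + 1 / (N : ℝ)

theorem bary_p (j k : Fin N) : bary j (p N k) = if k = j then 1 else 0 := by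
  rw [bary, inner_p_p]
  simp only [eq_comm (a := j)]
  ring

theorem sum_bary (hN : 0 < N) (x : Y N) : ∑ j, bary j x = 1 := by
  simp only [bary, Finset.sum_add_distrib, ← Finset.mul_sum, sum_inner_p]
  simp [hN.ne']

theorem ext_bary {x y : Y N} (h : ∀ j, bary j x = bary j y) : x = y :=
  ext_inner_p fun j => by
    have := h j
    simp only [bary] at this
    linarith

theorem continuous_bary (j : Fin N) : Continuous (bary j) := by
  unfold bary
  fun_prop

theorem p_injective : Function.Injective (p N) := by
  intro i j h
  have h1 := bary_p i i
  rw [h, bary_p] at h1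
  by_contra hne
  rw [if_neg (fun h => hne h.symm), if_pos rfl] at h1
  exact zero_ne_one h1

/-- A point of the simplex with a full barycentric coordinate is a vertex. -/
theorem eq_p_of_one_le_bary {x : Y N} (hx : ∀ j, 0 ≤ bary j x) {k : Fin N} (hk : 1 ≤ bary k x) :
    x = p N k := by
  have hsum := sum_bary k.pos x
  rw [← Finset.add_sum_erase _ _ (Finset.mem_univ k)] at hsum
  have h0 := Finset.sum_nonneg (s := Finset.univ.erase k) fun j _ => hx j
  refine ext_bary fun j => ?_
  rw [bary_p]
  split_ifs with h
  · subst h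
    linarith
  · have := (Finset.sum_eq_zero_iff_of_nonneg (fun j _ => hx j)).1
      (show ∑ j ∈ Finset.univ.erase k, bary j x = 0 by linarith) j
      (Finset.mem_erase.2 ⟨fun h' => h h'.symm, Finset.mem_univ j⟩)
    exact this

theorem bary_F (j l : Fin N) (x : Y N) :
    bary l (F N j x) = (bary l x + if j = l then 1 else 0) / 2 := by
  rw [← bary_p]
  simp only [bary, F, inner_add_right, inner_smulY_right, inner_sub_right]
  ring

theorem F_p (j : Fin N) : F N j (p N j) = p N j := by simp [F]

theorem F_comm (i j : Fin N) : F N i (p N j) = F N j (p N i) := by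
  refine ext_bary fun l => ?_
  simp only [bary_F, bary_p]
  ring

theorem dist_F (j : Fin N) (x y : Y N) : dist (F N j x) (F N j y) = 1 / 2 * dist x y := by
  rw [dist_eq_norm, dist_eq_norm, F, F, add_sub_add_right_eq_sub, ← smul_sub, norm_smul,
    sub_sub_sub_cancel_right, Real.norm_of_nonneg (by norm_num)]

theorem norm_p_sq (j : Fin N) : ‖p N j‖ ^ 2 = (1 - 1 / (N : ℝ)) / 2 := by
  rw [← real_inner_self_eq_norm_sq, inner_p_p, if_pos rfl]

/-- A scalar plus a rank one term: as `‖p_j‖² = (N - 1) / (2N)`, the coefficient `2N` raises the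
eigenvalue of `p_j` to `N / (N + 2)`. For `N = 1` the vector `p_j` is zero and is treated apart. -/
theorem T_apply (j : Fin N) (x : Y N) :
    T N j x = (1 / ((N : ℝ) + 2)) • (x + (2 * N * inner ℝ (p N j) x) • p N j) := by
  have hN := cast_ne_zero_of_fin j
  have hN2 : (N : ℝ) + 2 ≠ 0 := by positivity
  simp only [T, add_apply, smul_apply,
    Submodule.starProjection_orthogonal_val, Submodule.starProjection_singleton]
  rcases eq_or_ne (N : ℝ) 1 with h1 | h1
  · have hp : p N j = 0 := by
      rw [← norm_eq_zero, ← sq_eq_zero_iff, norm_p_sq, h1]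
      norm_num
    simp [hp]
  · have h2 : (N : ℝ) - 1 ≠ 0 := sub_ne_zero.2 h1
    have hps : ((‖p N j‖ ^ 2 : ℝ)) = (N - 1) / (2 * N) := by
      rw [norm_p_sq]
      field_simp
    simp only [RCLike.ofReal_real_eq_id, id_eq]
    rw [hps]
    match_scalars <;> field_simp <;> ring

theorem inner_T (j : Fin N) (x y : Y N) : inner ℝ (T N j x) y = inner ℝ x (T N j y) := by
  simp only [T_apply, inner_smulY_left, inner_smulY_right, inner_add_left, inner_add_right,
    real_inner_comm (p N j) x]
  ring

theorem adjoint_T (j : Fin N) : ContinuousLinearMap.adjoint (T N j) = T N j :=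
  ((ContinuousLinearMap.eq_adjoint_iff _ _).2 (inner_T j)).symm

theorem norm_T_le (j : Fin N) (x : Y N) : ‖T N j x‖ ≤ N / (N + 2) * ‖x‖ := by
  have hN : (1 : ℝ) ≤ N := by exact_mod_cast j.pos
  set c : ℝ := inner ℝ (p N j) x with hc
  have h1 : c ^ 2 ≤ (1 - 1 / (N : ℝ)) / 2 * ‖x‖ ^ 2 := by
    rw [← norm_p_sq j, ← mul_pow, ← sq_abs c]
    exact pow_le_pow_left₀ (abs_nonneg _) (abs_real_inner_le_norm _ _) 2
  have h2 : ‖x + (2 * N * c) • p N j‖ ^ 2 ≤ (N * ‖x‖) ^ 2 := by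
    rw [norm_add_sq_real, inner_smulY_right, real_inner_comm, ← hc, norm_smul, mul_pow, norm_p_sq,
      Real.norm_eq_abs, sq_abs]
    have e : (2 * N * c) ^ 2 * ((1 - 1 / (N : ℝ)) / 2) = 2 * N * (N - 1) * c ^ 2 := by
      field_simp
    have e2 : (1 - 1 / (N : ℝ)) / 2 * ‖x‖ ^ 2 * (2 * N * (N + 1)) = (N ^ 2 - 1) * ‖x‖ ^ 2 := by
      field_simp
      ring
    have := mul_le_mul_of_nonneg_right h1 (show (0 : ℝ) ≤ 2 * N * (N + 1) by positivity)
    rw [e2] at this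
    rw [e]
    nlinarith
  have h3 := abs_le_of_sq_le_sq h2 (by positivity)
  rw [abs_of_nonneg (norm_nonneg _)] at h3
  rw [T_apply, norm_smul, Real.norm_of_nonneg (by positivity), ← hc, div_mul_eq_mul_div,
    div_mul_eq_mul_div, one_mul]
  gcongr

theorem dist_S_le (j : Fin N) (x y : Y N) : dist (S N j x) (S N j y) ≤ N / (N + 2) * dist x y := by
  rw [dist_eq_norm, dist_eq_norm, S, S, add_sub_add_right_eq_sub, ← map_sub,
    sub_sub_sub_cancel_right]
  exact norm_T_le _ _

theorem T_injective (j : Fin N) : Function.Injective (T N j) := by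
  have hN := cast_ne_zero_of_fin j
  have hN2 : (N : ℝ) + 2 ≠ 0 := by positivity
  rw [injective_iff_map_eq_zero]
  intro x hx
  rw [T_apply, smul_eq_zero_iff_right (by positivity)] at hx
  have h1 := congrArg (inner ℝ (p N j)) hx
  rw [inner_add_right, inner_smulY_right, inner_p_p, if_pos rfl, inner_zero_right] at h1
  have h2 : inner ℝ (p N j) x = 0 := by
    field_simp at h1
    have h3 : (N : ℝ) * inner ℝ (p N j) x = 0 := by linarith
    exact (mul_eq_zero.1 h3).resolve_left hN
  simpa [h2] using hx

theorem S_injective (j : Fin N) : Function.Injective (S N j) := by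
  intro x y h
  simpa [S] using T_injective j (add_right_cancel h)

theorem S_p_self (j : Fin N) : S N j (p N j) = p N j := by simp [S]

theorem bary_S (j l : Fin N) (x : Y N) :
    bary l (S N j x) =
      (bary l x + 1 - bary j x + if j = l then N * bary j x + 1 else 0) / (N + 2) := by
  have hN := cast_ne_zero_of_fin j
  have hN2 : (N : ℝ) + 2 ≠ 0 := by positivity
  simp only [bary, S, T_apply, inner_add_right, inner_smulY_right, inner_sub_right, inner_p_p,
    eq_comm (a := l)]
  by_cases h : j = l
  · subst h
    simp only [if_true]
    field_simp
    ring
  · simp only [h, if_false, if_true]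
    field_simp
    ring

/-- Since the points `p_l` sum to zero, this is the harmonic extension rule of `harmExt` for the
vector-valued boundary data `p_1, …, p_N`. -/
theorem S_p_of_ne {i j : Fin N} (h : i ≠ j) :
    S N i (p N j) = (1 / ((N : ℝ) + 2)) • (p N i + p N j) := by
  have hN := cast_ne_zero_of_fin j
  have hN2 : (N : ℝ) + 2 ≠ 0 := by positivity
  rw [S, T_apply, inner_sub_right, inner_p_p, inner_p_p, if_pos rfl, if_neg h]
  match_scalars <;> field_simp <;> ring

theorem S_comm (i j : Fin N) : S N i (p N j) = S N j (p N i) := by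
  rcases eq_or_ne i j with rfl | h
  · rfl
  · rw [S_p_of_ne h, S_p_of_ne h.symm, add_comm (p N i)]

/-- In barycentric coordinates, comparing the `i`-th ones gives `N x_i + 1 = y_i - y_j ≤ 1`, hence
`x_i = 0`; comparing the `j`-th ones gives `x_j - x_i = 1 + N y_j ≥ 1`. So `x` has full `j`-th
coordinate. -/
theorem eq_p_of_S_eq_S {i j : Fin N} (hij : i ≠ j) {x y : Y N} (hx : ∀ l, 0 ≤ bary l x)
    (hy : ∀ l, 0 ≤ bary l y) (h : S N i x = S N j y) : x = p N j := by
  have hN : (0 : ℝ) < N := by exact_mod_cast i.pos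
  have h1 := congrArg (bary i) h
  have h2 := congrArg (bary j) h
  simp only [bary_S, if_true, if_neg hij, if_neg hij.symm, add_zero] at h1 h2
  rw [div_left_inj' (by positivity)] at h1 h2
  have hle : ∀ {z : Y N}, (∀ l, 0 ≤ bary l z) → ∀ {a b : Fin N}, a ≠ b →
      bary a z + bary b z ≤ 1 := by
    intro z hz a b hab
    rw [← sum_bary i.pos z, ← Finset.sum_pair (f := fun l => bary l z) hab]
    exact Finset.sum_le_sum_of_subset_of_nonneg (Finset.subset_univ _) fun l _ _ => hz l
  have h3 := hle hx hij
  have h4 := hle hy hij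
  have h5 := mul_nonneg hN.le (hx i)
  have h6 := mul_nonneg hN.le (hy j)
  apply eq_p_of_one_le_bary hx
  have h7 : (N : ℝ) * bary i x ≤ 0 := by linarith [hy j]
  have h8 : bary i x = 0 := by
    have := le_antisymm h7 h5
    exact (mul_eq_zero.1 this).resolve_left hN.ne'
  linarith

theorem eq_p_of_F_eq_F {i j : Fin N} (hij : i ≠ j) {x y : Y N} (hx : ∀ l, 0 ≤ bary l x)
    (hy : ∀ l, 0 ≤ bary l y) (h : F N i x = F N j y) : x = p N j := by
  have h2 := congrArg (bary j) h
  simp only [bary_F, if_true, if_neg hij] at h2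
  apply eq_p_of_one_le_bary hx
  linarith [hy j]

theorem F_injective (j : Fin N) : Function.Injective (F N j) := by
  intro x y h
  rw [← dist_eq_zero, dist_F] at h
  simpa using h

theorem Fword_append (f : Fin N → Y N → Y N) (w : List (Fin N)) (k : Fin N) (x : Y N) :
    wordMap f (w ++ [k]) x = wordMap f w (f k x) := by
  induction w with
  | nil => rfl
  | cons i w ih => exact congrArg (f i) ih

theorem wordMap_S_sub (w : List (Fin N)) (x y : Y N) :
    wordMap (S N) w x - wordMap (S N) w y = Tword N w (x - y) := by
  induction w with
  | nil => simp [wordMap, Tword]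
  | cons i w ih =>
    have : wordMap (S N) (i :: w) x - wordMap (S N) (i :: w) y =
        T N i (wordMap (S N) w x - wordMap (S N) w y) := by
      simp [wordMap, S]
    rw [this, ih]
    simp [Tword]

theorem wordMap_S_injective (w : List (Fin N)) : Function.Injective (wordMap (S N) w) := by
  induction w with
  | nil => exact Function.injective_id
  | cons i w ih => exact (S_injective i).comp ih

end Simplex

/-! ### Energies and harmonic functions -/

section Energy

variable {N : ℕ}

theorem sum_sq_sub (x : Fin N → ℝ) :
    ∑ i, ∑ j, (x i - x j) ^ 2 = 2 * N * ∑ i, x i ^ 2 - 2 * (∑ i, x i) ^ 2 := by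
  have : ∀ i j, (x i - x j) ^ 2 = x i ^ 2 + x j ^ 2 - 2 * (x i * x j) := fun i j => by ring
  simp only [this, Finset.sum_sub_distrib, Finset.sum_add_distrib, ← Finset.mul_sum,
    ← Finset.sum_mul]
  simp only [Finset.sum_const, Finset.card_univ, Fintype.card_fin, nsmul_eq_mul, ← Finset.mul_sum]
  ring

/-- The values on the level one vertices `F_k p_i` of the harmonic extension of `h`. -/
noncomputable def harmExt (h : Fin N → ℝ) (k i : Fin N) : ℝ :=
  if k = i then h k else (h i + h k + ∑ l, h l) / (N + 2)

/-- The energy on level one of a function is the energy of its boundary values plus the energy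
of its difference to the harmonic extension. -/
theorem cell_energy (h : Fin N → ℝ) (m : Fin N → Fin N → ℝ) (hd : ∀ k, m k k = h k)
    (hs : ∀ k i, m k i = m i k) :
    ((N : ℝ) + 2) / N * ∑ k, ∑ i, ∑ j, (m k i - m k j) ^ 2 =
      ∑ i, ∑ j, (h i - h j) ^ 2 + ((N : ℝ) + 2) / N * ∑ k, ∑ i, ∑ j,
        ((m k i - harmExt h k i) - (m k j - harmExt h k j)) ^ 2 := by
  rcases N.eq_zero_or_pos with rfl | hN
  · simp
  have hN' : (N : ℝ) ≠ 0 := by positivity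
  have hN2 : (N : ℝ) + 2 ≠ 0 := by positivity
  set H := ∑ l, h l with hH
  set d : Fin N → Fin N → ℝ := fun k i => m k i - harmExt h k i with hdd
  -- On the cell of index `k` the harmonic extension is split into its mean `c k` and a part `b k`
  -- of mean zero; `d` is the deviation of `m` from it.
  set c : Fin N → ℝ := fun k => (2 * h k + H) / (N + 2) with hc
  set b : Fin N → Fin N → ℝ := fun k i =>
    ((h i - h k) + if k = i then N * h k - H else 0) / (N + 2) with hb
  have hd0 : ∀ k, d k k = 0 := fun k => by simp [hdd, harmExt, hd]
  have hds : ∀ k i, d k i = d i k := by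
    intro k i
    simp only [hdd, harmExt, hs k i, eq_comm (a := i) (b := k)]
    split_ifs with hki
    · rw [hki]
    · ring
  have hm : ∀ k i, m k i = c k + b k i + d k i := by
    intro k i
    simp only [hdd, hc, hb, harmExt]
    split_ifs with hki
    · subst hki
      field_simp
      ring
    · field_simp
      ring
  have hb0 : ∀ k, ∑ i, b k i = 0 := by
    intro k
    simp only [hb, ← Finset.sum_div, Finset.sum_add_distrib, Finset.sum_sub_distrib, ← hH]
    simp
  have hbb : ∀ k, ∑ i, b k i ^ 2 =
      (∑ i, (h i - h k) ^ 2 + (N * h k - H) ^ 2) / (N + 2) ^ 2 := by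
    intro k
    have : ∀ i, b k i ^ 2 =
        ((h i - h k) ^ 2 + if k = i then (N * h k - H) ^ 2 else 0) / (N + 2) ^ 2 := by
      intro i
      simp only [hb]
      split_ifs with hki
      · subst hki
        field_simp
        ring
      · field_simp
        ring
    simp only [this, ← Finset.sum_div, Finset.sum_add_distrib]
    simp
  -- Orthogonality: `d` vanishes on the diagonal, which removes the exceptional diagonal term of
  -- `b`, and what remains cancels by the symmetry of `d`.
  have hbd : ∑ k, ∑ i, b k i * d k i = 0 := by
    have h1 : ∀ k i, b k i * d k i = (h i * d k i - h k * d k i) / (N + 2) := by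
      intro k i
      simp only [hb]
      split_ifs with hki
      · subst hki
        simp [hd0]
      · ring
    have h2 : ∑ k, ∑ i, h i * d k i = ∑ k, ∑ i, h k * d k i := by
      rw [Finset.sum_comm]
      exact Finset.sum_congr rfl fun k _ => Finset.sum_congr rfl fun i _ => by rw [hds]
    simp only [h1, ← Finset.sum_div, Finset.sum_sub_distrib, h2, sub_self, zero_div]
  have hcell : ∀ k, ∑ i, ∑ j, (m k i - m k j) ^ 2 =
      2 * N * ∑ i, b k i ^ 2 + 4 * N * ∑ i, b k i * d k i + ∑ i, ∑ j, (d k i - d k j) ^ 2 := by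
    intro k
    have h1 : ∀ i j, (m k i - m k j) ^ 2 = ((b k i + d k i) - (b k j + d k j)) ^ 2 := by
      intro i j
      rw [hm, hm]
      ring
    simp only [h1]
    rw [sum_sq_sub, sum_sq_sub]
    have h2 : ∀ i, (b k i + d k i) ^ 2 = b k i ^ 2 + 2 * (b k i * d k i) + d k i ^ 2 :=
      fun i => by ring
    simp only [h2, Finset.sum_add_distrib, ← Finset.mul_sum, hb0]
    ring
  have hNH : ∑ k, ((N : ℝ) * h k - H) ^ 2 = N / 2 * ∑ i, ∑ j, (h i - h j) ^ 2 := by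
    have h1 : ∀ k, ((N : ℝ) * h k - H) ^ 2 = N ^ 2 * h k ^ 2 - 2 * N * H * h k + H ^ 2 :=
      fun k => by ring
    rw [sum_sq_sub]
    simp only [h1, Finset.sum_add_distrib, Finset.sum_sub_distrib, ← Finset.mul_sum, ← hH]
    simp
    ring
  simp only [hcell, Finset.sum_add_distrib, ← Finset.mul_sum, hbd, hbb, ← Finset.sum_div, hNH]
  rw [Finset.sum_comm (f := fun k i => (h i - h k) ^ 2)]
  simp only [hdd]
  field_simp
  ring

theorem sum_words_succ (G : List (Fin N) → ℝ) (m : ℕ) :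
    ∑ w : Fin (m + 1) → Fin N, G (List.ofFn w) =
      ∑ w : Fin m → Fin N, ∑ k, G (List.ofFn w ++ [k]) := by
  rw [← (Fin.snocEquiv fun _ : Fin (m + 1) => Fin N).sum_comp, Fintype.sum_prod_type,
    Finset.sum_comm]
  refine Finset.sum_congr rfl fun w _ => Finset.sum_congr rfl fun k _ => ?_
  rw [List.ofFn_succ_last]
  simp [Fin.snocEquiv]

/-- The increment of the energy between two levels. -/
theorem energy_succ (u : Y N → ℝ) (m : ℕ) :
    energy N (m + 1) u = energy N m u + (((N : ℝ) + 2) / N) ^ (m + 1) *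
      ∑ w : Fin m → Fin N, ∑ k, ∑ i, ∑ j,
        ((u (wordMap (F N) (List.ofFn w) (F N k (p N i))) -
          harmExt (fun i => u (wordMap (F N) (List.ofFn w) (p N i))) k i) -
        (u (wordMap (F N) (List.ofFn w) (F N k (p N j))) -
          harmExt (fun i => u (wordMap (F N) (List.ofFn w) (p N i))) k j)) ^ 2 := by
  have hcell := fun w : Fin m → Fin N =>
    cell_energy (fun i => u (wordMap (F N) (List.ofFn w) (p N i)))
      (fun k i => u (wordMap (F N) (List.ofFn w) (F N k (p N i))))
      (fun k => by simp only [F_p]) (fun k i => by simp only [F_comm k i])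
  simp only [energy]
  rw [sum_words_succ (fun w => ∑ i, ∑ j,
    (u (wordMap (F N) w (p N i)) - u (wordMap (F N) w (p N j))) ^ 2) m]
  simp only [Fword_append]
  rw [pow_succ, mul_assoc, mul_assoc, ← mul_add]
  congr 1
  rw [Finset.mul_sum, Finset.mul_sum, ← Finset.sum_add_distrib]
  exact Finset.sum_congr rfl fun w _ => hcell w

theorem energy_eq_of_harmExt {u : Y N → ℝ}
    (h : ∀ w k i, u (wordMap (F N) w (F N k (p N i))) =
      harmExt (fun i => u (wordMap (F N) w (p N i))) k i) (m : ℕ) :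
    energy N m u = energy N (m + 1) u := by
  rw [energy_succ]
  simp [h]

/-- Equality of consecutive energies makes every square in `energy_succ` vanish. Each compares the
deviations from the harmonic extension at two vertices of a subcell; for the vertex `F_k p_k = p_k`
the deviation is zero, so the other one is zero too. -/
theorem IsHarmonic.eq_harmExt {u : Y N → ℝ} (hu : IsHarmonic N u) (w : List (Fin N)) (k i : Fin N) :
    u (wordMap (F N) w (F N k (p N i))) = harmExt (fun i => u (wordMap (F N) w (p N i))) k i := by
  have hN : (0 : ℝ) < N := by exact_mod_cast k.pos
  have h := hu.2 w.length
  rw [energy_succ, left_eq_add, mul_eq_zero, or_iff_right (by positivity),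
    Finset.sum_eq_zero_iff_of_nonneg fun _ _ => by positivity] at h
  have h1 := h w.get (Finset.mem_univ _)
  rw [Finset.sum_eq_zero_iff_of_nonneg fun _ _ => by positivity] at h1
  have h2 := h1 k (Finset.mem_univ _)
  rw [Finset.sum_eq_zero_iff_of_nonneg fun _ _ => by positivity] at h2
  have h3 := h2 i (Finset.mem_univ _)
  rw [Finset.sum_eq_zero_iff_of_nonneg fun _ _ => by positivity] at h3
  have h4 := h3 k (Finset.mem_univ _)
  rw [List.ofFn_get, sq_eq_zero_iff, F_p] at h4
  have h5 : harmExt (fun i => u (wordMap (F N) w (p N i))) k k = u (wordMap (F N) w (p N k)) := by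
    simp [harmExt]
  rw [h5, sub_self, sub_zero, sub_eq_zero] at h4
  exact h4

/-- The barycentric coordinates are harmonic along the words of the maps `S_j`. -/
theorem bary_wordMap_S (l : Fin N) (w : List (Fin N)) (k i : Fin N) :
    bary l (wordMap (S N) w (S N k (p N i))) =
      harmExt (fun i => bary l (wordMap (S N) w (p N i))) k i := by
  have hN2 : (N : ℝ) + 2 ≠ 0 := by positivity
  obtain ⟨C, hA⟩ : ∃ C, ∀ x, bary l (wordMap (S N) w x) =
      2 * inner ℝ (p N l) (Tword N w x) + C := by
    refine ⟨bary l (wordMap (S N) w 0), fun x => ?_⟩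
    have := wordMap_S_sub w x 0
    rw [sub_zero] at this
    rw [← this, bary, bary, inner_sub_right]
    ring
  unfold harmExt
  split_ifs with h
  · rw [h, S_p_self]
  · rw [S_p_of_ne h]
    simp only [hA]
    rw [Finset.sum_add_distrib, ← Finset.mul_sum, ← inner_sum, ← map_sum, sum_p, map_smul, map_add,
      inner_smulY_right, inner_add_right]
    simp only [map_zero, inner_zero_right, mul_zero, zero_add, Finset.sum_const, Finset.card_univ,
      Fintype.card_fin, nsmul_eq_mul]
    field_simp
    ring

end Energy

/-! ### The harmonic gasket -/

section Gasket

variable {N : ℕ}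

theorem ratio_nonneg (N : ℕ) : (0 : ℝ) ≤ N / (N + 2) := by positivity

theorem ratio_lt_one (N : ℕ) : (N : ℝ) / (N + 2) < 1 := by
  rw [div_lt_one (by positivity)]
  linarith

theorem dist_F_le (hN : 2 ≤ N) (j : Fin N) (x y : Y N) :
    dist (F N j x) (F N j y) ≤ N / (N + 2) * dist x y := by
  have : (2 : ℝ) ≤ N := by exact_mod_cast hN
  rw [dist_F]
  refine mul_le_mul_of_nonneg_right ?_ dist_nonneg
  rw [div_le_div_iff₀ two_pos (by positivity)]
  linarith

theorem isAttractor_K (hN : 2 ≤ N) : IsAttractor (F N) (K N) := by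
  have h := isAttractor_closure_range (ratio_nonneg N) (ratio_lt_one N) (dist_F_le hN)
    (F_p (⟨0, by omega⟩ : Fin N))
  rw [K, attractor_eq (ratio_nonneg N) (ratio_lt_one N) (dist_F_le hN) h]
  exact h

theorem p_mem_K (hN : 2 ≤ N) (j : Fin N) : p N j ∈ K N :=
  (isAttractor_K hN).fixedPoint_mem (ratio_nonneg N) (ratio_lt_one N) (dist_F_le hN) (F_p j)

theorem wordMap_mapsTo {f : Fin N → Y N → Y N} {A : Set (Y N)} (h : ∀ i, MapsTo (f i) A A)
    (w : List (Fin N)) : MapsTo (wordMap f w) A A := by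
  induction w with
  | nil => exact mapsTo_id A
  | cons i w ih => exact (h i).comp ih

theorem Vstar_subset_K (hN : 2 ≤ N) : Vstar N ⊆ K N := by
  rintro _ ⟨w, j, rfl⟩
  exact wordMap_mapsTo (isAttractor_K hN).mapsTo w (p_mem_K hN j)

theorem K_subset_closure_Vstar (hN : 2 ≤ N) : K N ⊆ closure (Vstar N) := by
  have h := isAttractor_closure_range (ratio_nonneg N) (ratio_lt_one N) (dist_F_le hN)
    (F_p (⟨0, by omega⟩ : Fin N))
  rw [K, attractor_eq (ratio_nonneg N) (ratio_lt_one N) (dist_F_le hN) h]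
  apply closure_mono
  rintro _ ⟨w, rfl⟩
  exact ⟨w, _, rfl⟩

/-- The simplex with vertices `p_j`. -/
def simplex (N : ℕ) : Set (Y N) := {x | ∀ j, 0 ≤ bary j x}

theorem isClosed_simplex : IsClosed (simplex N) := by
  rw [simplex, ofPred_forall]
  exact isClosed_iInter fun j => isClosed_le continuous_const (continuous_bary j)

theorem p_mem_simplex (j : Fin N) : p N j ∈ simplex N := by
  intro k
  rw [bary_p]
  positivity

theorem F_mapsTo_simplex (j : Fin N) : MapsTo (F N j) (simplex N) (simplex N) := by
  intro x hx l
  rw [bary_F]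
  have := hx l
  positivity

theorem bary_le_one {x : Y N} (hx : x ∈ simplex N) (j : Fin N) : bary j x ≤ 1 := by
  rw [← sum_bary j.pos x]
  exact Finset.single_le_sum (f := fun j => bary j x) (fun l _ => hx l) (Finset.mem_univ j)

theorem S_mapsTo_simplex (j : Fin N) : MapsTo (S N j) (simplex N) (simplex N) := by
  intro x hx l
  rw [bary_S]
  have h1 := hx l
  have h2 := hx j
  have h3 := sub_nonneg.2 (bary_le_one hx j)
  rw [add_sub_assoc]
  positivity

theorem attractor_subset_simplex {f : Fin N → Y N → Y N} (hN : 0 < N)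
    (hf : ∀ i x y, dist (f i x) (f i y) ≤ N / (N + 2) * dist x y)
    (hs : ∀ i, MapsTo (f i) (simplex N) (simplex N)) {A : Set (Y N)} (hA : IsAttractor f A) :
    A ⊆ simplex N :=
  subset_of_subset_iUnion_image (ratio_nonneg N) (ratio_lt_one N) hf hA.2.1
    (hA.2.2.subset.trans subset_union_right) isClosed_simplex ⟨_, p_mem_simplex ⟨0, hN⟩⟩ hs

theorem K_subset_simplex (hN : 2 ≤ N) : K N ⊆ simplex N :=
  attractor_subset_simplex (by omega) (dist_F_le hN) F_mapsTo_simplex (isAttractor_K hN)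

/-! ### The semiconjugacy between the classical and the harmonic gasket -/

/-- The map `Ψ` as a map from `K` into the hyperplane. -/
structure IsSemiconj (Φ : Y N → Y N) : Prop where
  continuousOn : ContinuousOn Φ (K N)
  map_p : ∀ i, Φ (p N i) = p N i
  map_F : ∀ i, ∀ x ∈ K N, Φ (F N i x) = S N i (Φ x)
  isAttractor : IsAttractor (S N) (Φ '' K N)

theorem exists_isSemiconj (hN : 2 ≤ N) : ∃ Φ : Y N → Y N, IsSemiconj Φ := by
  have : Nonempty (Fin N) := ⟨⟨0, by omega⟩⟩
  obtain ⟨Φ, h1, h2, h3, h4⟩ := exists_semiconj (ratio_nonneg N) (ratio_lt_one N) (dist_F_le hN)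
    dist_S_le (isAttractor_K hN) F_p S_p_self p_injective F_injective
    (fun i j hij x hx y hy h => ⟨eq_p_of_F_eq_F hij (K_subset_simplex hN hx)
      (K_subset_simplex hN hy) h, eq_p_of_F_eq_F hij.symm (K_subset_simplex hN hy)
      (K_subset_simplex hN hx) h.symm⟩) S_comm
  exact ⟨Φ, h1, h2, h3, h4⟩

namespace IsSemiconj

variable {Φ : Y N → Y N}

theorem map_wordMap (h : IsSemiconj Φ) (hN : 2 ≤ N) (w : List (Fin N)) {x : Y N} (hx : x ∈ K N) :
    Φ (wordMap (F N) w x) = wordMap (S N) w (Φ x) := by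
  induction w with
  | nil => rfl
  | cons i w ih =>
    exact (h.map_F i _ (wordMap_mapsTo (isAttractor_K hN).mapsTo w hx)).trans
      (congrArg (S N i) ih)

theorem isHarmonic_bary (h : IsSemiconj Φ) (hN : 2 ≤ N) (l : Fin N) :
    IsHarmonic N fun y => bary l (Φ y) := by
  refine ⟨(continuous_bary l).comp_continuousOn h.continuousOn, energy_eq_of_harmExt ?_⟩
  intro w k i
  have h1 : ∀ i, Φ (wordMap (F N) w (p N i)) = wordMap (S N) w (p N i) := fun i => by
    rw [h.map_wordMap hN w (p_mem_K hN i), h.map_p]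
  simp only [h1]
  rw [h.map_wordMap hN w ((isAttractor_K hN).mapsTo k (p_mem_K hN i)), h.map_F k _ (p_mem_K hN i),
    h.map_p, bary_wordMap_S]

/-- The extension rule propagates boundary values to all of `Vstar`, which is dense in `K`, so a
continuous harmonic function is determined on `K`. The function `bary l ∘ Φ` also serves as the
witness that the choice defining `psi` is not void. -/
theorem psi_eq (h : IsSemiconj Φ) (hN : 2 ≤ N) (l : Fin N) {y : Y N} (hy : y ∈ K N) :
    psi N l y = bary l (Φ y) := by
  have hspec : IsHarmonic N (psi N l) ∧ ∀ k, psi N l (p N k) = if k = l then 1 else 0 :=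
    Classical.epsilon_spec (p := fun u => IsHarmonic N u ∧ ∀ k, u (p N k) = if k = l then 1 else 0)
      ⟨fun y => bary l (Φ y), h.isHarmonic_bary hN l, fun k => by simp only [h.map_p, bary_p]⟩
  have hV : ∀ w i, psi N l (wordMap (F N) w (p N i)) = bary l (wordMap (S N) w (p N i)) := by
    intro w
    induction w using List.reverseRecOn with
    | nil => exact fun i => (hspec.2 i).trans (bary_p l i).symm
    | append_singleton w k ih =>
      intro i
      rw [Fword_append, Fword_append, hspec.1.eq_harmExt, bary_wordMap_S]
      simp only [ih]
  have heq : EqOn (psi N l) (fun y => bary l (Φ y)) (Vstar N) := by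
    rintro _ ⟨w, i, rfl⟩
    rw [hV, ← h.map_p i, ← h.map_wordMap hN w (p_mem_K hN i), h.map_p]
  exact heq.of_subset_closure hspec.1.1 ((continuous_bary l).comp_continuousOn h.continuousOn)
    (Vstar_subset_K hN) (K_subset_closure_Vstar hN) hy

theorem Psi_eq (h : IsSemiconj Φ) (hN : 2 ≤ N) {y : Y N} (hy : y ∈ K N) :
    Psi N y = (Φ y : EuclideanSpace ℝ (Fin N)) := by
  ext j
  change (Real.sqrt 2)⁻¹ * (psi N j y - 1 / (N : ℝ)) = _
  rw [h.psi_eq hN j hy, bary, inner_p, add_sub_cancel_right]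
  have : Real.sqrt 2 * Real.sqrt 2 = 2 := Real.mul_self_sqrt zero_le_two
  field_simp
  rw [sq, this]

theorem X_eq (h : IsSemiconj Φ) (hN : 2 ≤ N) : X N = Φ '' K N := by
  ext x
  constructor
  · rintro ⟨y, hy, hx⟩
    rw [h.Psi_eq hN hy] at hx
    exact ⟨y, hy, Subtype.ext hx⟩
  · rintro ⟨y, hy, rfl⟩
    exact ⟨y, hy, h.Psi_eq hN hy⟩

theorem apply_mem_PsiVstar (h : IsSemiconj Φ) (hN : 2 ≤ N) {y : Y N} (hy : y ∈ Vstar N) :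
    Φ y ∈ PsiVstar N :=
  ⟨y, hy, h.Psi_eq hN (Vstar_subset_K hN hy)⟩

end IsSemiconj

theorem isAttractor_X (hN : 2 ≤ N) : IsAttractor (S N) (X N) := by
  obtain ⟨Φ, h⟩ := exists_isSemiconj hN
  rw [h.X_eq hN]
  exact h.isAttractor

theorem X_subset_simplex (hN : 2 ≤ N) : X N ⊆ simplex N :=
  attractor_subset_simplex (by omega) dist_S_le S_mapsTo_simplex (isAttractor_X hN)

theorem countable_PsiVstar : (PsiVstar N).Countable := by
  have hV : (Vstar N).Countable := by
    have : Vstar N = range fun a : List (Fin N) × Fin N => wordMap (F N) a.1 (p N a.2) := by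
      ext y
      simp only [Vstar, mem_ofPred_eq, mem_range, Prod.exists, eq_comm]
    rw [this]
    exact countable_range _
  exact (hV.image _).preimage Subtype.val_injective

/-! ### Addresses of points of the harmonic gasket -/

theorem trunc_succ {ι : Type*} (ω : ℕ → ι) (m : ℕ) : trunc ω (m + 1) = trunc ω m ++ [ω m] := by
  rw [trunc, List.ofFn_succ_last]
  rfl

theorem trunc_congr {ι : Type*} {ω τ : ℕ → ι} {m : ℕ} (h : ∀ k < m, ω k = τ k) :
    trunc ω m = trunc τ m := by
  rw [trunc, trunc]
  congr 1
  ext1 k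
  exact h k k.2

/-- Points outside of `Ψ(V_*)` have at most one address. -/
theorem IsAddress.unique (hN : 2 ≤ N) {ω τ : ℕ → Fin N} {x : Y N} (hω : IsAddress N ω x)
    (hτ : IsAddress N τ x) (hx : x ∉ PsiVstar N) : ω = τ := by
  classical
  obtain ⟨Φ, h⟩ := exists_isSemiconj hN
  by_contra hne
  have hex : ∃ m, ω m ≠ τ m := Function.ne_iff.1 hne
  have hlt : ∀ k < Nat.find hex, ω k = τ k := fun k hk => by
    simpa using Nat.find_min hex hk
  have hm := Nat.find_spec hex
  set m := Nat.find hex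
  obtain ⟨y, hy, hyω, hyx⟩ := hω
  obtain ⟨y', hy', hyτ, hyx'⟩ := hτ
  rw [h.Psi_eq hN hy] at hyx
  rw [h.Psi_eq hN hy'] at hyx'
  obtain ⟨z, hz, hzy⟩ := hyω (m + 1)
  obtain ⟨z', hz', hzy'⟩ := hyτ (m + 1)
  rw [trunc_succ, Fword_append] at hzy hzy'
  rw [← trunc_congr hlt] at hzy'
  have hFK := fun j {a} (ha : a ∈ K N) => (isAttractor_K hN).mapsTo j ha
  have e1 : x = wordMap (S N) (trunc ω m) (S N (ω m) (Φ z)) := by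
    rw [← h.map_F _ _ hz, ← h.map_wordMap hN _ (hFK _ hz), hzy]
    exact Subtype.ext hyx.symm
  have e2 : x = wordMap (S N) (trunc ω m) (S N (τ m) (Φ z')) := by
    rw [← h.map_F _ _ hz', ← h.map_wordMap hN _ (hFK _ hz'), hzy']
    exact Subtype.ext hyx'.symm
  have hX : ∀ {a}, a ∈ K N → Φ a ∈ simplex N := fun {a} ha =>
    X_subset_simplex hN (by rw [h.X_eq hN]; exact mem_image_of_mem _ ha)
  -- Behind the common prefix the two addresses enter different cells, and these can meet only in a
  -- vertex; so `x` would belong to `Ψ(V_*)`.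
  have e3 := eq_p_of_S_eq_S hm (hX hz) (hX hz') (wordMap_S_injective _ (e1.symm.trans e2))
  apply hx
  rw [e1, e3, ← h.map_p, ← h.map_F _ _ (p_mem_K hN _),
    ← h.map_wordMap hN _ (hFK _ (p_mem_K hN _)), ← Fword_append]
  exact h.apply_mem_PsiVstar hN ⟨_, _, rfl⟩

theorem dist_wordMap_S_le (w : List (Fin N)) (x y : Y N) :
    dist (wordMap (S N) w x) (wordMap (S N) w y) ≤ (N / (N + 2)) ^ w.length * dist x y := by
  induction w with
  | nil => simp [wordMap]
  | cons i w ih =>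
    rw [List.length_cons, pow_succ', mul_assoc]
    exact (dist_S_le i _ _).trans (mul_le_mul_of_nonneg_left ih (ratio_nonneg N))

/-- The nested cells of `K` have a common point `y`. Its image lies in the same cells of `X` as `x`,
and their diameters shrink like `(N / (N + 2)) ^ m`. -/
theorem isAddress_of_mem (hN : 2 ≤ N) {ω : ℕ → Fin N} {x : Y N}
    (hx : ∀ m, x ∈ wordMap (S N) (trunc ω m) '' X N) : IsAddress N ω x := by
  obtain ⟨Φ, h⟩ := exists_isSemiconj hN
  have hK := isAttractor_K hN
  have hcont : ∀ w, Continuous (wordMap (F N) w) := by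
    intro w
    induction w with
    | nil => exact continuous_id
    | cons i w ih => exact (continuous_of_dist_le_mul (dist_F_le hN i)).comp ih
  have hcomp : ∀ m, IsCompact (wordMap (F N) (trunc ω m) '' K N) := fun m =>
    hK.2.1.image (hcont _)
  obtain ⟨y, hy⟩ := IsCompact.nonempty_iInter_of_sequence_nonempty_isCompact_isClosed
    (fun m => wordMap (F N) (trunc ω m) '' K N) (by
      rintro m _ ⟨z, hz, rfl⟩
      rw [trunc_succ, Fword_append]
      exact mem_image_of_mem _ (hK.mapsTo _ hz)) (fun m => hK.1.image _) (hcomp 0)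
    (fun m => (hcomp m).isClosed)
  rw [mem_iInter] at hy
  have hyK : y ∈ K N := by
    obtain ⟨z, hz, rfl⟩ := hy 0
    exact wordMap_mapsTo hK.mapsTo _ hz
  refine ⟨y, hyK, hy, ?_⟩
  rw [h.Psi_eq hN hyK]
  congr 1
  rw [← dist_le_zero]
  have hb := (isAttractor_X hN).2.1.isBounded
  have hle : ∀ m, dist (Φ y) x ≤ (N / (N + 2) : ℝ) ^ m * Metric.diam (X N) := by
    intro m
    obtain ⟨z, hz, hzy⟩ := hy m
    obtain ⟨z', hz', hzx⟩ := hx m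
    have hlen : (trunc ω m).length = m := List.length_ofFn
    have h1 := dist_wordMap_S_le (trunc ω m) (Φ z) z'
    rw [hlen, hzx, ← h.map_wordMap hN _ hz, hzy] at h1
    refine h1.trans (mul_le_mul_of_nonneg_left ?_ (pow_nonneg (ratio_nonneg N) m))
    exact Metric.dist_le_diam_of_mem hb (by rw [h.X_eq hN]; exact mem_image_of_mem _ hz) hz'
  have hlim := (tendsto_pow_atTop_nhds_zero_of_lt_one (ratio_nonneg N) (ratio_lt_one N)).mul_const
    (Metric.diam (X N))
  rw [zero_mul] at hlim
  exact ge_of_tendsto' hlim hle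

end Gasket

/-! ### The planar curve, parametrized by its slope -/

section SlopeCurve

/-- The denominator of `slope`. -/
def slopeDen (n ε s : ℝ) : ℝ := n + 2 + ε * (n - 2) * s

/-- The action on slopes of the linear map `planarLin n ε`. -/
noncomputable def slope (n ε s : ℝ) : ℝ := n * (s + ε) / slopeDen n ε s

/-- The inverse of `slope n ε`. -/
noncomputable def slopeInv (n ε t : ℝ) : ℝ := ((n + 2) * t - ε * n) / (n - ε * (n - 2) * t)

/-- The linear part of `planarMap`. -/
noncomputable def planarLin (n ε : ℝ) (x : ℝ × ℝ) : ℝ × ℝ :=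
  (((n + 2) * x.1 + ε * (n - 2) * x.2) / (2 * (n + 2)), n * (ε * x.1 + x.2) / (2 * (n + 2)))

/-- The affine maps `S_1` (for `ε = -1`) and `S_2` (for `ε = 1`) in the coordinates with respect to
the basis `p_2 - p_1`, `p_1 + p_2`. -/
noncomputable def planarMap (n ε : ℝ) (x : ℝ × ℝ) : ℝ × ℝ :=
  planarLin n ε x + (ε / (n + 2), 1 / (n + 2))

variable {n ε s t x y : ℝ}

theorem abs_mul_le_one (hε : ε = -1 ∨ ε = 1) (hs : s ∈ Icc (-1 : ℝ) 1) :
    -1 ≤ ε * s ∧ ε * s ≤ 1 := by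
  rcases hε with rfl | rfl <;> constructor <;> linarith [hs.1, hs.2]

theorem four_le_slopeDen (hn : 2 ≤ n) (hε : ε = -1 ∨ ε = 1) (hs : s ∈ Icc (-1 : ℝ) 1) :
    4 ≤ slopeDen n ε s := by
  have := (abs_mul_le_one hε hs).1
  have : 0 ≤ (n - 2) * (ε * s + 1) := mul_nonneg (by linarith) (by linarith)
  unfold slopeDen
  linarith

theorem two_le_invDen (hn : 2 ≤ n) (hε : ε = -1 ∨ ε = 1) (hs : s ∈ Icc (-1 : ℝ) 1) :
    2 ≤ n - ε * (n - 2) * s := by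
  have := (abs_mul_le_one hε hs).2
  have : 0 ≤ (n - 2) * (1 - ε * s) := mul_nonneg (by linarith) (by linarith)
  linarith

theorem sq_eq_one_of_sign (hε : ε = -1 ∨ ε = 1) : ε ^ 2 = 1 := by
  rcases hε with rfl | rfl <;> norm_num

theorem slopeInv_slope (hn : 2 ≤ n) (hε : ε = -1 ∨ ε = 1) (hs : s ∈ Icc (-1 : ℝ) 1) :
    slopeInv n ε (slope n ε s) = s := by
  have hD := four_le_slopeDen hn hε hs
  have h1 : n - ε * (n - 2) * slope n ε s = 4 * n / slopeDen n ε s := by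
    rw [slope, eq_div_iff (by linarith)]
    field_simp
    unfold slopeDen
    rcases hε with rfl | rfl <;> ring
  have h2 : (n + 2) * slope n ε s - ε * n = 4 * n * s / slopeDen n ε s := by
    rw [slope, eq_div_iff (by linarith)]
    field_simp
    unfold slopeDen
    rcases hε with rfl | rfl <;> ring
  rw [slopeInv, h1, h2]
  field_simp

theorem slope_slopeInv (hn : 2 ≤ n) (hε : ε = -1 ∨ ε = 1) (ht : t ∈ Icc (-1 : ℝ) 1) :
    slope n ε (slopeInv n ε t) = t := by
  have hE : n - ε * (n - 2) * t ≠ 0 := by linarith [two_le_invDen hn hε ht]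
  have h1 : slopeDen n ε (slopeInv n ε t) = 4 * n / (n - ε * (n - 2) * t) := by
    rw [slopeDen, slopeInv, eq_div_iff hE, add_mul, mul_assoc (ε * (n - 2)),
      div_mul_cancel₀ _ hE]
    rcases hε with rfl | rfl <;> ring
  have h2 : n * (slopeInv n ε t + ε) = 4 * n * t / (n - ε * (n - 2) * t) := by
    rw [slopeInv, eq_div_iff hE, mul_assoc, add_mul, div_mul_cancel₀ _ hE]
    rcases hε with rfl | rfl <;> ring
  rw [slope, h1, h2, div_div_div_cancel_right₀ hE, mul_div_cancel_left₀ _ (by linarith)]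

/-- The difference formula for a Möbius transformation; `4 * n` is the determinant of its matrix,
because `ε² = 1`. -/
theorem slope_sub_slope (hn : 2 ≤ n) (hε : ε = -1 ∨ ε = 1) (hx : x ∈ Icc (-1 : ℝ) 1)
    (hy : y ∈ Icc (-1 : ℝ) 1) :
    slope n ε x - slope n ε y = 4 * n * (x - y) / (slopeDen n ε x * slopeDen n ε y) := by
  have hx' := four_le_slopeDen hn hε hx
  have hy' := four_le_slopeDen hn hε hy
  rw [slope, slope, div_sub_div _ _ (by linarith) (by linarith)]
  congr 1
  unfold slopeDen
  linear_combination (n * (n - 2) * (y - x)) * sq_eq_one_of_sign hε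

theorem slope_mono (hn : 2 ≤ n) (hε : ε = -1 ∨ ε = 1) : MonotoneOn (slope n ε) (Icc (-1) 1) := by
  intro x hx y hy hxy
  have hx' := four_le_slopeDen hn hε hx
  have hy' := four_le_slopeDen hn hε hy
  rw [← sub_nonneg, slope_sub_slope hn hε hy hx]
  have : 0 ≤ y - x := sub_nonneg.2 hxy
  positivity

theorem slopeInv_mono (hn : 2 ≤ n) (hε : ε = -1 ∨ ε = 1) :
    MonotoneOn (slopeInv n ε) (Icc (-1) 1) := by
  intro x hx y hy hxy
  have hx' := two_le_invDen hn hε hx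
  have hy' := two_le_invDen hn hε hy
  rw [slopeInv, slopeInv, div_le_div_iff₀ (by linarith) (by linarith), ← sub_nonneg]
  have : 0 ≤ 4 * n * (y - x) := mul_nonneg (by linarith) (sub_nonneg.2 hxy)
  refine this.trans_eq ?_
  rcases hε with rfl | rfl <;> ring

theorem slope_neg_one_neg_one (hn : 2 ≤ n) : slope n (-1) (-1) = -1 := by
  have : n ≠ 0 := by linarith
  unfold slope slopeDen
  rw [div_eq_iff (by linarith)]
  ring

theorem slope_neg_one_one : slope n (-1) 1 = 0 := by simp [slope]

theorem slope_one_neg_one : slope n 1 (-1) = 0 := by simp [slope]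

theorem slope_one_one (hn : 2 ≤ n) : slope n 1 1 = 1 := by
  unfold slope slopeDen
  rw [div_eq_iff (by linarith)]
  ring

theorem mem_Icc_neg_one : (-1 : ℝ) ∈ Icc (-1 : ℝ) 1 := by norm_num
theorem mem_Icc_one : (1 : ℝ) ∈ Icc (-1 : ℝ) 1 := by norm_num
theorem mem_Icc_zero : (0 : ℝ) ∈ Icc (-1 : ℝ) 1 := by norm_num

theorem slope_mem_left (hn : 2 ≤ n) (hs : s ∈ Icc (-1 : ℝ) 1) : slope n (-1) s ∈ Icc (-1 : ℝ) 0 := by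
  have h1 := slope_mono hn (Or.inl rfl) mem_Icc_neg_one hs hs.1
  have h2 := slope_mono hn (Or.inl rfl) hs mem_Icc_one hs.2
  rw [slope_neg_one_neg_one hn] at h1
  rw [slope_neg_one_one] at h2
  exact ⟨h1, h2⟩

theorem slope_mem_right (hn : 2 ≤ n) (hs : s ∈ Icc (-1 : ℝ) 1) : slope n 1 s ∈ Icc (0 : ℝ) 1 := by
  have h1 := slope_mono hn (Or.inr rfl) mem_Icc_neg_one hs hs.1
  have h2 := slope_mono hn (Or.inr rfl) hs mem_Icc_one hs.2
  rw [slope_one_neg_one] at h1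
  rw [slope_one_one hn] at h2
  exact ⟨h1, h2⟩

theorem slope_mem (hn : 2 ≤ n) (hε : ε = -1 ∨ ε = 1) (hs : s ∈ Icc (-1 : ℝ) 1) :
    slope n ε s ∈ Icc (-1 : ℝ) 1 := by
  rcases hε with rfl | rfl
  · exact Icc_subset_Icc_right zero_le_one (slope_mem_left hn hs)
  · exact Icc_subset_Icc_left (by norm_num) (slope_mem_right hn hs)

theorem slopeInv_neg_one_neg_one (hn : 2 ≤ n) : slopeInv n (-1) (-1) = -1 := by
  have h := slopeInv_slope hn (Or.inl rfl) mem_Icc_neg_one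
  rwa [slope_neg_one_neg_one hn] at h

theorem slopeInv_neg_one_zero (hn : 2 ≤ n) : slopeInv n (-1) 0 = 1 := by
  have h := slopeInv_slope hn (Or.inl rfl) mem_Icc_one
  rwa [slope_neg_one_one] at h

theorem slopeInv_one_zero (hn : 2 ≤ n) : slopeInv n 1 0 = -1 := by
  have h := slopeInv_slope hn (Or.inr rfl) mem_Icc_neg_one
  rwa [slope_one_neg_one] at h

theorem slopeInv_one_one (hn : 2 ≤ n) : slopeInv n 1 1 = 1 := by
  have h := slopeInv_slope hn (Or.inr rfl) mem_Icc_one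
  rwa [slope_one_one hn] at h

theorem slopeInv_mem_left (hn : 2 ≤ n) (ht : t ∈ Icc (-1 : ℝ) 0) :
    slopeInv n (-1) t ∈ Icc (-1 : ℝ) 1 := by
  have ht' : t ∈ Icc (-1 : ℝ) 1 := Icc_subset_Icc_right zero_le_one ht
  have h1 := slopeInv_mono hn (Or.inl rfl) mem_Icc_neg_one ht' ht.1
  have h2 := slopeInv_mono hn (Or.inl rfl) ht' mem_Icc_zero ht.2
  rw [slopeInv_neg_one_neg_one hn] at h1
  rw [slopeInv_neg_one_zero hn] at h2
  exact ⟨h1, h2⟩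

theorem slopeInv_mem_right (hn : 2 ≤ n) (ht : t ∈ Icc (0 : ℝ) 1) :
    slopeInv n 1 t ∈ Icc (-1 : ℝ) 1 := by
  have ht' : t ∈ Icc (-1 : ℝ) 1 := Icc_subset_Icc_left (by norm_num) ht
  have h1 := slopeInv_mono hn (Or.inr rfl) mem_Icc_zero ht' ht.1
  have h2 := slopeInv_mono hn (Or.inr rfl) ht' mem_Icc_one ht.2
  rw [slopeInv_one_zero hn] at h1
  rw [slopeInv_one_one hn] at h2
  exact ⟨h1, h2⟩

/-- Every slope lies in the image of `slope n (-1)` or `slope n 1`. -/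
theorem exists_slope_eq (hn : 2 ≤ n) (ht : t ∈ Icc (-1 : ℝ) 1) :
    ∃ ε, (ε = -1 ∨ ε = 1) ∧ ∃ s ∈ Icc (-1 : ℝ) 1, slope n ε s = t := by
  rcases le_total t 0 with h | h
  · exact ⟨-1, Or.inl rfl, _, slopeInv_mem_left hn ⟨ht.1, h⟩, slope_slopeInv hn (Or.inl rfl) ht⟩
  · exact ⟨1, Or.inr rfl, _, slopeInv_mem_right hn ⟨h, ht.2⟩, slope_slopeInv hn (Or.inr rfl) ht⟩

/-- The quadratic form that is expanded by the maps `planarLin`, relative to their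
determinant. -/
def slopeForm (n s : ℝ) : ℝ := n - (n - 2) * s ^ 2

theorem two_le_slopeForm (hn : 2 ≤ n) (hs : s ∈ Icc (-1 : ℝ) 1) : 2 ≤ slopeForm n s := by
  have : s ^ 2 ≤ 1 := by nlinarith [hs.1, hs.2]
  have := mul_le_mul_of_nonneg_left this (show 0 ≤ n - 2 by linarith)
  unfold slopeForm
  linarith

theorem slopeForm_le (hn : 2 ≤ n) : slopeForm n s ≤ n := by
  have : 0 ≤ (n - 2) * s ^ 2 := mul_nonneg (by linarith) (sq_nonneg s)
  unfold slopeForm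
  linarith

/-- The right side equals `4 n q + n (8 + …)` with `q = slopeForm n s` and a nonnegative remainder,
and `8 n ≥ 8 q`. The gain of `4 * (n + 2)` over the factor `4 * n` in `slope_sub_slope` is what
makes the slope maps contract. -/
theorem slopeForm_slope (hn : 2 ≤ n) (hε : ε = -1 ∨ ε = 1) (hs : s ∈ Icc (-1 : ℝ) 1) :
    4 * (n + 2) * slopeForm n s ≤ slopeDen n ε s ^ 2 * slopeForm n (slope n ε s) := by
  have hD := four_le_slopeDen hn hε hs
  have h1 : slopeDen n ε s ^ 2 * slopeForm n (slope n ε s) =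
      n * slopeDen n ε s ^ 2 - (n - 2) * (n * (s + ε)) ^ 2 := by
    unfold slopeForm slope
    field_simp
  have h2 : n * slopeDen n ε s ^ 2 - (n - 2) * (n * (s + ε)) ^ 2 =
      4 * n * slopeForm n s + n * (8 + 2 * (n - 2) * (1 + ε * s) ^ 2) := by
    unfold slopeForm slopeDen
    rcases hε with rfl | rfl <;> ring
  have h3 := slopeForm_le (s := s) hn
  have h4 : 0 ≤ n * (2 * (n - 2) * (1 + ε * s) ^ 2) := by
    have : 0 ≤ n - 2 := by linarith
    have : 0 ≤ n := by linarith
    positivity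
  rw [h1, h2]
  linarith

theorem planarLin_sub (u v : ℝ × ℝ) : planarMap n ε u - planarMap n ε v = planarLin n ε (u - v) := by
  simp only [planarMap, planarLin]
  ext
  · simp
    ring
  · simp
    ring

/-- The vectors of slope at most one in absolute value that point to the right. -/
def cone : Set (ℝ × ℝ) := {x | |x.2| ≤ x.1}

theorem mem_cone {u : ℝ × ℝ} : u ∈ cone ↔ |u.2| ≤ u.1 := Iff.rfl

theorem add_mem_cone {u v : ℝ × ℝ} (hu : u ∈ cone) (hv : v ∈ cone) : u + v ∈ cone := by
  rw [mem_cone] at *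
  exact (abs_add_le u.2 v.2).trans (add_le_add hu hv)

theorem planarLin_left_of_cone (hn : 2 ≤ n) {u : ℝ × ℝ} (hu : u ∈ cone) :
    (planarLin n (-1) u).2 ≤ 0 ∧ -(planarLin n (-1) u).2 ≤ (planarLin n (-1) u).1 := by
  obtain ⟨h1, h2⟩ := abs_le.1 (show |u.2| ≤ u.1 from hu)
  simp only [planarLin]
  constructor
  · exact div_nonpos_of_nonpos_of_nonneg
      (mul_nonpos_of_nonneg_of_nonpos (by linarith) (by linarith)) (by linarith)
  · rw [← neg_div]
    exact div_le_div_of_nonneg_right (by linarith) (by linarith)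

theorem planarLin_right_of_cone (hn : 2 ≤ n) {u : ℝ × ℝ} (hu : u ∈ cone) :
    0 ≤ (planarLin n 1 u).2 ∧ (planarLin n 1 u).2 ≤ (planarLin n 1 u).1 := by
  obtain ⟨h1, h2⟩ := abs_le.1 (show |u.2| ≤ u.1 from hu)
  simp only [planarLin]
  constructor
  · exact div_nonneg (mul_nonneg (by linarith) (by linarith)) (by linarith)
  · exact div_le_div_of_nonneg_right (by linarith) (by linarith)

theorem planarLin_mem_cone (hn : 2 ≤ n) (hε : ε = -1 ∨ ε = 1) {u : ℝ × ℝ} (hu : u ∈ cone) :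
    planarLin n ε u ∈ cone := by
  rcases hε with rfl | rfl
  · obtain ⟨h1, h2⟩ := planarLin_left_of_cone hn hu
    rw [mem_cone]
    exact abs_le.2 ⟨by linarith, by linarith⟩
  · obtain ⟨h1, h2⟩ := planarLin_right_of_cone hn hu
    rw [mem_cone]
    exact abs_le.2 ⟨by linarith, by linarith⟩

/-- The covector that kills the image slope pulls back to a positive multiple of the one that kills
`s`, so supporting lines go to supporting lines. The factor is the determinant `n / (n + 2)²`
divided by the stretch `slopeDen n ε s / (2 (n + 2))` of the direction of slope `s`. -/
theorem planarLin_tangent (hn : 2 ≤ n) (hε : ε = -1 ∨ ε = 1) (hs : s ∈ Icc (-1 : ℝ) 1)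
    (u : ℝ × ℝ) : (planarLin n ε u).2 - slope n ε s * (planarLin n ε u).1 =
      2 * n / ((n + 2) * slopeDen n ε s) * (u.2 - s * u.1) := by
  have hD := four_le_slopeDen hn hε hs
  have hn2 : n + 2 ≠ 0 := by linarith
  simp only [planarLin, slope]
  field_simp
  unfold slopeDen
  linear_combination ((n - 2) * (s * u.1 - u.2)) * sq_eq_one_of_sign hε

theorem planarLin_injective (hn : 2 ≤ n) (hε : ε = -1 ∨ ε = 1) {u : ℝ × ℝ}
    (h : planarLin n ε u = 0) : u = 0 := by
  have hn2 : (2 * (n + 2)) ≠ 0 := by linarith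
  have h1 := congrArg Prod.fst h
  have h2 := congrArg Prod.snd h
  simp only [planarLin, Prod.fst_zero, Prod.snd_zero, div_eq_zero_iff, hn2, or_false,
    mul_eq_zero] at h1 h2
  have h3 := h2.resolve_left (by linarith)
  have h4 : u.1 = 0 := by
    linear_combination (1 / 4) * h1 - (ε * (n - 2) / 4) * h3 +
      ((n - 2) / 4 * u.1) * sq_eq_one_of_sign hε
  ext
  · exact h4
  · rw [h4, mul_zero, zero_add] at h3
    exact h3

/-- The norm of `ℝ × ℝ` is the maximum norm, and both rows of the matrix have absolute sum `n / (n +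
2)`. -/
theorem norm_planarLin_le (hn : 2 ≤ n) (hε : ε = -1 ∨ ε = 1) (u : ℝ × ℝ) :
    ‖planarLin n ε u‖ ≤ n / (n + 2) * ‖u‖ := by
  have h1 : |u.1| ≤ ‖u‖ := norm_fst_le u
  have h2 : |u.2| ≤ ‖u‖ := norm_snd_le u
  have hε1 : |ε| = 1 := by rcases hε with rfl | rfl <;> norm_num
  have hk : 0 ≤ n - 2 := by linarith
  have hn0 : 0 ≤ n := by linarith
  have hd : 0 < 2 * (n + 2) := by linarith
  rw [Prod.norm_def]
  apply max_le
  · rw [Real.norm_eq_abs, planarLin, abs_div, abs_of_pos hd, div_mul_eq_mul_div,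
      div_le_div_iff₀ hd (by linarith)]
    have h3 : |(n + 2) * u.1 + ε * (n - 2) * u.2| ≤ (n + 2) * ‖u‖ + (n - 2) * ‖u‖ := by
      refine (abs_add_le _ _).trans (add_le_add ?_ ?_)
      · rw [abs_mul, abs_of_nonneg (show 0 ≤ n + 2 by linarith)]
        exact mul_le_mul_of_nonneg_left h1 (by linarith)
      · rw [abs_mul, abs_mul, hε1, one_mul, abs_of_nonneg hk]
        exact mul_le_mul_of_nonneg_left h2 hk
    nlinarith
  · rw [Real.norm_eq_abs, planarLin, abs_div, abs_of_pos hd, div_mul_eq_mul_div,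
      div_le_div_iff₀ hd (by linarith)]
    have h3 : |n * (ε * u.1 + u.2)| ≤ n * (‖u‖ + ‖u‖) := by
      rw [abs_mul, abs_of_nonneg hn0]
      refine mul_le_mul_of_nonneg_left ((abs_add_le _ _).trans (add_le_add ?_ h2)) hn0
      rw [abs_mul, hε1, one_mul]
      exact h1
    nlinarith

end SlopeCurve

/-! ### Curves given by their supporting lines, and the self-similar one among them -/

section SlopeCurve

variable {n ε s t : ℝ}

/-- A curve from `(-1/2, 1/2)` to `(1/2, 1/2)` over the slopes `[-1,1]` which lies above its
supporting lines: the line of slope `s` supports it at `γ s`. -/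
structure IsSlopeCurve (γ : ℝ → ℝ × ℝ) : Prop where
  left : γ (-1) = (-1 / 2, 1 / 2)
  right : γ 1 = (1 / 2, 1 / 2)
  sub_mem_cone : ∀ s ∈ Icc (-1 : ℝ) 1, ∀ r ∈ Icc (-1 : ℝ) 1, s ≤ r → γ r - γ s ∈ cone
  tangent : ∀ s ∈ Icc (-1 : ℝ) 1, ∀ r ∈ Icc (-1 : ℝ) 1, 0 ≤ (γ r - γ s).2 - s * (γ r - γ s).1

theorem IsSlopeCurve.congr {γ δ : ℝ → ℝ × ℝ} (hγ : IsSlopeCurve γ)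
    (h : ∀ s ∈ Icc (-1 : ℝ) 1, δ s = γ s) : IsSlopeCurve δ where
  left := (h _ mem_Icc_neg_one).trans hγ.left
  right := (h _ mem_Icc_one).trans hγ.right
  sub_mem_cone s hs r hr hsr := by rw [h s hs, h r hr]; exact hγ.sub_mem_cone s hs r hr hsr
  tangent s hs r hr := by rw [h s hs, h r hr]; exact hγ.tangent s hs r hr

/-- The parabola. -/
theorem isSlopeCurve_parabola : IsSlopeCurve fun s => (s / 2, s ^ 2 / 4 + 1 / 4) where
  left := by norm_num
  right := by norm_num
  sub_mem_cone s hs r hr hsr := by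
    rw [mem_cone, Prod.mk_sub_mk]
    simp only
    rw [abs_le]
    constructor <;> nlinarith [hs.1, hs.2, hr.1, hr.2]
  tangent s hs r hr := by
    rw [Prod.mk_sub_mk]
    simp only
    nlinarith [sq_nonneg (r - s)]

open Classical in
/-- The action of the two affine maps on curves that are parametrized by their slopes. -/
noncomputable def slopeStep (n : ℝ) (γ : ℝ → ℝ × ℝ) (s : ℝ) : ℝ × ℝ :=
  if s ≤ 0 then planarMap n (-1) (γ (slopeInv n (-1) s)) else planarMap n 1 (γ (slopeInv n 1 s))

/-- Both sides represent the common point `S_1 p_2 = S_2 p_1`; this makes `slopeStep` well behaved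
at slope `0`. -/
theorem planarMap_glue (hn : 2 ≤ n) {γ : ℝ → ℝ × ℝ} (hγ : IsSlopeCurve γ) :
    planarMap n (-1) (γ 1) = planarMap n 1 (γ (-1)) := by
  rw [hγ.left, hγ.right]
  have : n + 2 ≠ 0 := by linarith
  simp only [planarMap, planarLin]
  ext
  · simp
    field_simp
    ring
  · simp only [Prod.snd_add]
    ring

theorem slopeStep_of_nonpos (γ : ℝ → ℝ × ℝ) (hs : s ≤ 0) :
    slopeStep n γ s = planarMap n (-1) (γ (slopeInv n (-1) s)) := if_pos hs

theorem slopeStep_of_nonneg (hn : 2 ≤ n) {γ : ℝ → ℝ × ℝ} (hγ : IsSlopeCurve γ) (hs : 0 ≤ s) :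
    slopeStep n γ s = planarMap n 1 (γ (slopeInv n 1 s)) := by
  rcases hs.eq_or_lt with rfl | hs
  · rw [slopeStep_of_nonpos γ le_rfl, slopeInv_neg_one_zero hn, slopeInv_one_zero hn,
      planarMap_glue hn hγ]
  · exact if_neg hs.not_ge

theorem slopeStep_continuousOn (hn : 2 ≤ n) {γ : ℝ → ℝ × ℝ} (hγ : IsSlopeCurve γ)
    (hc : Continuous γ) : ContinuousOn (slopeStep n γ) (Icc (-1) 1) := by
  have hm : ∀ ε, Continuous (planarMap n ε) := by
    intro ε
    unfold planarMap planarLin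
    fun_prop
  have hi : ∀ ε, (ε = -1 ∨ ε = 1) → ContinuousOn (slopeInv n ε) (Icc (-1) 1) := by
    intro ε hε
    unfold slopeInv
    refine ContinuousOn.div (by fun_prop) (by fun_prop) fun s hs => ?_
    linarith [two_le_invDen hn hε hs]
  have h1 : ContinuousOn (fun s => planarMap n (-1) (γ (slopeInv n (-1) s))) (Icc (-1) 1) :=
    ((hm _).comp hc).comp_continuousOn (hi _ (Or.inl rfl))
  have h2 : ContinuousOn (fun s => planarMap n 1 (γ (slopeInv n 1 s))) (Icc (-1) 1) :=
    ((hm _).comp hc).comp_continuousOn (hi _ (Or.inr rfl))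
  have hl : ContinuousOn (slopeStep n γ) (Icc (-1) 0) :=
    (h1.mono (Icc_subset_Icc_right zero_le_one)).congr fun s hs => slopeStep_of_nonpos γ hs.2
  have hr : ContinuousOn (slopeStep n γ) (Icc 0 1) :=
    (h2.mono (Icc_subset_Icc_left (by norm_num))).congr fun s hs => slopeStep_of_nonneg hn hγ hs.1
  rw [← Icc_union_Icc_eq_Icc (show (-1 : ℝ) ≤ 0 by norm_num) zero_le_one]
  exact hl.union_of_isClosed hr isClosed_Icc isClosed_Icc

/-- On either half, both conditions are transported by the linear parts. Across slope `0` the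
increment is split there: the chord over the other half has a slope on the other side of `0`, hence
stays above the line of slope `s`. -/
theorem IsSlopeCurve.slopeStep (hn : 2 ≤ n) {γ : ℝ → ℝ × ℝ} (hγ : IsSlopeCurve γ) :
    IsSlopeCurve (slopeStep n γ) := by
  have hn2 : n + 2 ≠ 0 := by linarith
  have hl : ∀ s ∈ Icc (-1 : ℝ) 0, ∀ r ∈ Icc (-1 : ℝ) 0,
      HarmonicGasket.slopeStep n γ r - HarmonicGasket.slopeStep n γ s =
        planarLin n (-1) (γ (slopeInv n (-1) r) - γ (slopeInv n (-1) s)) := by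
    intro s hs r hr
    rw [slopeStep_of_nonpos γ hs.2, slopeStep_of_nonpos γ hr.2, planarLin_sub]
  have hr : ∀ s ∈ Icc (0 : ℝ) 1, ∀ r ∈ Icc (0 : ℝ) 1,
      HarmonicGasket.slopeStep n γ r - HarmonicGasket.slopeStep n γ s =
        planarLin n 1 (γ (slopeInv n 1 r) - γ (slopeInv n 1 s)) := by
    intro s hs r hr
    rw [slopeStep_of_nonneg hn hγ hs.1, slopeStep_of_nonneg hn hγ hr.1, planarLin_sub]
  have sub_left : Icc (-1 : ℝ) 0 ⊆ Icc (-1) 1 := Icc_subset_Icc_right zero_le_one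
  have sub_right : Icc (0 : ℝ) 1 ⊆ Icc (-1) 1 := Icc_subset_Icc_left (by norm_num)
  have hcl : ∀ s ∈ Icc (-1 : ℝ) 0, ∀ r ∈ Icc (-1 : ℝ) 0, s ≤ r →
      γ (slopeInv n (-1) r) - γ (slopeInv n (-1) s) ∈ cone := fun s hs r hr hsr =>
    hγ.sub_mem_cone _ (slopeInv_mem_left hn hs) _ (slopeInv_mem_left hn hr)
      (slopeInv_mono hn (Or.inl rfl) (sub_left hs) (sub_left hr) hsr)
  have hcr : ∀ s ∈ Icc (0 : ℝ) 1, ∀ r ∈ Icc (0 : ℝ) 1, s ≤ r →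
      γ (slopeInv n 1 r) - γ (slopeInv n 1 s) ∈ cone := fun s hs r hr hsr =>
    hγ.sub_mem_cone _ (slopeInv_mem_right hn hs) _ (slopeInv_mem_right hn hr)
      (slopeInv_mono hn (Or.inr rfl) (sub_right hs) (sub_right hr) hsr)
  have h0l : (0 : ℝ) ∈ Icc (-1 : ℝ) 0 := by norm_num
  have h0r : (0 : ℝ) ∈ Icc (0 : ℝ) 1 := by norm_num
  have htl : ∀ s ∈ Icc (-1 : ℝ) 0, ∀ r ∈ Icc (-1 : ℝ) 0,
      0 ≤ (HarmonicGasket.slopeStep n γ r - HarmonicGasket.slopeStep n γ s).2 -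
        s * (HarmonicGasket.slopeStep n γ r - HarmonicGasket.slopeStep n γ s).1 := by
    intro s hs r hr
    have hs' := slopeInv_mem_left hn hs
    have key := planarLin_tangent hn (Or.inl rfl) hs' (γ (slopeInv n (-1) r) - γ (slopeInv n (-1) s))
    rw [slope_slopeInv hn (Or.inl rfl) (sub_left hs)] at key
    rw [hl s hs r hr, key]
    have hD := four_le_slopeDen hn (Or.inl rfl) hs'
    have h2 := hγ.tangent _ hs' _ (slopeInv_mem_left hn hr)
    have : 0 ≤ n := by linarith
    positivity
  have htr : ∀ s ∈ Icc (0 : ℝ) 1, ∀ r ∈ Icc (0 : ℝ) 1,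
      0 ≤ (HarmonicGasket.slopeStep n γ r - HarmonicGasket.slopeStep n γ s).2 -
        s * (HarmonicGasket.slopeStep n γ r - HarmonicGasket.slopeStep n γ s).1 := by
    intro s hs r hr'
    have hs' := slopeInv_mem_right hn hs
    have key := planarLin_tangent hn (Or.inr rfl) hs' (γ (slopeInv n 1 r) - γ (slopeInv n 1 s))
    rw [slope_slopeInv hn (Or.inr rfl) (sub_right hs)] at key
    rw [hr s hs r hr', key]
    have hD := four_le_slopeDen hn (Or.inr rfl) hs'
    have h2 := hγ.tangent _ hs' _ (slopeInv_mem_right hn hr')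
    have : 0 ≤ n := by linarith
    positivity
  refine ⟨?_, ?_, ?_, ?_⟩
  · rw [slopeStep_of_nonpos γ (by norm_num), slopeInv_neg_one_neg_one hn, hγ.left]
    simp only [planarMap, planarLin]
    ext
    · simp
      field_simp
      ring
    · simp
      field_simp
      ring
  · rw [slopeStep_of_nonneg hn hγ zero_le_one, slopeInv_one_one hn, hγ.right]
    simp only [planarMap, planarLin]
    ext
    · simp
      field_simp
      ring
    · simp
      field_simp
      ring
  · intro s hs r hr' hsr
    rcases le_total r 0 with hr0 | hr0
    · have hs2 : s ∈ Icc (-1 : ℝ) 0 := ⟨hs.1, hsr.trans hr0⟩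
      rw [hl s hs2 r ⟨hr'.1, hr0⟩]
      exact planarLin_mem_cone hn (Or.inl rfl) (hcl _ hs2 _ ⟨hr'.1, hr0⟩ hsr)
    · have hr2 : r ∈ Icc (0 : ℝ) 1 := ⟨hr0, hr'.2⟩
      rcases le_total s 0 with hs0 | hs0
      · have hs2 : s ∈ Icc (-1 : ℝ) 0 := ⟨hs.1, hs0⟩
        rw [← sub_add_sub_cancel _ (HarmonicGasket.slopeStep n γ 0), hl s hs2 0 h0l, hr 0 h0r r hr2]
        exact add_mem_cone (planarLin_mem_cone hn (Or.inr rfl) (hcr _ h0r _ hr2 hr0))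
          (planarLin_mem_cone hn (Or.inl rfl) (hcl _ hs2 _ h0l hs0))
      · have hs2 : s ∈ Icc (0 : ℝ) 1 := ⟨hs0, hs.2⟩
        rw [hr s hs2 r hr2]
        exact planarLin_mem_cone hn (Or.inr rfl) (hcr _ hs2 _ hr2 hsr)
  · intro s hs r hr'
    rcases le_total s 0 with hs0 | hs0
    · have hs2 : s ∈ Icc (-1 : ℝ) 0 := ⟨hs.1, hs0⟩
      rcases le_total r 0 with hr0 | hr0
      · exact htl s hs2 r ⟨hr'.1, hr0⟩
      · have h1 := htl s hs2 0 h0l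
        obtain ⟨h2, h3⟩ := planarLin_right_of_cone hn (hcr 0 h0r r ⟨hr0, hr'.2⟩ hr0)
        rw [← hr 0 h0r r ⟨hr0, hr'.2⟩] at h2 h3
        rw [← sub_add_sub_cancel _ (HarmonicGasket.slopeStep n γ 0)]
        simp only [Prod.snd_add, Prod.fst_add] at *
        nlinarith
    · have hs2 : s ∈ Icc (0 : ℝ) 1 := ⟨hs0, hs.2⟩
      rcases le_total r 0 with hr0 | hr0
      · have h1 := htr s hs2 0 h0r
        obtain ⟨h2, h3⟩ := planarLin_left_of_cone hn (hcl r ⟨hr'.1, hr0⟩ 0 h0l hr0)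
        rw [← hl r ⟨hr'.1, hr0⟩ 0 h0l] at h2 h3
        rw [← sub_add_sub_cancel _ (HarmonicGasket.slopeStep n γ 0)]
        simp only [Prod.snd_add, Prod.fst_add, Prod.snd_sub, Prod.fst_sub] at *
        nlinarith
      · exact htr s hs2 r ⟨hr0, hr'.2⟩

theorem dist_planarMap_le (hn : 2 ≤ n) (hε : ε = -1 ∨ ε = 1) (u v : ℝ × ℝ) :
    dist (planarMap n ε u) (planarMap n ε v) ≤ n / (n + 2) * dist u v := by
  rw [dist_eq_norm, dist_eq_norm, planarLin_sub]
  exact norm_planarLin_le hn hε _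

/-- Banach's fixed point theorem for `slopeStep` on the closed set `M` of slope curves in `C([-1,1],
ℝ²)`; the parabola shows that `M` is not empty. Curves are extended by constants beyond `[-1,1]`. -/
theorem exists_slopeCurve (hn : 2 ≤ n) : ∃ γ : ℝ → ℝ × ℝ, Continuous γ ∧ IsSlopeCurve γ ∧
    ∀ s ∈ Icc (-1 : ℝ) 1, γ s = slopeStep n γ s := by
  have h11 : (-1 : ℝ) ≤ 1 := by norm_num
  let M : Set C(Icc (-1 : ℝ) 1, ℝ × ℝ) := {f | IsSlopeCurve (IccExtend h11 f)}
  have hM : IsClosed M := by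
    have hev : ∀ s, Continuous fun f : C(Icc (-1 : ℝ) 1, ℝ × ℝ) => IccExtend h11 f s := fun s =>
      continuous_eval_const (F := C(Icc (-1 : ℝ) 1, ℝ × ℝ)) _
    have hcone : IsClosed cone := by
      unfold cone
      exact isClosed_le (by fun_prop) (by fun_prop)
    have : M = {f : C(Icc (-1 : ℝ) 1, ℝ × ℝ) | IccExtend h11 f (-1) = (-1 / 2, 1 / 2)} ∩ {f : C(Icc (-1 : ℝ) 1, ℝ × ℝ) | IccExtend h11 f 1 = (1 / 2, 1 / 2)}
        ∩ (⋂ s ∈ Icc (-1 : ℝ) 1, ⋂ r ∈ Icc (-1 : ℝ) 1, ⋂ _ : s ≤ r,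
          {f : C(Icc (-1 : ℝ) 1, ℝ × ℝ) | IccExtend h11 f r - IccExtend h11 f s ∈ cone})
        ∩ (⋂ s ∈ Icc (-1 : ℝ) 1, ⋂ r ∈ Icc (-1 : ℝ) 1,
          {f : C(Icc (-1 : ℝ) 1, ℝ × ℝ) | 0 ≤ (IccExtend h11 f r - IccExtend h11 f s).2 -
            s * (IccExtend h11 f r - IccExtend h11 f s).1}) := by
      ext f
      simp only [mem_inter_iff, mem_iInter]
      exact ⟨fun h => ⟨⟨⟨h.1, h.2⟩, h.3⟩, h.4⟩, fun h => ⟨h.1.1.1, h.1.1.2, h.1.2, h.2⟩⟩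
    rw [this]
    refine (((isClosed_eq (hev _) continuous_const).inter
      (isClosed_eq (hev _) continuous_const)).inter ?_).inter ?_
    · exact isClosed_biInter fun s _ => isClosed_biInter fun r _ => isClosed_iInter fun _ =>
        hcone.preimage ((hev r).sub (hev s))
    · refine isClosed_biInter fun s _ => isClosed_biInter fun r _ => isClosed_le continuous_const ?_
      have := (hev r).sub (hev s)
      exact (continuous_snd.comp this).sub (continuous_const.mul (continuous_fst.comp this))
  have hcont : ∀ f : C(Icc (-1 : ℝ) 1, ℝ × ℝ), Continuous (IccExtend h11 f) := fun f =>
    f.continuous.Icc_extend'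
  let R : M → M := fun f =>
    ⟨⟨(Icc (-1 : ℝ) 1).domRestrict (slopeStep n (IccExtend h11 f.1)),
      (slopeStep_continuousOn hn f.2 (hcont f.1)).domRestrict⟩,
      (f.2.slopeStep hn).congr fun s hs => by
        rw [IccExtend_of_mem _ _ hs]
        rfl⟩
  have hR : ∀ f g : M, dist (R f) (R g) ≤ n / (n + 2) * dist f g := by
    intro f g
    have hρ : 0 ≤ n / (n + 2) := div_nonneg (by linarith) (by linarith)
    rw [Subtype.dist_eq, Subtype.dist_eq, ContinuousMap.dist_le (by positivity)]
    have hfg : ∀ s, dist (IccExtend h11 f.1 s) (IccExtend h11 g.1 s) ≤ dist f.1 g.1 := fun s =>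
      ContinuousMap.dist_apply_le_dist _
    rintro ⟨s, hs⟩
    change dist (slopeStep n (IccExtend h11 f.1) s) (slopeStep n (IccExtend h11 g.1) s) ≤ _
    rcases le_total s 0 with h | h
    · rw [slopeStep_of_nonpos _ h, slopeStep_of_nonpos _ h]
      exact (dist_planarMap_le hn (Or.inl rfl) _ _).trans (mul_le_mul_of_nonneg_left (hfg _) hρ)
    · rw [slopeStep_of_nonneg hn f.2 h, slopeStep_of_nonneg hn g.2 h]
      exact (dist_planarMap_le hn (Or.inr rfl) _ _).trans (mul_le_mul_of_nonneg_left (hfg _) hρ)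
  have hne : Nonempty M := by
    refine ⟨⟨⟨fun s => ((s : ℝ) / 2, (s : ℝ) ^ 2 / 4 + 1 / 4), by fun_prop⟩, ?_⟩⟩
    refine isSlopeCurve_parabola.congr fun s hs => ?_
    rw [IccExtend_of_mem _ _ hs]
    rfl
  have hcs : CompleteSpace M := hM.isComplete.completeSpace_coe
  have hn0 : 0 ≤ n / (n + 2) := div_nonneg (by linarith) (by linarith)
  have hctr : ContractingWith (n / (n + 2)).toNNReal R := by
    refine ⟨?_, LipschitzWith.of_dist_le_mul fun f g => ?_⟩
    · rw [Real.toNNReal_lt_one]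
      exact (div_lt_one (by linarith)).2 (by linarith)
    · rw [Real.coe_toNNReal _ hn0]
      exact hR f g
  have hfix := hctr.fixedPoint_isFixedPt
  set f := ContractingWith.fixedPoint R hctr
  refine ⟨IccExtend h11 f.1, hcont _, f.2, fun s hs => ?_⟩
  rw [IccExtend_of_mem _ _ hs]
  have := congrArg (fun g : M => g.1 ⟨s, hs⟩) hfix
  exact this.symm

end SlopeCurve

/-! ### Contraction of slopes and absence of corners -/

section SlopeCurve

variable {n ε s t x y : ℝ}

/-- The square of a distance on `[-1,1]` that is contracted by both maps `slope n ε`. -/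
noncomputable def slopeGap (n x y : ℝ) : ℝ := (x - y) ^ 2 / (slopeForm n x * slopeForm n y)

/-- The squared difference acquires the factor `(4n)²` over the squared denominators, whereas by
`slopeForm_slope` the product of the forms acquires at least `(4(n + 2))²` over the same
denominators. -/
theorem slopeGap_slope_lt (hn : 2 ≤ n) (hε : ε = -1 ∨ ε = 1) (hx : x ∈ Icc (-1 : ℝ) 1)
    (hy : y ∈ Icc (-1 : ℝ) 1) (hxy : x ≠ y) :
    slopeGap n (slope n ε x) (slope n ε y) < slopeGap n x y := by
  have hn0 : 0 < n := by linarith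
  have hDx := four_le_slopeDen hn hε hx
  have hDy := four_le_slopeDen hn hε hy
  have hqx := two_le_slopeForm hn hx
  have hqy := two_le_slopeForm hn hy
  have hqx' := two_le_slopeForm hn (slope_mem hn hε hx)
  have hqy' := two_le_slopeForm hn (slope_mem hn hε hy)
  have h1 := slopeForm_slope hn hε hx
  have h2 := slopeForm_slope hn hε hy
  have hpos : 0 < (x - y) ^ 2 := by
    have := sub_ne_zero.2 hxy
    positivity
  unfold slopeGap
  rw [slope_sub_slope hn hε hx hy, div_pow, div_div, div_lt_div_iff₀ (by positivity) (by positivity)]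
  have h3 : (4 * n * slopeForm n x) * (4 * n * slopeForm n y) <
      (slopeDen n ε x ^ 2 * slopeForm n (slope n ε x)) *
      (slopeDen n ε y ^ 2 * slopeForm n (slope n ε y)) :=
    mul_lt_mul'' (lt_of_lt_of_le (by nlinarith) h1) (lt_of_lt_of_le (by nlinarith) h2)
      (by positivity) (by positivity)
  have := mul_lt_mul_of_pos_left h3 hpos
  linarith

theorem slopeGap_pos (hn : 2 ≤ n) (hx : x ∈ Icc (-1 : ℝ) 1) (hy : y ∈ Icc (-1 : ℝ) 1)
    (hxy : x ≠ y) : 0 < slopeGap n x y := by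
  have hqx := two_le_slopeForm hn hx
  have hqy := two_le_slopeForm hn hy
  have := sub_ne_zero.2 hxy
  unfold slopeGap
  positivity

theorem continuousOn_slopeGap (hn : 2 ≤ n) :
    ContinuousOn (fun z : ℝ × ℝ => slopeGap n z.1 z.2) (Icc (-1) 1 ×ˢ Icc (-1) 1) := by
  unfold slopeGap
  refine ContinuousOn.div (by fun_prop) (by unfold slopeForm; fun_prop) ?_
  rintro ⟨x, y⟩ ⟨hx, hy⟩
  have hqx := two_le_slopeForm hn hx
  have hqy := two_le_slopeForm hn hy
  simp only
  positivity

/-- A slope curve that is invariant under the maps `planarMap n ε`. -/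
structure IsSelfSimilar (n : ℝ) (γ : ℝ → ℝ × ℝ) : Prop extends IsSlopeCurve γ where
  continuous : Continuous γ
  map_slope : ∀ ε, (ε = -1 ∨ ε = 1) → ∀ s ∈ Icc (-1 : ℝ) 1, γ (slope n ε s) = planarMap n ε (γ s)

theorem exists_isSelfSimilar (hn : 2 ≤ n) : ∃ γ, IsSelfSimilar n γ := by
  obtain ⟨γ, hc, hγ, h⟩ := exists_slopeCurve hn
  refine ⟨γ, hγ, hc, ?_⟩
  rintro ε hε s hs
  rw [h _ (slope_mem hn hε hs)]
  rcases hε with rfl | rfl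
  · rw [slopeStep_of_nonpos γ (slope_mem_left hn hs).2, slopeInv_slope hn (Or.inl rfl) hs]
  · rw [slopeStep_of_nonneg hn hγ (slope_mem_right hn hs).1, slopeInv_slope hn (Or.inr rfl) hs]

namespace IsSelfSimilar

variable {γ : ℝ → ℝ × ℝ}

theorem eq_of_slope_eq (h : IsSelfSimilar n γ) (hn : 2 ≤ n) (hε : ε = -1 ∨ ε = 1)
    (hx : x ∈ Icc (-1 : ℝ) 1) (hy : y ∈ Icc (-1 : ℝ) 1)
    (hxy : γ (slope n ε x) = γ (slope n ε y)) : γ x = γ y := by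
  rw [h.map_slope ε hε x hx, h.map_slope ε hε y hy, ← sub_eq_zero, planarLin_sub] at hxy
  exact sub_eq_zero.1 (planarLin_injective hn hε hxy)

/-- By the cone condition the height cannot change unless the abscissa does, and the abscissa is
monotone. -/
theorem eq_of_mem_Icc (h : IsSelfSimilar n γ) {r : ℝ} (hs : s ∈ Icc (-1 : ℝ) 1)
    (hr : r ∈ Icc (-1 : ℝ) 1) (ht : t ∈ Icc s r) (hsr : (γ s).1 = (γ r).1) : γ s = γ t := by
  have ht' : t ∈ Icc (-1 : ℝ) 1 := ⟨hs.1.trans ht.1, ht.2.trans hr.2⟩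
  have h1 := mem_cone.1 (h.sub_mem_cone s hs t ht' ht.1)
  have h2 := mem_cone.1 (h.sub_mem_cone t ht' r hr ht.2)
  rw [Prod.fst_sub, Prod.snd_sub] at h1 h2
  have h3 := abs_nonneg ((γ r).2 - (γ t).2)
  have h4 : (γ t).2 - (γ s).2 = 0 := abs_nonpos_iff.1 (by linarith)
  have h5 := abs_nonneg ((γ t).2 - (γ s).2)
  ext <;> linarith

theorem map_zero (h : IsSelfSimilar n γ) (hn : 2 ≤ n) : γ 0 = (0, 1 / (n + 2)) := by
  have h1 := h.map_slope 1 (Or.inr rfl) (-1) mem_Icc_neg_one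
  rw [slope_one_neg_one, h.left] at h1
  rw [h1]
  have : n + 2 ≠ 0 := by linarith
  simp only [planarMap, planarLin]
  ext
  · simp
    field_simp
    ring
  · simp only [Prod.snd_add]
    ring

/-- Among the slopes whose point is `γ 1`, take one with the largest gap to `1`. The inverse of
`slope n 1` fixes `1`, preserves the coincidence and enlarges the gap. A slope `r ≤ 0` is excluded
because it would force `γ 0 = γ 1`. -/
theorem ne_right (h : IsSelfSimilar n γ) (hn : 2 ≤ n) (hs : s ∈ Icc (-1 : ℝ) 1) (hs1 : s < 1) :
    γ s ≠ γ 1 := by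
  intro hflat
  have hcomp : IsCompact (Icc (-1 : ℝ) 1 ∩ {s | γ s = γ 1}) :=
    isCompact_Icc.inter_right (isClosed_eq h.continuous continuous_const)
  have hgap : ContinuousOn (fun s => slopeGap n s 1) (Icc (-1 : ℝ) 1 ∩ {s | γ s = γ 1}) :=
    (continuousOn_slopeGap hn).comp (f := fun s : ℝ => (s, (1 : ℝ))) (by fun_prop)
      fun s hs => ⟨hs.1, mem_Icc_one⟩
  obtain ⟨r, ⟨hr, hr1⟩, hmax⟩ := hcomp.exists_isMaxOn ⟨s, hs, hflat⟩ hgap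
  have hr1' : γ r = γ 1 := hr1
  have hne : r ≠ 1 := by
    rintro rfl
    have h1 : slopeGap n s 1 ≤ slopeGap n 1 1 := hmax ⟨hs, hflat⟩
    have h2 := slopeGap_pos hn hs mem_Icc_one hs1.ne
    rw [slopeGap, slopeGap, sub_self] at *
    simp at h1
    linarith
  rcases le_total 0 r with h0 | h0
  · have hr' := slopeInv_mem_right hn ⟨h0, hr.2⟩
    have e := slope_slopeInv hn (Or.inr rfl) hr
    have hne' : slopeInv n 1 r ≠ 1 := by
      intro h'
      rw [h', slope_one_one hn] at e
      exact hne e.symm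
    have h1 : γ (slopeInv n 1 r) = γ 1 :=
      h.eq_of_slope_eq hn (Or.inr rfl) hr' mem_Icc_one (by rw [e, slope_one_one hn, hr1'])
    have h2 := slopeGap_slope_lt hn (Or.inr rfl) hr' mem_Icc_one hne'
    rw [e, slope_one_one hn] at h2
    exact absurd (hmax ⟨hr', h1⟩) h2.not_ge
  · have h1 := h.eq_of_mem_Icc hr mem_Icc_one ⟨h0, zero_le_one⟩ (by rw [hr1'])
    rw [hr1', h.map_zero hn, h.right] at h1
    have := congrArg Prod.fst h1
    norm_num at this

/-- Two slopes with one point form a corner; take a corner of largest gap. If both slopes lie on the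
same side of `0`, pulling back gives a corner with a larger gap. If they lie on different sides,
then `γ a = γ 0`, and the inverse of the left map turns this into a corner at the right end, against
`ne_right`. -/
theorem injOn (h : IsSelfSimilar n γ) (hn : 2 ≤ n) {r : ℝ} (hs : s ∈ Icc (-1 : ℝ) 1)
    (hr : r ∈ Icc (-1 : ℝ) 1) (hsr : s < r) : γ s ≠ γ r := by
  intro hflat
  set A : Set (ℝ × ℝ) := (Icc (-1) 1 ×ˢ Icc (-1) 1) ∩ ({z | z.1 ≤ z.2} ∩ {z | γ z.1 = γ z.2})
  have hcomp : IsCompact A := (isCompact_Icc.prod isCompact_Icc).inter_right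
    ((isClosed_le continuous_fst continuous_snd).inter
      (isClosed_eq (h.continuous.comp continuous_fst) (h.continuous.comp continuous_snd)))
  have hmem : (s, r) ∈ A := ⟨⟨hs, hr⟩, hsr.le, hflat⟩
  obtain ⟨⟨a, b⟩, ⟨⟨ha, hb⟩, hab, hab'⟩, hmax⟩ :=
    hcomp.exists_isMaxOn ⟨_, hmem⟩ ((continuousOn_slopeGap hn).mono inter_subset_left)
  simp only at ha hb
  have hab : a ≤ b := hab
  have hab' : γ a = γ b := hab'
  have hmax : ∀ c d, c ∈ Icc (-1 : ℝ) 1 → d ∈ Icc (-1 : ℝ) 1 → c ≤ d → γ c = γ d →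
      slopeGap n c d ≤ slopeGap n a b := fun c d hc hd h1 h2 =>
    hmax (show (c, d) ∈ A from ⟨⟨hc, hd⟩, h1, h2⟩)
  have hne : a ≠ b := by
    rintro rfl
    have h1 := hmax s r hs hr hsr.le hflat
    have h2 := slopeGap_pos hn hs hr hsr.ne
    rw [slopeGap, slopeGap, sub_self] at *
    simp at h1
    linarith
  have pull : ∀ ε, (ε = -1 ∨ ε = 1) → slopeInv n ε a ∈ Icc (-1 : ℝ) 1 →
      slopeInv n ε b ∈ Icc (-1 : ℝ) 1 → False := by
    intro ε hε ha' hb'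
    have ea := slope_slopeInv hn hε ha
    have eb := slope_slopeInv hn hε hb
    have h1 := h.eq_of_slope_eq hn hε ha' hb' (by rw [ea, eb, hab'])
    have hne' : slopeInv n ε a ≠ slopeInv n ε b := fun h' => hne (by rw [← ea, ← eb, h'])
    have h2 := slopeGap_slope_lt hn hε ha' hb' hne'
    rw [ea, eb] at h2
    exact absurd (hmax _ _ ha' hb' (slopeInv_mono hn hε ha hb hab) h1) h2.not_ge
  rcases le_total b 0 with hb0 | hb0
  · exact pull (-1) (Or.inl rfl) (slopeInv_mem_left hn ⟨ha.1, hab.trans hb0⟩)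
      (slopeInv_mem_left hn ⟨hb.1, hb0⟩)
  · rcases le_or_gt 0 a with ha0 | ha0
    · exact pull 1 (Or.inr rfl) (slopeInv_mem_right hn ⟨ha0, ha.2⟩)
        (slopeInv_mem_right hn ⟨ha0.trans hab, hb.2⟩)
    · have h1 := h.eq_of_mem_Icc ha hb ⟨ha0.le, hb0⟩ (by rw [hab'])
      have ha' := slopeInv_mem_left hn ⟨ha.1, ha0.le⟩
      have ea := slope_slopeInv hn (Or.inl rfl) ha
      have h2 : γ (slopeInv n (-1) a) = γ 1 := h.eq_of_slope_eq hn (Or.inl rfl) ha' mem_Icc_one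
        (by rw [ea, slope_neg_one_one, h1])
      refine h.ne_right hn ha' (lt_of_le_of_ne ha'.2 fun h3 => ?_) h2
      rw [h3, slope_neg_one_one] at ea
      exact ha0.ne ea.symm

theorem strictMonoOn (h : IsSelfSimilar n γ) (hn : 2 ≤ n) :
    StrictMonoOn (fun s => (γ s).1) (Icc (-1) 1) := by
  intro s hs r hr hsr
  refine lt_of_le_of_ne ?_ fun heq => ?_
  · have := mem_cone.1 (h.sub_mem_cone s hs r hr hsr.le)
    have := (abs_nonneg _).trans this
    rw [Prod.fst_sub] at this
    exact sub_nonneg.1 this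
  · exact h.injOn hn hs hr hsr (h.eq_of_mem_Icc hs hr (right_mem_Icc.2 hsr.le) heq)

end IsSelfSimilar

end SlopeCurve

/-! ### The curve as a graph over the edge -/

section Graph

variable {n : ℝ} {γ : ℝ → ℝ × ℝ}

/-- The inverse of the strictly increasing abscissa. It is continuous because its graph is, up to
exchanging coordinates, the compact graph of the abscissa. -/
theorem IsSelfSimilar.exists_slopeAt (h : IsSelfSimilar n γ) (hn : 2 ≤ n) :
    ∃ σ : ℝ → ℝ, Continuous σ ∧ ∀ t ∈ Icc (0 : ℝ) 1, σ t ∈ Icc (-1 : ℝ) 1 ∧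
      (γ (σ t)).1 = t - 1 / 2 := by
  have hex : ∀ t, ∃ s, t ∈ Icc (0 : ℝ) 1 → s ∈ Icc (-1 : ℝ) 1 ∧ (γ s).1 = t - 1 / 2 := by
    intro t
    by_cases ht : t ∈ Icc (0 : ℝ) 1
    · obtain ⟨s, hs, hst⟩ := intermediate_value_Icc (show (-1 : ℝ) ≤ 1 by norm_num)
        (f := fun s => (γ s).1) (continuous_fst.comp h.continuous).continuousOn
        (show t - 1 / 2 ∈ Icc (γ (-1)).1 (γ 1).1 by
          rw [h.left, h.right]
          constructor <;> linarith [ht.1, ht.2])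
      exact ⟨s, fun _ => ⟨hs, hst⟩⟩
    · exact ⟨0, fun h' => absurd h' ht⟩
  choose σ hσ using hex
  have hgraph : (fun t => (t, σ t)) '' Icc 0 1 = (fun s => ((γ s).1 + 1 / 2, s)) '' Icc (-1) 1 := by
    apply Subset.antisymm
    · rintro _ ⟨t, ht, rfl⟩
      refine ⟨σ t, (hσ t ht).1, ?_⟩
      simp only [(hσ t ht).2, sub_add_cancel]
    · rintro _ ⟨s, hs, rfl⟩
      have hmono := (h.strictMonoOn hn).monotoneOn
      have h1 := hmono mem_Icc_neg_one hs hs.1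
      have h2 := hmono hs mem_Icc_one hs.2
      simp only [h.left, h.right] at h1 h2
      have ht : (γ s).1 + 1 / 2 ∈ Icc (0 : ℝ) 1 := by constructor <;> linarith
      refine ⟨_, ht, ?_⟩
      have : σ ((γ s).1 + 1 / 2) = s := by
        apply (h.strictMonoOn hn).injOn (hσ _ ht).1 hs
        simp only [(hσ _ ht).2]
        ring
      simp only [this]
  have hc : ContinuousOn σ (Icc 0 1) := by
    apply continuousOn_of_isCompact_graph
    rw [hgraph]
    exact isCompact_Icc.image (((continuous_fst.comp h.continuous).add continuous_const).prodMk
      continuous_id)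
  refine ⟨IccExtend zero_le_one ((Icc (0 : ℝ) 1).domRestrict σ), hc.domRestrict.Icc_extend', ?_⟩
  intro t ht
  rw [IccExtend_of_mem _ _ ht]
  exact hσ t ht

/-- The supporting lines at both points give `0 ≤ Δy - σ(t) Δx ≤ (σ(r) - σ(t)) Δx`, and the right
side is `o(Δx)` by continuity of `σ`. -/
theorem IsSelfSimilar.hasDerivWithinAt (h : IsSelfSimilar n γ) {σ : ℝ → ℝ} (hσ : Continuous σ)
    (hσ' : ∀ t ∈ Icc (0 : ℝ) 1, σ t ∈ Icc (-1 : ℝ) 1 ∧ (γ (σ t)).1 = t - 1 / 2)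
    {t : ℝ} (ht : t ∈ Icc (0 : ℝ) 1) :
    HasDerivWithinAt (fun t => (γ (σ t)).2) (σ t) (Icc 0 1) t := by
  rw [hasDerivWithinAt_iff_isLittleO]
  have h1 : (fun r => σ r - σ t) =o[𝓝[Icc 0 1] t] fun _ => (1 : ℝ) := by
    rw [Asymptotics.isLittleO_one_iff]
    have := (hσ.tendsto t).sub_const (σ t)
    rw [sub_self] at this
    exact this.mono_left nhdsWithin_le_nhds
  have h2 := h1.mul_isBigO (Asymptotics.isBigO_refl (fun r => r - t) (𝓝[Icc 0 1] t))
  simp only [one_mul] at h2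
  refine Asymptotics.IsBigO.trans_isLittleO (Asymptotics.IsBigO.of_bound 1 ?_) h2
  filter_upwards [self_mem_nhdsWithin] with r hr
  obtain ⟨ht1, ht2⟩ := hσ' t ht
  obtain ⟨hr1, hr2⟩ := hσ' r hr
  have h3 := h.tangent _ ht1 _ hr1
  have h4 := h.tangent _ hr1 _ ht1
  rw [Prod.fst_sub, Prod.snd_sub, ht2, hr2] at h3 h4
  rw [one_mul, smul_eq_mul, Real.norm_eq_abs, Real.norm_eq_abs, abs_of_nonneg (by linarith)]
  refine le_trans ?_ (le_abs_self _)
  linarith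

end Graph

/-! ### The plane through an edge of the simplex -/

section Plane

variable {N : ℕ} {i j : Fin N}

/-- The direction of the edge from `p_i` to `p_j`. -/
noncomputable def edge (i j : Fin N) : Y N := p N j - p N i

/-- Twice the midpoint of the edge from `p_i` to `p_j`. -/
noncomputable def axis (i j : Fin N) : Y N := p N i + p N j

/-- The point with given coordinates with respect to `edge i j` and `axis i j`. -/
noncomputable def emb (i j : Fin N) (x : ℝ × ℝ) : Y N := x.1 • edge i j + x.2 • axis i j

/-- The normal vector in the plane of an edge to the direction of slope `s`. -/
noncomputable def normal (i j : Fin N) (s : ℝ) : Y N :=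
  axis i j - (s * (((N : ℝ) - 2) / N)) • edge i j

/-- The sign belonging to the first or second vertex of an edge. -/
def sgn : Fin 2 → ℝ := ![-1, 1]

theorem sgn_eq (b : Fin 2) : sgn b = -1 ∨ sgn b = 1 := by
  fin_cases b
  · exact Or.inl rfl
  · exact Or.inr rfl

theorem inner_edge_edge (hij : i ≠ j) : inner ℝ (edge i j) (edge i j) = 1 := by
  have hN := cast_ne_zero_of_fin i
  simp only [edge, inner_sub_left, inner_sub_right, inner_p_p, if_true, if_neg hij, if_neg hij.symm]
  ring

theorem inner_edge_axis (hij : i ≠ j) : inner ℝ (edge i j) (axis i j) = 0 := by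
  simp only [edge, axis, inner_sub_left, inner_add_right, inner_p_p, if_true, if_neg hij,
    if_neg hij.symm]
  ring

theorem inner_axis_edge (hij : i ≠ j) : inner ℝ (axis i j) (edge i j) = 0 := by
  rw [real_inner_comm, inner_edge_axis hij]

/-- For `N = 2` the value is zero: `axis i j` vanishes, the plane collapses to a line and every
`normal i j s` is zero. The arguments below cover this case. -/
theorem inner_axis_axis (hij : i ≠ j) :
    inner ℝ (axis i j) (axis i j) = ((N : ℝ) - 2) / N := by
  have hN := cast_ne_zero_of_fin i
  simp only [axis, inner_add_left, inner_add_right, inner_p_p, if_true, if_neg hij, if_neg hij.symm]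
  field_simp
  ring

theorem p_eq_edge_axis (b : Fin 2) :
    p N (![i, j] b) = (1 / 2 : ℝ) • (axis i j + sgn b • edge i j) := by
  fin_cases b
  · simp only [axis, edge, sgn, Fin.zero_eta, Matrix.cons_val_zero]
    module
  · simp only [axis, edge, sgn, Fin.mk_one, Matrix.cons_val_one, Matrix.cons_val_zero]
    module

theorem inner_edge_emb (hij : i ≠ j) (x : ℝ × ℝ) : inner ℝ (edge i j) (emb i j x) = x.1 := by
  rw [emb, inner_add_right, inner_smulY_right, inner_smulY_right, inner_edge_edge hij,
    inner_edge_axis hij]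
  ring

theorem inner_axis_emb (hij : i ≠ j) (x : ℝ × ℝ) :
    inner ℝ (axis i j) (emb i j x) = ((N : ℝ) - 2) / N * x.2 := by
  rw [emb, inner_add_right, inner_smulY_right, inner_smulY_right, inner_axis_edge hij,
    inner_axis_axis hij]
  ring

theorem inner_normal (s : ℝ) (x : Y N) : inner ℝ (normal i j s) x =
    inner ℝ (axis i j) x - s * (((N : ℝ) - 2) / N) * inner ℝ (edge i j) x := by
  rw [normal, inner_sub_left, inner_smulY_left]

theorem inner_normal_emb (hij : i ≠ j) (s : ℝ) (x : ℝ × ℝ) :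
    inner ℝ (normal i j s) (emb i j x) = ((N : ℝ) - 2) / N * (x.2 - s * x.1) := by
  rw [inner_normal, inner_edge_emb hij, inner_axis_emb hij]
  ring

theorem inner_p_edge (hij : i ≠ j) (b : Fin 2) :
    inner ℝ (p N (![i, j] b)) (edge i j) = sgn b / 2 := by
  rw [p_eq_edge_axis, inner_smulY_left, inner_add_left, inner_smulY_left, inner_edge_edge hij,
    inner_axis_edge hij]
  ring

theorem inner_p_axis (hij : i ≠ j) (b : Fin 2) :
    inner ℝ (p N (![i, j] b)) (axis i j) = ((N : ℝ) - 2) / (2 * N) := by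
  rw [p_eq_edge_axis, inner_smulY_left, inner_add_left, inner_smulY_left, inner_axis_axis hij,
    inner_edge_axis hij]
  have hN := cast_ne_zero_of_fin i
  field_simp
  ring

theorem emb_sub (x y : ℝ × ℝ) : emb i j x - emb i j y = emb i j (x - y) := by
  simp only [emb, Prod.fst_sub, Prod.snd_sub]
  module

theorem T_emb (hij : i ≠ j) (b : Fin 2) (x : ℝ × ℝ) :
    T N (![i, j] b) (emb i j x) = emb i j (planarLin N (sgn b) x) := by
  have hN := cast_ne_zero_of_fin i
  have hN2 : (N : ℝ) + 2 ≠ 0 := by positivity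
  rw [T_apply, emb, inner_add_right, inner_smulY_right, inner_smulY_right, inner_p_edge hij,
    inner_p_axis hij, p_eq_edge_axis]
  simp only [emb, planarLin]
  match_scalars
  · field_simp
    linear_combination (N * x.1) * sq_eq_one_of_sign (sgn_eq b)
  · field_simp
    ring

theorem S_emb (hij : i ≠ j) (b : Fin 2) (x : ℝ × ℝ) :
    S N (![i, j] b) (emb i j x) = emb i j (planarMap N (sgn b) x) := by
  have hN2 : (N : ℝ) + 2 ≠ 0 := by positivity
  have hp : p N (![i, j] b) = emb i j (sgn b / 2, 1 / 2) := by
    rw [p_eq_edge_axis, emb]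
    module
  rw [S, hp, emb_sub, T_emb hij]
  simp only [emb, planarMap, planarLin, Prod.fst_add, Prod.snd_add, Prod.fst_sub, Prod.snd_sub]
  match_scalars
  · field_simp
    ring
  · field_simp
    linear_combination (-(N : ℝ)) * sq_eq_one_of_sign (sgn_eq b)

/-- `T` is symmetric, so it transports normals backwards, from the image slope to `s`, with the
factor of `planarLin_tangent`. -/
theorem T_normal (hN : 2 ≤ N) (hij : i ≠ j) (b : Fin 2) {s : ℝ} (hs : s ∈ Icc (-1 : ℝ) 1) :
    T N (![i, j] b) (normal i j (slope N (sgn b) s)) =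
      (2 * N / ((N + 2) * slopeDen N (sgn b) s) : ℝ) • normal i j s := by
  have hN' : (2 : ℝ) ≤ N := by exact_mod_cast hN
  have hN0 : (N : ℝ) ≠ 0 := by positivity
  have hN2 : (N : ℝ) + 2 ≠ 0 := by positivity
  have hD := four_le_slopeDen hN' (sgn_eq b) hs
  have hn : ∀ s, normal i j s = emb i j (-(s * (((N : ℝ) - 2) / N)), 1) := by
    intro s
    rw [normal, emb]
    module
  rw [hn, hn, T_emb hij]
  simp only [emb, planarLin, slope]
  have hε := sgn_eq b
  generalize sgn b = ε at *
  have hD0 : slopeDen N ε s ≠ 0 := by linarith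
  have hDe : slopeDen N ε s = N + 2 + ε * (N - 2) * s := rfl
  match_scalars
  · field_simp
    rw [hDe]
    rcases hε with rfl | rfl <;> ring
  · field_simp
    rw [hDe]
    rcases hε with rfl | rfl <;> ring

end Plane

/-! ### The curve `Γ` in the gasket -/

section Edge

variable {N : ℕ} {i j : Fin N} {γ : ℝ → ℝ × ℝ} {s : ℝ}

theorem emb_left (h : IsSlopeCurve γ) : emb i j (γ (-1)) = p N i := by
  rw [h.left, emb, edge, axis]
  module

theorem emb_right (h : IsSlopeCurve γ) : emb i j (γ 1) = p N j := by
  rw [h.right, emb, edge, axis]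
  module

theorem continuous_emb : Continuous (emb i j) := by
  have h1 : Continuous fun x : ℝ × ℝ => x.1 • edge i j := continuous_fst.smul continuous_const
  have h2 : Continuous fun x : ℝ × ℝ => x.2 • axis i j := continuous_snd.smul continuous_const
  exact h1.add h2

/-- The two slope maps together cover `[-1,1]`, so the functional equation of `γ` is the
self-similarity of its image. -/
theorem isAttractor_edgeCurve (hN : 2 ≤ N) (hij : i ≠ j) (h : IsSelfSimilar N γ) :
    IsAttractor (fun b : Fin 2 => S N (![i, j] b)) ((fun s => emb i j (γ s)) '' Icc (-1) 1) := by
  have hN' : (2 : ℝ) ≤ N := by exact_mod_cast hN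
  refine ⟨(nonempty_Icc.2 (by norm_num)).image _,
    isCompact_Icc.image (continuous_emb.comp h.continuous), ?_⟩
  ext x
  simp only [mem_iUnion, image_image, S_emb hij]
  constructor
  · rintro ⟨t, ht, rfl⟩
    obtain ⟨ε, hε, s, hs, rfl⟩ := exists_slope_eq hN' ht
    obtain ⟨b, rfl⟩ : ∃ b, sgn b = ε := by
      rcases hε with rfl | rfl
      · exact ⟨0, rfl⟩
      · exact ⟨1, rfl⟩
    refine ⟨b, s, hs, ?_⟩
    simp only [h.map_slope _ hε s hs]
  · rintro ⟨b, s, hs, rfl⟩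
    exact ⟨_, slope_mem hN' (sgn_eq b) hs, by simp only [h.map_slope _ (sgn_eq b) s hs]⟩

theorem Gam_eq (hN : 2 ≤ N) (hij : i ≠ j) (h : IsSelfSimilar N γ) :
    Gam N i j = (fun s => emb i j (γ s)) '' Icc (-1) 1 :=
  attractor_eq (ratio_nonneg N) (ratio_lt_one N) (fun _ => dist_S_le _)
    (isAttractor_edgeCurve hN hij h)

/-- `X` is closed and mapped into itself by `S_i` and `S_j`, hence contains the attractor of these
two maps alone. -/
theorem edgeCurve_mem_X (hN : 2 ≤ N) (hij : i ≠ j) (h : IsSelfSimilar N γ)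
    (hs : s ∈ Icc (-1 : ℝ) 1) : emb i j (γ s) ∈ X N := by
  have hA := isAttractor_edgeCurve hN hij h
  have hX := isAttractor_X hN
  exact subset_of_subset_iUnion_image (ratio_nonneg N) (ratio_lt_one N)
    (fun b : Fin 2 => dist_S_le (![i, j] b)) hA.2.1 (hA.2.2.subset.trans subset_union_right)
    hX.2.1.isClosed hX.1 (fun b => hX.mapsTo _) (mem_image_of_mem _ hs)

/-! ### Supporting half-spaces and minimality of the curve -/

/-- The points below some supporting line of the curve. -/
def belowCurve (i j : Fin N) (γ : ℝ → ℝ × ℝ) : Set (Y N) :=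
  {x | ∃ s ∈ Icc (-1 : ℝ) 1, inner ℝ (normal i j s) (x - emb i j (γ s)) ≤ 0}

/-- The points above all supporting lines of the curve. -/
def aboveCurve (i j : Fin N) (γ : ℝ → ℝ × ℝ) : Set (Y N) :=
  {x | ∀ s ∈ Icc (-1 : ℝ) 1, 0 ≤ inner ℝ (normal i j s) (x - emb i j (γ s))}

theorem continuous_normal : Continuous (normal i j) := by
  have h1 : Continuous fun s : ℝ => (s * (((N : ℝ) - 2) / N)) • edge i j :=
    (continuous_id.mul continuous_const).smul continuous_const
  exact continuous_const.sub h1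

/-- A union over a compact parameter set: the projection along a compact factor is a closed map. -/
theorem isClosed_belowCurve (h : Continuous γ) : IsClosed (belowCurve i j γ) := by
  have : belowCurve i j γ = Prod.snd '' {a : Icc (-1 : ℝ) 1 × Y N |
      inner ℝ (normal i j a.1) (a.2 - emb i j (γ a.1)) ≤ 0} := by
    ext x
    constructor
    · rintro ⟨s, hs, hx⟩
      exact ⟨(⟨s, hs⟩, x), hx, rfl⟩
    · rintro ⟨⟨⟨s, hs⟩, x⟩, hx, rfl⟩
      exact ⟨s, hs, hx⟩
  rw [this]
  refine isClosedMap_snd_of_compactSpace _ (isClosed_le ?_ continuous_const)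
  have h1 : Continuous fun a : Icc (-1 : ℝ) 1 × Y N => (a.1 : ℝ) :=
    continuous_subtype_val.comp continuous_fst
  exact (continuous_normal.comp h1).inner
    (continuous_snd.sub (continuous_emb.comp (h.comp h1)))

theorem S_mapsTo_belowCurve (hN : 2 ≤ N) (hij : i ≠ j) (h : IsSelfSimilar N γ) (b : Fin 2) :
    MapsTo (S N (![i, j] b)) (belowCurve i j γ) (belowCurve i j γ) := by
  have hN' : (2 : ℝ) ≤ N := by exact_mod_cast hN
  rintro x ⟨s, hs, hx⟩
  refine ⟨slope N (sgn b) s, slope_mem hN' (sgn_eq b) hs, ?_⟩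
  have hD := four_le_slopeDen hN' (sgn_eq b) hs
  rw [h.map_slope _ (sgn_eq b) s hs, ← S_emb hij, S, S, add_sub_add_right_eq_sub, ← map_sub,
    sub_sub_sub_cancel_right, ← inner_T, T_normal hN hij b hs, inner_smulY_left]
  exact mul_nonpos_of_nonneg_of_nonpos (by positivity) hx

theorem inner_axis (x : Y N) : inner ℝ (axis i j) x = (bary i x + bary j x) / 2 - 1 / (N : ℝ) := by
  rw [axis, inner_add_left, bary, bary]
  ring

/-- `S_i` and `S_j` carry half-spaces below supporting lines to others of this kind. A cell of any
other letter is below the supporting line of slope `0` at once: there the `i`-th and `j`-th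
barycentric coordinates sum to at most `4 / (N + 2)`, the value at `γ 0`. -/
theorem X_subset_belowCurve (hN : 2 ≤ N) (hij : i ≠ j) (h : IsSelfSimilar N γ) :
    X N ⊆ belowCurve i j γ := by
  have hN' : (2 : ℝ) ≤ N := by exact_mod_cast hN
  have hX := isAttractor_X hN
  refine subset_of_subset_iUnion_image (ratio_nonneg N) (ratio_lt_one N)
    (fun b : Fin 2 => dist_S_le (![i, j] b)) hX.2.1 ?_ (isClosed_belowCurve h.continuous)
    ⟨emb i j (γ 0), 0, mem_Icc_zero, by simp⟩ (S_mapsTo_belowCurve hN hij h)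
  intro x hx
  obtain ⟨l, y, hy, rfl⟩ := hX.exists_eq hx
  by_cases hl : ∃ b : Fin 2, ![i, j] b = l
  · obtain ⟨b, rfl⟩ := hl
    exact Or.inr (mem_iUnion.2 ⟨b, y, hy, rfl⟩)
  · left
    have hli : l ≠ i := fun h' => hl ⟨0, h'.symm⟩
    have hlj : l ≠ j := fun h' => hl ⟨1, h'.symm⟩
    refine ⟨0, mem_Icc_zero, ?_⟩
    have hy' := X_subset_simplex hN hy
    have h1 : bary i y + bary j y ≤ 1 := by
      rw [← sum_bary i.pos y, ← Finset.sum_pair (f := fun l => bary l y) hij]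
      exact Finset.sum_le_sum_of_subset_of_nonneg (Finset.subset_univ _) fun l _ _ => hy' l
    have h2 := hy' l
    rw [inner_sub_right, inner_normal_emb hij, inner_normal, zero_mul, zero_mul, sub_zero,
      h.map_zero hN', inner_axis, bary_S, bary_S, if_neg hli, if_neg hlj]
    have h3 : ((bary i y + 1 - bary l y + 0) / ((N : ℝ) + 2) +
        (bary j y + 1 - bary l y + 0) / (N + 2)) / 2 ≤ 4 / (N + 2) / 2 := by
      rw [← add_div]
      gcongr
      linarith
    have h4 : 4 / ((N : ℝ) + 2) / 2 - 1 / N - (((N : ℝ) - 2) / N * (1 / (N + 2) - 0 * 0)) = 0 := by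
      field_simp
      ring
    simp only at *
    linarith

theorem emb_mem_aboveCurve (hN : 2 ≤ N) (hij : i ≠ j) (h : IsSlopeCurve γ)
    (hs : s ∈ Icc (-1 : ℝ) 1) : emb i j (γ s) ∈ aboveCurve i j γ := by
  intro r hr
  have hN' : (2 : ℝ) ≤ N := by exact_mod_cast hN
  rw [emb_sub, inner_normal_emb hij]
  exact mul_nonneg (div_nonneg (by linarith) (by linarith)) (h.tangent r hr s hs)

theorem isClosed_aboveCurve : IsClosed (aboveCurve i j γ) := by
  have : aboveCurve i j γ = ⋂ s ∈ Icc (-1 : ℝ) 1,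
      {x | 0 ≤ inner ℝ (normal i j s) (x - emb i j (γ s))} := by
    ext x
    simp [aboveCurve]
  rw [this]
  exact isClosed_biInter fun s _ => isClosed_le continuous_const
    (continuous_const.inner (continuous_id.sub continuous_const))

theorem convex_aboveCurve : Convex ℝ (aboveCurve i j γ) := by
  intro x hx y hy a b ha hb hab s hs
  have e : a • x + b • y - emb i j (γ s) =
      a • (x - emb i j (γ s)) + b • (y - emb i j (γ s)) := by
    have : emb i j (γ s) = (a + b) • emb i j (γ s) := by rw [hab, one_smul]
    conv_lhs => rw [this]
    module
  rw [e, inner_add_right, inner_smulY_right, inner_smulY_right]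
  exact add_nonneg (mul_nonneg ha (hx s hs)) (mul_nonneg hb (hy s hs))

/-- The point above the curve that is nearest to a point below the curve lies on a supporting
line. -/
theorem exists_inner_eq_zero (h : Continuous γ) {x q : Y N} (hx : x ∈ belowCurve i j γ)
    (hq : q ∈ aboveCurve i j γ) (hxq : ∀ c ∈ aboveCurve i j γ, inner ℝ (x - q) (c - q) ≤ 0) :
    ∃ s ∈ Icc (-1 : ℝ) 1, inner ℝ (normal i j s) (q - emb i j (γ s)) = 0 := by
  by_contra! hne
  have hpos : ∀ s ∈ Icc (-1 : ℝ) 1, 0 < inner ℝ (normal i j s) (q - emb i j (γ s)) := fun s hs =>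
    lt_of_le_of_ne (hq s hs) (hne s hs).symm
  have hc1 : Continuous fun s => inner ℝ (normal i j s) (q - emb i j (γ s)) :=
    continuous_normal.inner (continuous_const.sub (continuous_emb.comp h))
  have hc2 : Continuous fun s => inner ℝ (normal i j s) (x - q) :=
    continuous_normal.inner continuous_const
  obtain ⟨a, ha, hmin⟩ := isCompact_Icc.exists_isMinOn ⟨0, mem_Icc_zero⟩ hc1.continuousOn
  obtain ⟨B, hB⟩ := isCompact_Icc.exists_bound_of_continuousOn (s := Icc (-1 : ℝ) 1) hc2.continuousOn
  set μ := inner ℝ (normal i j a) (q - emb i j (γ a))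
  have hμ : 0 < μ := hpos a ha
  have hB0 : 0 ≤ B := (norm_nonneg _).trans (hB 0 mem_Icc_zero)
  -- All constraints hold at `q` with margin `μ`, and along `x - q` they change at rate at most `B`;
  -- so a step of this length towards `x` stays above the curve. The angle inequality then forces `x
  -- = q`.
  set δ := μ / (B + 1)
  have hδ : 0 < δ := by positivity
  have hmem : q + δ • (x - q) ∈ aboveCurve i j γ := by
    intro s hs
    rw [add_sub_right_comm, inner_add_right, inner_smulY_right]
    have h1 : μ ≤ inner ℝ (normal i j s) (q - emb i j (γ s)) := hmin hs
    have h2 := (abs_le.1 (hB s hs)).1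
    have h3 : δ * (B + 1) = μ := div_mul_cancel₀ _ (by positivity)
    nlinarith
  have h1 := hxq _ hmem
  rw [add_sub_cancel_left, inner_smulY_right] at h1
  have h2 : x - q = 0 := by
    rw [← inner_self_eq_zero (𝕜 := ℝ)]
    exact le_antisymm (nonpos_of_mul_nonpos_right h1 hδ) real_inner_self_nonneg
  obtain ⟨s, hs, hsx⟩ := hx
  rw [sub_eq_zero.1 h2] at hsx
  exact absurd hsx (hpos s hs).not_ge

/-- A curve in the gasket between the end points is at least as long as the curve, in its
parametrization as a graph. -/
theorem length_le_of_mapsTo_X (hN : 2 ≤ N) (hij : i ≠ j) (h : IsSelfSimilar N γ) {σ : ℝ → ℝ}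
    (hσ : ∀ t ∈ Icc (0 : ℝ) 1, σ t ∈ Icc (-1 : ℝ) 1 ∧ (γ (σ t)).1 = t - 1 / 2)
    {c : ℝ → Y N} (hc : ContinuousOn c (Icc 0 1)) (hcX : MapsTo c (Icc 0 1) (X N))
    (hc0 : c 0 = p N i) (hc1 : c 1 = p N j) :
    length (fun t => emb i j (γ (σ t))) ≤ length c := by
  have hN' : (2 : ℝ) ≤ N := by exact_mod_cast hN
  obtain ⟨π, hπ, hπC⟩ := exists_convex_projection
    ⟨_, emb_mem_aboveCurve hN hij h.toIsSlopeCurve mem_Icc_zero⟩ isClosed_aboveCurve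
    (convex_aboveCurve (i := i) (j := j) (γ := γ))
  have hπfix : ∀ x ∈ aboveCurve i j γ, π x = x := by
    intro x hx
    have := (hπC x).2 x hx
    have h2 : x - π x = 0 := by
      rw [← inner_self_eq_zero (𝕜 := ℝ)]
      exact le_antisymm this real_inner_self_nonneg
    exact (sub_eq_zero.1 h2).symm
  have hπ0 : π (p N i) = p N i := hπfix _ (by
    rw [← emb_left h.toIsSlopeCurve (j := j)]
    exact emb_mem_aboveCurve hN hij h.toIsSlopeCurve mem_Icc_neg_one)
  have hπ1 : π (p N j) = p N j := hπfix _ (by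
    rw [← emb_right h.toIsSlopeCurve (i := i)]
    exact emb_mem_aboveCurve hN hij h.toIsSlopeCurve mem_Icc_one)
  -- The nearest point `π (c t)` need not lie in the plane of the edge; the orthogonal projection to
  -- this plane is again `1`-Lipschitz.
  set P : Submodule ℝ (Y N) := Submodule.span ℝ {edge i j, axis i j}
  have hP : ∀ (x : Y N) (a : ℝ × ℝ), inner ℝ (edge i j) x = a.1 →
      inner ℝ (axis i j) x = ((N : ℝ) - 2) / N * a.2 → P.starProjection x = emb i j a := by
    intro x a h1 h2
    refine (Submodule.eq_starProjection_of_mem_of_inner_eq_zero ?_ ?_)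
    · exact Submodule.add_mem _
        (Submodule.smul_mem _ _ (Submodule.subset_span (mem_insert _ _)))
        (Submodule.smul_mem _ _ (Submodule.subset_span (mem_insert_of_mem _ rfl)))
    · intro w hw
      obtain ⟨r, r', rfl⟩ := Submodule.mem_span_pair.1 hw
      rw [real_inner_comm, inner_add_left, inner_smulY_left, inner_smulY_left, inner_sub_right,
        inner_sub_right, inner_edge_emb hij, inner_axis_emb hij, h1, h2]
      ring
  -- The abscissa of the projected curve. It may leave `[0,1]`, where nothing is claimed.
  set τ : ℝ → ℝ := fun t => inner ℝ (edge i j) (π (c t)) + 1 / 2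
  have hτc : ContinuousOn τ (Icc 0 1) :=
    (continuousOn_const.inner (hπ.continuous.comp_continuousOn hc)).add continuousOn_const
  have hτ0 : τ 0 = 0 := by
    simp only [τ, hc0, hπ0]
    rw [← emb_left h.toIsSlopeCurve (j := j), inner_edge_emb hij, h.left]
    norm_num
  have hτ1 : τ 1 = 1 := by
    simp only [τ, hc1, hπ1]
    rw [← emb_right h.toIsSlopeCurve (i := i), inner_edge_emb hij, h.right]
    norm_num
  have heq : ∀ t ∈ Icc (0 : ℝ) 1, τ t ∈ Icc (0 : ℝ) 1 →
      P.starProjection (π (c t)) = emb i j (γ (σ (τ t))) := by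
    intro t ht hτt
    obtain ⟨hr, hr1⟩ := hσ _ hτt
    have hx := X_subset_belowCurve hN hij h (hcX ht)
    obtain ⟨s, hs, hsq⟩ := exists_inner_eq_zero h.continuous hx (hπC (c t)).1 (hπC (c t)).2
    have h1 := (hπC (c t)).1 _ hr
    have h2 : inner ℝ (edge i j) (π (c t)) = (γ (σ (τ t))).1 := by
      rw [hr1]
      simp only [τ]
      ring
    -- The projected point lies on the supporting line at `s`, which is below the curve; and it lies
    -- above the supporting line at the point of the curve with the same abscissa.
    refine hP _ _ h2 (le_antisymm ?_ ?_)
    · have h3 := emb_mem_aboveCurve hN hij h.toIsSlopeCurve hr s hs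
      rw [emb_sub, inner_normal_emb hij] at h3
      rw [inner_sub_right, inner_normal_emb hij, inner_normal, h2] at hsq
      simp only [Prod.fst_sub, Prod.snd_sub] at h3
      linarith
    · rw [inner_sub_right, inner_normal_emb hij, inner_normal, h2] at h1
      linarith
  refine (eVariationOn_le_of_eq_comp hτc hτ0 hτ1 heq).trans ?_
  refine eVariationOn_mono_edist fun x _ y _ => ?_
  have h1 : edist (P.starProjection (π (c x))) (P.starProjection (π (c y))) ≤
      edist (π (c x)) (π (c y)) := by
    rw [edist_dist, edist_dist, dist_eq_norm, dist_eq_norm, ← map_sub]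
    exact ENNReal.ofReal_le_ofReal (P.norm_starProjection_apply_le _)
  exact h1.trans (by simpa using hπ (c x) (c y))

end Edge

/-! ### The limit of the matrices `Zm` along the curve -/

section Normalized

variable {E : Type*} [NormedAddCommGroup E] [InnerProductSpace ℝ E] [CompleteSpace E]
  {ι : Type*} [Fintype ι]

/-- The squared Hilbert–Schmidt norm becomes the trace of `A * adjoint A`, which is linear and
continuous in that operator. -/
theorem sum_sq_inner_eq (b : OrthonormalBasis ι ℝ E) (A : E →L[ℝ] E) :
    ∑ a, ∑ c, (inner ℝ (b a) (A (b c))) ^ 2 =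
      ∑ a, inner ℝ (b a) ((A * ContinuousLinearMap.adjoint A) (b a)) := by
  refine Finset.sum_congr rfl fun a _ => ?_
  change _ = inner ℝ (b a) (A (ContinuousLinearMap.adjoint A (b a)))
  rw [← ContinuousLinearMap.adjoint_inner_left, real_inner_self_eq_norm_sq,
    ← OrthonormalBasis.sum_sq_norm_inner_left b]
  refine Finset.sum_congr rfl fun c _ => ?_
  rw [ContinuousLinearMap.adjoint_inner_left, Real.norm_eq_abs, sq_abs]

/-- Operators concentrated on the line of `u` have Gram operators that converge to a multiple of the
projection onto `u`. -/
theorem tendsto_star_mul_self {D : ℕ → E →L[ℝ] E} {u : E} (hu : u ≠ 0)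
    (hDu : ∀ m, ‖D m u‖ = 1) {δ : ℕ → ℝ} (hδ0 : ∀ m, 0 ≤ δ m) (hδ : Tendsto δ atTop (𝓝 0))
    (h : ∀ m y, ‖D m (y - (ℝ ∙ u).starProjection y)‖ ≤ δ m * ‖y‖) :
    Tendsto (fun m => star (D m) * D m) atTop (𝓝 ((‖u‖ ^ 2)⁻¹ • (ℝ ∙ u).starProjection)) := by
  set P := (ℝ ∙ u).starProjection with hP
  have hPapp : ∀ y, P y = (inner ℝ u y / ‖u‖ ^ 2) • u := fun y =>
    Submodule.starProjection_singleton ℝ y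
  have hu0 : 0 < ‖u‖ := norm_pos_iff.2 hu
  have hDP : ∀ m, ‖D m * P‖ ≤ ‖u‖⁻¹ := fun m => by
    refine ContinuousLinearMap.opNorm_le_bound _ (inv_nonneg.2 hu0.le) fun y => ?_
    change ‖D m (P y)‖ ≤ _
    rw [hPapp, map_smul, norm_smul, hDu, mul_one, norm_div,
      Real.norm_of_nonneg (sq_nonneg ‖u‖), div_le_iff₀ (by positivity)]
    refine (norm_inner_le_norm u y).trans_eq ?_
    field_simp
  have hDD : ∀ m, ‖D m - D m * P‖ ≤ δ m := fun m => by
    refine ContinuousLinearMap.opNorm_le_bound _ (hδ0 m) fun y => ?_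
    have e : (D m - D m * P) y = D m (y - P y) := by
      rw [map_sub]
      rfl
    rw [e]
    exact h m y
  have hPstar : star P = P := isSelfAdjoint_starProjection (ℝ ∙ u)
  -- After replacing `D m` by `D m * P` the Gram operator equals the limit exactly; the error of
  -- this replacement is controlled by `δ m`.
  have hGP : ∀ m, star (D m * P) * (D m * P) = (‖u‖ ^ 2)⁻¹ • P := fun m => by
    ext1 y
    rw [star_mul, hPstar]
    have e : (P * star (D m) * (D m * P)) y = P (star (D m) (D m (P y))) := rfl
    rw [e, hPapp y, map_smul, map_smul, map_smul, hPapp (star (D m) (D m u)),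
      ContinuousLinearMap.star_eq_adjoint, ContinuousLinearMap.adjoint_inner_right,
      real_inner_self_eq_norm_sq, hDu, smul_apply, hPapp, smul_smul, smul_smul]
    congr 1
    ring
  rw [tendsto_iff_norm_sub_tendsto_zero]
  refine squeeze_zero (g := fun m => (‖u‖⁻¹ + δ m) * δ m + δ m * ‖u‖⁻¹)
    (fun _ => norm_nonneg _) (fun m => ?_) ?_
  · have hDn : ‖D m‖ ≤ ‖u‖⁻¹ + δ m := by
      calc ‖D m‖ = ‖D m * P + (D m - D m * P)‖ := by rw [add_sub_cancel]
        _ ≤ _ := (norm_add_le _ _).trans (add_le_add (hDP m) (hDD m))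
    rw [← hGP m]
    have e : star (D m) * D m - star (D m * P) * (D m * P) =
        star (D m) * (D m - D m * P) + star (D m - D m * P) * (D m * P) := by
      simp only [mul_sub, sub_mul, star_sub]
      abel
    rw [e]
    refine (norm_add_le _ _).trans (add_le_add ?_ ?_)
    · refine (norm_mul_le _ _).trans (mul_le_mul ?_ (hDD m) (norm_nonneg _) ?_)
      · exact ((ContinuousLinearMap.adjoint (𝕜 := ℝ)).norm_map (D m)).trans_le hDn
      · exact add_nonneg (inv_nonneg.2 hu0.le) (hδ0 m)
    · refine (norm_mul_le _ _).trans (mul_le_mul ?_ (hDP m) (norm_nonneg _) (hδ0 m))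
      exact ((ContinuousLinearMap.adjoint (𝕜 := ℝ)).norm_map _).trans_le (hDD m)
  · have := ((hδ.const_add ‖u‖⁻¹).mul hδ).add (hδ.mul_const ‖u‖⁻¹)
    simpa using this

/-- If the adjoint of `A m` is asymptotically concentrated on `u`, then the normalized matrices
`A m (A m)ᵗ` converge to the projection onto `u`. -/
theorem tendsto_normalized (b : OrthonormalBasis ι ℝ E) {A : ℕ → E →L[ℝ] E} {u : E} (hu : u ≠ 0)
    (hAu : ∀ m, ContinuousLinearMap.adjoint (A m) u ≠ 0) {δ : ℕ → ℝ} (hδ0 : ∀ m, 0 ≤ δ m)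
    (hδ : Tendsto δ atTop (𝓝 0))
    (h : ∀ m y, ‖ContinuousLinearMap.adjoint (A m) (y - (ℝ ∙ u).starProjection y)‖ ≤
      δ m * ‖ContinuousLinearMap.adjoint (A m) u‖ * ‖y‖) :
    Tendsto (fun m => (∑ a, ∑ c, (inner ℝ (b a) (A m (b c))) ^ 2)⁻¹ •
      (A m * ContinuousLinearMap.adjoint (A m))) atTop (𝓝 (ℝ ∙ u).starProjection) := by
  set P := (ℝ ∙ u).starProjection with hP
  have hu0 : 0 < ‖u‖ := norm_pos_iff.2 hu
  set k : ℕ → ℝ := fun m => ‖ContinuousLinearMap.adjoint (A m) u‖⁻¹ with hkdef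
  have hBu : ∀ m, 0 < ‖ContinuousLinearMap.adjoint (A m) u‖ := fun m => norm_pos_iff.2 (hAu m)
  have hk : ∀ m, 0 < k m := fun m => inv_pos.2 (hBu m)
  -- Division by the trace cancels any scalar, so the adjoints may be rescaled to send `u` to a unit
  -- vector.
  set D : ℕ → E →L[ℝ] E := fun m => k m • ContinuousLinearMap.adjoint (A m) with hD
  have hGlim : Tendsto (fun m => star (D m) * D m) atTop (𝓝 ((‖u‖ ^ 2)⁻¹ • P)) := by
    refine tendsto_star_mul_self hu (fun m => ?_) hδ0 hδ fun m y => ?_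
    · change ‖k m • ContinuousLinearMap.adjoint (A m) u‖ = 1
      rw [norm_smul, Real.norm_of_nonneg (hk m).le]
      exact inv_mul_cancel₀ (hBu m).ne'
    · change ‖k m • ContinuousLinearMap.adjoint (A m) (y - P y)‖ ≤ _
      rw [norm_smul, Real.norm_of_nonneg (hk m).le]
      refine (mul_le_mul_of_nonneg_left (h m y) (hk m).le).trans_eq ?_
      have : k m * ‖ContinuousLinearMap.adjoint (A m) u‖ = 1 := inv_mul_cancel₀ (hBu m).ne'
      linear_combination (δ m * ‖y‖) * this
  set tr : (E →L[ℝ] E) → ℝ := fun M => ∑ a, inner ℝ (b a) (M (b a)) with htr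
  have htrc : Continuous tr := by
    refine continuous_finsetSum _ fun a _ => continuous_const.inner ?_
    exact (ContinuousLinearMap.apply ℝ E (b a)).continuous
  have htrs : ∀ (c : ℝ) M, tr (c • M) = c * tr M := fun c M => by
    simp only [htr, smul_apply, real_inner_smul_right, Finset.mul_sum]
  have htrP : tr P = 1 := by
    have : ∀ y, inner ℝ y (P y) = (‖u‖ ^ 2)⁻¹ * ‖inner ℝ y u‖ ^ 2 := fun y => by
      have hPapp : P y = (inner ℝ u y / ‖u‖ ^ 2) • u := Submodule.starProjection_singleton ℝ y
      rw [hPapp, real_inner_smul_right, real_inner_comm u y, Real.norm_eq_abs, sq_abs]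
      ring
    simp only [htr, this]
    rw [← Finset.mul_sum, OrthonormalBasis.sum_sq_norm_inner_right]
    exact inv_mul_cancel₀ (by positivity)
  have hlim : Tendsto (fun m => (tr (star (D m) * D m))⁻¹ • (star (D m) * D m)) atTop (𝓝 P) := by
    have h1 : tr ((‖u‖ ^ 2)⁻¹ • P) = (‖u‖ ^ 2)⁻¹ := by rw [htrs, htrP, mul_one]
    have h2 := ((htrc.tendsto _).comp hGlim).inv₀ (by rw [h1]; positivity)
    have h3 := h2.smul hGlim
    rw [h1, inv_inv, smul_smul, mul_inv_cancel₀ (by positivity), one_smul] at h3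
    exact h3
  refine hlim.congr fun m => ?_
  have hAG : star (D m) * D m = (k m ^ 2) • (A m * ContinuousLinearMap.adjoint (A m)) := by
    simp only [hD, star_smul, ContinuousLinearMap.star_eq_adjoint,
      ContinuousLinearMap.adjoint_adjoint, star_trivial, smul_mul_smul_comm]
    rw [sq]
  rw [hAG, htrs, sum_sq_inner_eq, smul_smul]
  congr 1
  have := (hk m).ne'
  rw [mul_inv, mul_comm, ← mul_assoc, mul_inv_cancel₀ (by positivity), one_mul]

end Normalized

/-! ### Stretching of tangents and normals along an address -/

section Limit

variable {N : ℕ} {i j : Fin N}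

/-- The direction of slope `s` in the plane of an edge. -/
noncomputable def direction (i j : Fin N) (s : ℝ) : Y N := emb i j (1, s)

theorem T_direction (hN : 2 ≤ N) (hij : i ≠ j) (b : Fin 2) {s : ℝ} (hs : s ∈ Icc (-1 : ℝ) 1) :
    T N (![i, j] b) (direction i j s) =
      (slopeDen N (sgn b) s / (2 * (N + 2)) : ℝ) • direction i j (slope N (sgn b) s) := by
  have hN' : (2 : ℝ) ≤ N := by exact_mod_cast hN
  have hN2 : (N : ℝ) + 2 ≠ 0 := by positivity
  have hD := four_le_slopeDen hN' (sgn_eq b) hs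
  have hD0 : slopeDen N (sgn b) s ≠ 0 := by linarith
  rw [direction, direction, T_emb hij]
  simp only [emb, planarLin, slope]
  match_scalars
  · rw [slopeDen]
    ring
  · field_simp
    ring

theorem norm_direction_sq (hij : i ≠ j) (s : ℝ) :
    ‖direction i j s‖ ^ 2 = 1 + ((N : ℝ) - 2) / N * s ^ 2 := by
  rw [← real_inner_self_eq_norm_sq, direction]
  conv_lhs => rw [emb, inner_add_left, inner_smulY_left, inner_smulY_left]
  change _ * inner ℝ (edge i j) (emb i j (1, s)) + _ * inner ℝ (axis i j) (emb i j (1, s)) = _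
  rw [inner_edge_emb hij, inner_axis_emb hij]
  ring

theorem norm_normal_sq (hij : i ≠ j) (s : ℝ) :
    ‖normal i j s‖ ^ 2 = ((N : ℝ) - 2) / N * (1 + ((N : ℝ) - 2) / N * s ^ 2) := by
  rw [← real_inner_self_eq_norm_sq, inner_normal, normal, inner_sub_right, inner_sub_right,
    inner_smulY_right, inner_smulY_right, inner_edge_edge hij, inner_edge_axis hij,
    inner_axis_axis hij, inner_axis_edge hij]
  ring

theorem inner_normal_direction (hij : i ≠ j) (s : ℝ) :
    inner ℝ (normal i j s) (direction i j s) = 0 := by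
  rw [direction, inner_normal_emb hij]
  ring

theorem ratio_mem (hN : 2 ≤ N) : 0 ≤ ((N : ℝ) - 2) / N ∧ ((N : ℝ) - 2) / N ≤ 1 := by
  have hN' : (2 : ℝ) ≤ N := by exact_mod_cast hN
  constructor
  · exact div_nonneg (by linarith) (by linarith)
  · rw [div_le_one (by linarith)]
    linarith

theorem sq_le_one_of_mem {s : ℝ} (hs : s ∈ Icc (-1 : ℝ) 1) : s ^ 2 ≤ 1 := by
  nlinarith [hs.1, hs.2]

theorem one_le_norm_direction (hN : 2 ≤ N) (hij : i ≠ j) (s : ℝ) : 1 ≤ ‖direction i j s‖ := by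
  have h1 := norm_direction_sq hij s
  have h2 := mul_nonneg (ratio_mem hN).1 (sq_nonneg s)
  have h3 := norm_nonneg (direction i j s)
  nlinarith

theorem norm_direction_le (hN : 2 ≤ N) (hij : i ≠ j) {s : ℝ} (hs : s ∈ Icc (-1 : ℝ) 1) :
    ‖direction i j s‖ ≤ 2 := by
  have h1 := norm_direction_sq hij s
  have h2 := mul_le_one₀ (ratio_mem hN).2 (sq_nonneg s) (sq_le_one_of_mem hs)
  have h3 := norm_nonneg (direction i j s)
  nlinarith

/-- The squared norms are a common factor times numbers in `[1,2]` for slopes in `[-1,1]`; for `N =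
2` the common factor and both sides are zero. -/
theorem norm_normal_le (hN : 2 ≤ N) (hij : i ≠ j) {s r : ℝ} (hr : r ∈ Icc (-1 : ℝ) 1) :
    ‖normal i j r‖ ≤ 2 * ‖normal i j s‖ := by
  obtain ⟨hκ0, hκ1⟩ := ratio_mem hN
  have h1 := norm_normal_sq hij s
  have h2 := norm_normal_sq hij r
  have h3 := mul_le_one₀ hκ1 (sq_nonneg r) (sq_le_one_of_mem hr)
  have h4 := mul_nonneg hκ0 (sq_nonneg s)
  refine abs_le_of_sq_le_sq' ?_ (by positivity) |>.2
  rw [mul_pow, h1, h2]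
  nlinarith

theorem T_of_inner_eq_zero {z : Y N} (b : Fin 2) (h1 : inner ℝ (edge i j) z = 0)
    (h2 : inner ℝ (axis i j) z = 0) : T N (![i, j] b) z = (1 / ((N : ℝ) + 2)) • z := by
  rw [T_apply, p_eq_edge_axis, inner_smulY_left, inner_add_left, inner_smulY_left, h1, h2]
  simp

theorem Tword_append (w : List (Fin N)) (k : Fin N) : Tword N (w ++ [k]) = Tword N w * T N k := by
  simp [Tword]

/-- The expansion of a slope with respect to the two maps `slope n (sgn b)`. -/
theorem exists_slope_expansion {n : ℝ} (hn : 2 ≤ n) {s : ℝ} (hs : s ∈ Icc (-1 : ℝ) 1) :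
    ∃ (ω : ℕ → Fin 2) (r : ℕ → ℝ), r 0 = s ∧ (∀ m, r m ∈ Icc (-1 : ℝ) 1) ∧
      ∀ m, slope n (sgn (ω m)) (r (m + 1)) = r m := by
  have hex : ∀ t : Icc (-1 : ℝ) 1, ∃ a : Fin 2 × Icc (-1 : ℝ) 1, slope n (sgn a.1) a.2 = t := by
    rintro ⟨t, ht⟩
    obtain ⟨ε, hε, s, hs, h⟩ := exists_slope_eq hn ht
    rcases hε with rfl | rfl
    · exact ⟨(0, ⟨s, hs⟩), h⟩
    · exact ⟨(1, ⟨s, hs⟩), h⟩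
  choose F hF using hex
  set R : ℕ → Icc (-1 : ℝ) 1 := fun m => (fun t => (F t).2)^[m] ⟨s, hs⟩
  refine ⟨fun m => (F (R m)).1, fun m => R m, rfl, fun m => (R m).2, fun m => ?_⟩
  have : R (m + 1) = (F (R m)).2 := Function.iterate_succ_apply' _ _ _
  change slope n (sgn (F (R m)).1) (R (m + 1)) = R m
  rw [this]
  exact hF _

variable {ω : ℕ → Fin 2} {r : ℕ → ℝ}

/-- The factor by which `T_{ω_1} ⋯ T_{ω_m}` stretches the direction of slope `r m`. -/
noncomputable def stretch (N : ℕ) (ω : ℕ → Fin 2) (r : ℕ → ℝ) (m : ℕ) : ℝ :=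
  ∏ k ∈ Finset.range m, slopeDen N (sgn (ω k)) (r (k + 1)) / (2 * (N + 2))

/-- The factor by which the adjoint of `T_{ω_1} ⋯ T_{ω_m}` stretches the normal of slope `r 0`. -/
noncomputable def conormalStretch (N : ℕ) (ω : ℕ → Fin 2) (r : ℕ → ℝ) (m : ℕ) : ℝ :=
  ∏ k ∈ Finset.range m, (2 * N / ((N + 2) * slopeDen N (sgn (ω k)) (r (k + 1))))

theorem stretch_succ (m : ℕ) : stretch N ω r (m + 1) =
    stretch N ω r m * (slopeDen N (sgn (ω m)) (r (m + 1)) / (2 * (N + 2))) :=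
  Finset.prod_range_succ _ _

theorem conormalStretch_succ (m : ℕ) : conormalStretch N ω r (m + 1) =
    conormalStretch N ω r m * (2 * N / ((N + 2) * slopeDen N (sgn (ω m)) (r (m + 1)))) :=
  Finset.prod_range_succ _ _

theorem stretch_pos (hN : 2 ≤ N) (hr : ∀ m, r m ∈ Icc (-1 : ℝ) 1) (m : ℕ) :
    0 < stretch N ω r m :=
  Finset.prod_pos fun k _ => div_pos (by
    have := four_le_slopeDen (show (2 : ℝ) ≤ N from mod_cast hN) (sgn_eq (ω k)) (hr (k + 1))
    linarith) (by positivity)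

theorem conormalStretch_nonneg (hN : 2 ≤ N) (hr : ∀ m, r m ∈ Icc (-1 : ℝ) 1) (m : ℕ) :
    0 ≤ conormalStretch N ω r m :=
  Finset.prod_nonneg fun k _ => div_nonneg (by positivity) (mul_nonneg (by positivity) (by
    have := four_le_slopeDen (show (2 : ℝ) ≤ N from mod_cast hN) (sgn_eq (ω k)) (hr (k + 1))
    linarith))

theorem pow_le_stretch (hN : 2 ≤ N) (hr : ∀ m, r m ∈ Icc (-1 : ℝ) 1) (m : ℕ) :
    (2 / ((N : ℝ) + 2)) ^ m ≤ stretch N ω r m := by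
  have hN' : (2 : ℝ) ≤ N := by exact_mod_cast hN
  induction m with
  | zero => simp [stretch]
  | succ m ih =>
    rw [pow_succ, stretch_succ]
    refine mul_le_mul ih ?_ (by positivity) (stretch_pos hN hr m).le
    rw [div_le_div_iff₀ (by positivity) (by positivity)]
    nlinarith [four_le_slopeDen hN' (sgn_eq (ω m)) (hr (m + 1))]

/-- At each step the two factors multiply to `N / (N + 2)²`, the determinant of the planar map. -/
theorem stretch_mul_conormalStretch (hN : 2 ≤ N) (hr : ∀ m, r m ∈ Icc (-1 : ℝ) 1) (m : ℕ) :
    stretch N ω r m * conormalStretch N ω r m = (N / (N + 2) ^ 2 : ℝ) ^ m := by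
  have hN' : (2 : ℝ) ≤ N := by exact_mod_cast hN
  induction m with
  | zero => simp [stretch, conormalStretch]
  | succ m ih =>
    rw [pow_succ, ← ih, stretch_succ, conormalStretch_succ]
    have := four_le_slopeDen hN' (sgn_eq (ω m)) (hr (m + 1))
    have h0 : slopeDen N (sgn (ω m)) (r (m + 1)) ≠ 0 := by linarith
    field_simp

/-- Iteration of `slopeForm_slope`. As the form stays between `2` and `N`, the stretch decays no
faster than `(N + 2) ^ (-m / 2)`, which is better than the termwise bound `pow_le_stretch` when `N >
2`. -/
theorem slopeForm_le_stretch (hN : 2 ≤ N) (hr : ∀ m, r m ∈ Icc (-1 : ℝ) 1)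
    (hω : ∀ m, slope N (sgn (ω m)) (r (m + 1)) = r m) (m : ℕ) :
    slopeForm N (r m) ≤ (N + 2) ^ m * stretch N ω r m ^ 2 * slopeForm N (r 0) := by
  have hN' : (2 : ℝ) ≤ N := by exact_mod_cast hN
  induction m with
  | zero => simp [stretch]
  | succ m ih =>
    have h1 := slopeForm_slope hN' (sgn_eq (ω m)) (hr (m + 1))
    rw [hω] at h1
    have h2 := mul_le_mul_of_nonneg_left ih (sq_nonneg (slopeDen N (sgn (ω m)) (r (m + 1))))
    have h3 : 4 * ((N : ℝ) + 2) *
        ((N + 2) ^ (m + 1) * stretch N ω r (m + 1) ^ 2 * slopeForm N (r 0)) =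
        slopeDen N (sgn (ω m)) (r (m + 1)) ^ 2 *
          ((N + 2) ^ m * stretch N ω r m ^ 2 * slopeForm N (r 0)) := by
      rw [stretch_succ]
      field_simp
      ring
    have h4 := (h1.trans h2).trans_eq h3.symm
    exact le_of_mul_le_mul_left h4 (by positivity)

/-- The ratio of the two stretches is the `m`-th power of the determinant over the squared stretch,
and the squared stretch is at least `2 / (N (N + 2) ^ m)`. -/
theorem conormalStretch_le (hN : 2 ≤ N) (hr : ∀ m, r m ∈ Icc (-1 : ℝ) 1)
    (hω : ∀ m, slope N (sgn (ω m)) (r (m + 1)) = r m) (m : ℕ) :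
    conormalStretch N ω r m ≤ N / 2 * (N / (N + 2)) ^ m * stretch N ω r m := by
  have hN' : (2 : ℝ) ≤ N := by exact_mod_cast hN
  have h1 := slopeForm_le_stretch hN hr hω m
  have h2 := two_le_slopeForm hN' (hr m)
  have h3 : slopeForm N (r 0) ≤ N := slopeForm_le hN'
  have h4 : 2 ≤ (N + 2) ^ m * stretch N ω r m ^ 2 * N :=
    (h2.trans h1).trans (mul_le_mul_of_nonneg_left h3 (by positivity))
  have hcm := stretch_pos (ω := ω) hN hr m
  rw [← mul_le_mul_iff_right₀ hcm, stretch_mul_conormalStretch hN hr]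
  have h6 : stretch N ω r m * (N / 2 * (N / ((N : ℝ) + 2)) ^ m * stretch N ω r m) =
      (N / (N + 2) ^ 2 : ℝ) ^ m * (((N + 2) ^ m * stretch N ω r m ^ 2 * N) / 2) := by
    rw [div_pow, div_pow, ← pow_mul, mul_comm 2 m, pow_mul]
    field_simp
  rw [h6]
  have h7 : (0 : ℝ) ≤ (N / (N + 2) ^ 2 : ℝ) ^ m := by positivity
  nlinarith

theorem Tword_trunc_succ (τ : ℕ → Fin N) (m : ℕ) (y : Y N) :
    Tword N (trunc τ (m + 1)) y = Tword N (trunc τ m) (T N (τ m) y) := by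
  rw [trunc_succ, Tword_append]
  rfl

theorem Tword_trunc_zero (τ : ℕ → Fin N) (y : Y N) : Tword N (trunc τ 0) y = y := by
  simp [trunc, Tword]

theorem adjoint_Tword_trunc_succ (τ : ℕ → Fin N) (m : ℕ) (y : Y N) :
    ContinuousLinearMap.adjoint (Tword N (trunc τ (m + 1))) y =
      T N (τ m) (ContinuousLinearMap.adjoint (Tword N (trunc τ m)) y) := by
  refine ext_inner_right ℝ fun z => ?_
  rw [ContinuousLinearMap.adjoint_inner_left, Tword_trunc_succ, inner_T,
    ContinuousLinearMap.adjoint_inner_left]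

theorem adjoint_Tword_trunc_zero (τ : ℕ → Fin N) (y : Y N) :
    ContinuousLinearMap.adjoint (Tword N (trunc τ 0)) y = y := by
  refine ext_inner_right ℝ fun z => ?_
  rw [ContinuousLinearMap.adjoint_inner_left, Tword_trunc_zero]

theorem Tword_direction (hN : 2 ≤ N) (hij : i ≠ j) (hr : ∀ m, r m ∈ Icc (-1 : ℝ) 1)
    (hω : ∀ m, slope N (sgn (ω m)) (r (m + 1)) = r m) (m : ℕ) :
    Tword N (trunc (fun m => ![i, j] (ω m)) m) (direction i j (r m)) =
      stretch N ω r m • direction i j (r 0) := by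
  induction m with
  | zero => rw [Tword_trunc_zero, stretch, Finset.prod_range_zero, one_smul]
  | succ m ih =>
    rw [Tword_trunc_succ, T_direction hN hij _ (hr _), hω, map_smul, ih, stretch_succ,
      smul_smul, mul_comm]

theorem adjoint_Tword_normal (hN : 2 ≤ N) (hij : i ≠ j) (hr : ∀ m, r m ∈ Icc (-1 : ℝ) 1)
    (hω : ∀ m, slope N (sgn (ω m)) (r (m + 1)) = r m) (m : ℕ) :
    ContinuousLinearMap.adjoint (Tword N (trunc (fun m => ![i, j] (ω m)) m)) (normal i j (r 0)) =
      conormalStretch N ω r m • normal i j (r m) := by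
  induction m with
  | zero => rw [adjoint_Tword_trunc_zero, conormalStretch, Finset.prod_range_zero, one_smul]
  | succ m ih =>
    rw [adjoint_Tword_trunc_succ, ih, map_smul, ← hω m, T_normal hN hij _ (hr _),
      conormalStretch_succ, smul_smul]

theorem adjoint_Tword_of_inner_eq_zero (m : ℕ) {z : Y N} (h1 : inner ℝ (edge i j) z = 0)
    (h2 : inner ℝ (axis i j) z = 0) :
    ContinuousLinearMap.adjoint (Tword N (trunc (fun m => ![i, j] (ω m)) m)) z =
      ((1 / ((N : ℝ) + 2)) ^ m) • z := by
  induction m with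
  | zero => rw [adjoint_Tword_trunc_zero, pow_zero, one_smul]
  | succ m ih =>
    rw [adjoint_Tword_trunc_succ, ih, map_smul, T_of_inner_eq_zero _ h1 h2, smul_smul, pow_succ]

/-- Pairing with the direction of slope `r m` moves the adjoint to the other side, where the stretch
is explicit. The norms of directions lie between `1` and `2`, whence the factor `1 / 2`. -/
theorem le_norm_adjoint_Tword_direction (hN : 2 ≤ N) (hij : i ≠ j)
    (hr : ∀ m, r m ∈ Icc (-1 : ℝ) 1) (hω : ∀ m, slope N (sgn (ω m)) (r (m + 1)) = r m) (m : ℕ) :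
    stretch N ω r m / 2 ≤ ‖ContinuousLinearMap.adjoint
      (Tword N (trunc (fun m => ![i, j] (ω m)) m)) (direction i j (r 0))‖ := by
  set B := ContinuousLinearMap.adjoint (Tword N (trunc (fun m => ![i, j] (ω m)) m))
    (direction i j (r 0)) with hB
  have h1 : inner ℝ B (direction i j (r m)) = stretch N ω r m * ‖direction i j (r 0)‖ ^ 2 := by
    rw [hB, ContinuousLinearMap.adjoint_inner_left, Tword_direction hN hij hr hω, inner_smulY_right,
      real_inner_self_eq_norm_sq]
  have h2 := real_inner_le_norm B (direction i j (r m))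
  have h3 := norm_direction_le hN hij (hr m)
  have h4 := stretch_pos (ω := ω) hN hr m
  rw [h1] at h2
  have h5 := mul_le_mul_of_nonneg_left h3 (norm_nonneg B)
  have h6 : 1 ≤ ‖direction i j (r 0)‖ ^ 2 := one_le_pow₀ (one_le_norm_direction hN hij _)
  have h7 := mul_le_mul_of_nonneg_left h6 h4.le
  linarith

/-- A vector orthogonal to a direction is the sum of a multiple of the normal of that direction and
of a vector orthogonal to the plane of the edge. -/
theorem exists_eq_normal_add (hN : 2 ≤ N) (hij : i ≠ j) (s : ℝ) {y : Y N}
    (hy : inner ℝ (direction i j s) y = 0) :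
    ∃ (β : ℝ) (z : Y N), y = β • normal i j s + z ∧ inner ℝ (edge i j) z = 0 ∧
      inner ℝ (axis i j) z = 0 ∧ ‖β • normal i j s‖ ≤ ‖y‖ ∧ ‖z‖ ≤ ‖y‖ := by
  -- For `N = 2` the normal is zero and the coefficient is `0 / 0 = 0`, in agreement with the
  -- projection onto the zero subspace.
  have hproj : (ℝ ∙ normal i j s).starProjection y =
      (inner ℝ (normal i j s) y / ‖normal i j s‖ ^ 2) • normal i j s :=
    Submodule.starProjection_singleton ℝ y
  obtain ⟨β, hβ⟩ : ∃ β : ℝ, (ℝ ∙ normal i j s).starProjection y = β • normal i j s := ⟨_, hproj⟩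
  have hz : y - β • normal i j s = (ℝ ∙ normal i j s)ᗮ.starProjection y := by
    rw [Submodule.starProjection_orthogonal_val, hβ]
  have hνz : inner ℝ (normal i j s) (y - β • normal i j s) = 0 := by
    rw [hz]
    exact Submodule.mem_orthogonal_singleton_iff_inner_right.1
      (Submodule.starProjection_apply_mem _ _)
  refine ⟨β, y - β • normal i j s, (add_sub_cancel _ _).symm, ?_⟩
  have huz : inner ℝ (direction i j s) (y - β • normal i j s) = 0 := by
    rw [inner_sub_right, inner_smulY_right, hy, real_inner_comm, inner_normal_direction hij]
    ring
  have hzn : ‖y - β • normal i j s‖ ≤ ‖y‖ := by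
    rw [hz]
    exact Submodule.norm_starProjection_apply_le _ _
  have hβn : ‖β • normal i j s‖ ≤ ‖y‖ := by
    rw [← hβ]
    exact Submodule.norm_starProjection_apply_le _ _
  set z := y - β • normal i j s
  have hu' : inner ℝ (direction i j s) z = inner ℝ (edge i j) z + s * inner ℝ (axis i j) z := by
    rw [direction, emb, inner_add_left, inner_smulY_left, inner_smulY_left, one_mul]
  have hν' := inner_normal (i := i) (j := j) s z
  rw [hνz] at hν'
  rw [huz] at hu'
  obtain ⟨hκ0, hκ1⟩ := ratio_mem hN
  have hax : inner ℝ (axis i j) z = 0 := by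
    have h1 : inner ℝ (axis i j) z * (1 + s ^ 2 * (((N : ℝ) - 2) / N)) = 0 := by
      linear_combination (-1 : ℝ) * hν' - (s * (((N : ℝ) - 2) / N)) * hu'
    exact (mul_eq_zero.1 h1).resolve_right (by positivity)
  refine ⟨?_, hax, hβn, hzn⟩
  rw [hax] at hu'
  linarith

/-- Orthogonally to the tangent only two rates occur: `conormalStretch` on the normal inside the
plane of the edge, with the `2` of `norm_normal_le`, and `1 / (N + 2)` per step off the plane. -/
theorem norm_adjoint_Tword_le (hN : 2 ≤ N) (hij : i ≠ j)
    (hr : ∀ m, r m ∈ Icc (-1 : ℝ) 1) (hω : ∀ m, slope N (sgn (ω m)) (r (m + 1)) = r m) (m : ℕ)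
    {y : Y N} (hy : inner ℝ (direction i j (r 0)) y = 0) :
    ‖ContinuousLinearMap.adjoint (Tword N (trunc (fun m => ![i, j] (ω m)) m)) y‖ ≤
      (2 * conormalStretch N ω r m + (1 / ((N : ℝ) + 2)) ^ m) * ‖y‖ := by
  obtain ⟨β, z, hyz, hed, hax, hβn, hzn⟩ := exists_eq_normal_add hN hij _ hy
  have hle : ‖ContinuousLinearMap.adjoint (Tword N (trunc (fun m => ![i, j] (ω m)) m))
      (β • normal i j (r 0) + z)‖ ≤
      (2 * conormalStretch N ω r m + (1 / ((N : ℝ) + 2)) ^ m) * ‖y‖ := by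
    rw [map_add, map_smul, adjoint_Tword_normal hN hij hr hω,
      adjoint_Tword_of_inner_eq_zero m hed hax, add_mul]
    have hd0 := conormalStretch_nonneg (ω := ω) hN hr m
    refine (norm_add_le _ _).trans (add_le_add ?_ ?_)
    · rw [norm_smul, norm_smul, Real.norm_of_nonneg hd0]
      have h1 := norm_normal_le hN hij (s := r 0) (hr m)
      rw [norm_smul] at hβn
      have h2 := mul_le_mul_of_nonneg_left h1 (norm_nonneg β)
      have h3 : ‖β‖ * ‖normal i j (r m)‖ ≤ 2 * ‖y‖ := by linarith
      have h4 := mul_le_mul_of_nonneg_left h3 hd0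
      linarith
    · rw [norm_smul, Real.norm_of_nonneg (by positivity)]
      exact mul_le_mul_of_nonneg_left hzn (by positivity)
  rwa [← hyz] at hle

/-- Along the address of a point of the curve, the matrices `Zm` converge to the projection onto the
tangent. -/
theorem tendsto_Zm (hN : 2 ≤ N) (hij : i ≠ j) (hr : ∀ m, r m ∈ Icc (-1 : ℝ) 1)
    (hω : ∀ m, slope N (sgn (ω m)) (r (m + 1)) = r m) :
    Tendsto (Zm N fun m => ![i, j] (ω m)) atTop
      (𝓝 (ℝ ∙ direction i j (r 0)).starProjection) := by
  -- These terms bound the two rates of `norm_adjoint_Tword_le` relative to the stretch; both are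
  -- doubled because the tangent is only known to be stretched by `stretch N ω r m / 2`.
  have hlim : Tendsto (fun m => 4 * (N / 2 * (N / (N + 2) : ℝ) ^ m) + 2 * (1 / 2 : ℝ) ^ m) atTop
      (𝓝 0) := by
    have h1 := ((tendsto_pow_atTop_nhds_zero_of_lt_one (ratio_nonneg N) (ratio_lt_one N)).const_mul
      ((N : ℝ) / 2)).const_mul 4
    have h2 := (tendsto_pow_atTop_nhds_zero_of_lt_one (show (0 : ℝ) ≤ 1 / 2 by norm_num)
      (by norm_num)).const_mul 2
    simpa using h1.add h2
  have hu : 0 < ‖direction i j (r 0)‖ :=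
    zero_lt_one.trans_le (one_le_norm_direction hN hij _)
  have hBu := le_norm_adjoint_Tword_direction hN hij hr hω
  refine tendsto_normalized (stdOrthonormalBasis ℝ (Y N)) (norm_pos_iff.1 hu)
    (fun m => norm_pos_iff.1 (lt_of_lt_of_le (half_pos (stretch_pos hN hr m)) (hBu m)))
    (fun m => by positivity) hlim ?_
  intro m y
  have hy' : y - (ℝ ∙ direction i j (r 0)).starProjection y =
      (ℝ ∙ direction i j (r 0))ᗮ.starProjection y :=
    (Submodule.starProjection_orthogonal_val _).symm
  rw [hy']
  have horth : inner ℝ (direction i j (r 0)) ((ℝ ∙ direction i j (r 0))ᗮ.starProjection y) = 0 :=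
    Submodule.mem_orthogonal_singleton_iff_inner_right.1 (Submodule.starProjection_apply_mem _ _)
  have hle := norm_adjoint_Tword_le hN hij hr hω m horth
  refine hle.trans (mul_le_mul ?_ (Submodule.norm_starProjection_apply_le _ _) (norm_nonneg _)
    (mul_nonneg (by positivity) (norm_nonneg _)))
  have h1 := conormalStretch_le hN hr hω m
  have h2 : (1 / ((N : ℝ) + 2)) ^ m ≤ (1 / 2) ^ m * stretch N ω r m := by
    calc (1 / ((N : ℝ) + 2)) ^ m = (1 / 2) ^ m * (2 / ((N : ℝ) + 2)) ^ m := by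
          rw [← mul_pow]
          congr 1
          field_simp
      _ ≤ _ := mul_le_mul_of_nonneg_left (pow_le_stretch hN hr m) (by positivity)
  have h3 := mul_le_mul_of_nonneg_left (hBu m)
    (show 0 ≤ 4 * (N / 2 * (N / (N + 2) : ℝ) ^ m) + 2 * (1 / 2 : ℝ) ^ m by positivity)
  linarith

end Limit

/-! ### The edge curve as a smooth geodesic -/

section EdgeGeodesic

variable {N : ℕ} {i j : Fin N} {γ : ℝ → ℝ × ℝ} {σ : ℝ → ℝ}

/-- The curve `γ` in the plane of an edge, parametrized by its projection to the edge. -/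
noncomputable def edgeGraph (i j : Fin N) (γ : ℝ → ℝ × ℝ) (σ : ℝ → ℝ) (t : ℝ) : Y N :=
  emb i j (γ (σ t))

theorem hasDerivWithinAt_edgeGraph (h : IsSelfSimilar N γ) (hc : Continuous σ)
    (hσ : ∀ t ∈ Icc (0 : ℝ) 1, σ t ∈ Icc (-1 : ℝ) 1 ∧ (γ (σ t)).1 = t - 1 / 2)
    {t : ℝ} (ht : t ∈ Icc (0 : ℝ) 1) :
    HasDerivWithinAt (edgeGraph i j γ σ) (direction i j (σ t)) (Icc 0 1) t := by
  have h1 : HasDerivWithinAt (fun t => (γ (σ t)).1) 1 (Icc 0 1) t :=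
    ((hasDerivWithinAt_id t _).sub_const (1 / 2)).congr (fun r hr => (hσ r hr).2) (hσ t ht).2
  exact (h1.smul_const (edge i j)).add ((h.hasDerivWithinAt hc hσ ht).smul_const (axis i j))

theorem continuous_direction : Continuous (direction i j) :=
  continuous_emb.comp (Continuous.prodMk_right 1)

theorem derivWithin_edgeGraph (h : IsSelfSimilar N γ) (hc : Continuous σ)
    (hσ : ∀ t ∈ Icc (0 : ℝ) 1, σ t ∈ Icc (-1 : ℝ) 1 ∧ (γ (σ t)).1 = t - 1 / 2)
    {t : ℝ} (ht : t ∈ Icc (0 : ℝ) 1) :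
    derivWithin (edgeGraph i j γ σ) (Icc 0 1) t = direction i j (σ t) :=
  (hasDerivWithinAt_edgeGraph h hc hσ ht).derivWithin (uniqueDiffOn_Icc zero_lt_one t ht)

theorem contDiffOn_edgeGraph (h : IsSelfSimilar N γ) (hc : Continuous σ)
    (hσ : ∀ t ∈ Icc (0 : ℝ) 1, σ t ∈ Icc (-1 : ℝ) 1 ∧ (γ (σ t)).1 = t - 1 / 2) :
    ContDiffOn ℝ 1 (edgeGraph i j γ σ) (Icc 0 1) := by
  rw [contDiffOn_one_iff_derivWithin (uniqueDiffOn_Icc zero_lt_one)]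
  refine ⟨fun t ht => (hasDerivWithinAt_edgeGraph h hc hσ ht).differentiableWithinAt, ?_⟩
  exact (continuous_direction.comp hc).continuousOn.congr
    fun t ht => derivWithin_edgeGraph h hc hσ ht

theorem inner_edge_edgeGraph (hij : i ≠ j)
    (hσ : ∀ t ∈ Icc (0 : ℝ) 1, σ t ∈ Icc (-1 : ℝ) 1 ∧ (γ (σ t)).1 = t - 1 / 2)
    {t : ℝ} (ht : t ∈ Icc (0 : ℝ) 1) :
    inner ℝ (edge i j) (edgeGraph i j γ σ t) + 1 / 2 = t := by
  rw [edgeGraph, inner_edge_emb hij, (hσ t ht).2]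
  ring

theorem slopeAt_eq (hN : 2 ≤ N) (h : IsSelfSimilar N γ)
    (hσ : ∀ t ∈ Icc (0 : ℝ) 1, σ t ∈ Icc (-1 : ℝ) 1 ∧ (γ (σ t)).1 = t - 1 / 2)
    {s t : ℝ} (hs : s ∈ Icc (-1 : ℝ) 1) (ht : t ∈ Icc (0 : ℝ) 1) (hst : (γ s).1 = t - 1 / 2) :
    σ t = s :=
  (h.strictMonoOn (by exact_mod_cast hN)).injOn (hσ t ht).1 hs ((hσ t ht).2.trans hst.symm)

theorem edgeGraph_zero (hN : 2 ≤ N) (h : IsSelfSimilar N γ)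
    (hσ : ∀ t ∈ Icc (0 : ℝ) 1, σ t ∈ Icc (-1 : ℝ) 1 ∧ (γ (σ t)).1 = t - 1 / 2) :
    edgeGraph i j γ σ 0 = p N i := by
  have h0 : (γ (-1)).1 = 0 - 1 / 2 := by rw [h.left]; norm_num
  rw [edgeGraph, slopeAt_eq hN h hσ mem_Icc_neg_one ⟨le_rfl, zero_le_one⟩ h0,
    emb_left h.toIsSlopeCurve]

theorem edgeGraph_one (hN : 2 ≤ N) (h : IsSelfSimilar N γ)
    (hσ : ∀ t ∈ Icc (0 : ℝ) 1, σ t ∈ Icc (-1 : ℝ) 1 ∧ (γ (σ t)).1 = t - 1 / 2) :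
    edgeGraph i j γ σ 1 = p N j := by
  have h0 : (γ 1).1 = 1 - 1 / 2 := by rw [h.right]; norm_num
  rw [edgeGraph, slopeAt_eq hN h hσ mem_Icc_one ⟨zero_le_one, le_rfl⟩ h0,
    emb_right h.toIsSlopeCurve]

theorem isSimpleParam_edgeGraph (hN : 2 ≤ N) (hij : i ≠ j) (h : IsSelfSimilar N γ)
    (hc : Continuous σ)
    (hσ : ∀ t ∈ Icc (0 : ℝ) 1, σ t ∈ Icc (-1 : ℝ) 1 ∧ (γ (σ t)).1 = t - 1 / 2) :
    IsSimpleParam (edgeGraph i j γ σ) (Gam N i j) := by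
  refine ⟨(continuous_emb.comp (h.continuous.comp hc)).continuousOn, fun t ht r hr htr => ?_, ?_⟩
  · rw [← inner_edge_edgeGraph hij hσ ht, htr, inner_edge_edgeGraph hij hσ hr]
  · rw [Gam_eq hN hij h]
    apply Subset.antisymm
    · rintro _ ⟨t, ht, rfl⟩
      exact ⟨σ t, (hσ t ht).1, rfl⟩
    · rintro _ ⟨s, hs, rfl⟩
      have hmono := (h.strictMonoOn (by exact_mod_cast hN)).monotoneOn
      have h1 := hmono mem_Icc_neg_one hs hs.1
      have h2 := hmono hs mem_Icc_one hs.2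
      simp only [h.left, h.right] at h1 h2
      have ht : (γ s).1 + 1 / 2 ∈ Icc (0 : ℝ) 1 := by constructor <;> linarith
      refine ⟨_, ht, ?_⟩
      simp only [edgeGraph]
      rw [slopeAt_eq hN h hσ hs ht (by ring)]

theorem length_edgeGraph (h : IsSelfSimilar N γ) (hc : Continuous σ)
    (hσ : ∀ t ∈ Icc (0 : ℝ) 1, σ t ∈ Icc (-1 : ℝ) 1 ∧ (γ (σ t)).1 = t - 1 / 2) :
    length (edgeGraph i j γ σ) =
      ENNReal.ofReal (∫ t in (0 : ℝ)..1, ‖direction i j (σ t)‖) :=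
  eVariationOn_eq_integral_norm (fun _ ht => hasDerivWithinAt_edgeGraph h hc hσ ht)
    (continuous_direction.comp hc)

theorem isGeodesic_Gam (hN : 2 ≤ N) (hij : i ≠ j) (h : IsSelfSimilar N γ) (hc : Continuous σ)
    (hσ : ∀ t ∈ Icc (0 : ℝ) 1, σ t ∈ Icc (-1 : ℝ) 1 ∧ (γ (σ t)).1 = t - 1 / 2) :
    IsGeodesic (X N) (Gam N i j) (p N i) (p N j) := by
  refine ⟨?_, edgeGraph i j γ σ, isSimpleParam_edgeGraph hN hij h hc hσ, edgeGraph_zero hN h hσ,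
    edgeGraph_one hN h hσ, ?_, fun c hcc hcX hc0 hc1 => ?_⟩
  · rw [Gam_eq hN hij h]
    rintro _ ⟨s, hs, rfl⟩
    exact edgeCurve_mem_X hN hij h hs
  · rw [length_edgeGraph h hc hσ]
    exact ENNReal.ofReal_ne_top
  · exact length_le_of_mapsTo_X hN hij h hσ hcc hcX hc0 hc1

theorem arcLength_Gam (hN : 2 ≤ N) (hij : i ≠ j) (h : IsSelfSimilar N γ) (hc : Continuous σ)
    (hσ : ∀ t ∈ Icc (0 : ℝ) 1, σ t ∈ Icc (-1 : ℝ) 1 ∧ (γ (σ t)).1 = t - 1 / 2) :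
    arcLength (Gam N i j) = ENNReal.ofReal (∫ t in (0 : ℝ)..1, ‖direction i j (σ t)‖) := by
  rw [← length_edgeGraph h hc hσ]
  exact arcLength_eq (ξ := fun x => inner ℝ (edge i j) x + 1 / 2)
    (isSimpleParam_edgeGraph hN hij h hc hσ)
    ((continuous_const.inner continuous_id).add continuous_const)
    fun _ ht => inner_edge_edgeGraph hij hσ ht

/-- The squared speed is `1 + κ s²` with `κ = (N - 2) / N` and `s²` both in `[0,1]`. -/
theorem arcLength_Gam_mem (hN : 2 ≤ N) (hij : i ≠ j) (h : IsSelfSimilar N γ) (hc : Continuous σ)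
    (hσ : ∀ t ∈ Icc (0 : ℝ) 1, σ t ∈ Icc (-1 : ℝ) 1 ∧ (γ (σ t)).1 = t - 1 / 2) :
    1 ≤ arcLength (Gam N i j) ∧ arcLength (Gam N i j) ≤ 2 := by
  rw [arcLength_Gam hN hij h hc hσ]
  have hint : IntervalIntegrable (fun t => ‖direction i j (σ t)‖) volume 0 1 :=
    (continuous_direction.comp hc).norm.intervalIntegrable 0 1
  have h1 := intervalIntegral.integral_mono_on zero_le_one
    (intervalIntegrable_const (c := (1 : ℝ))) hint
    fun t _ => one_le_norm_direction hN hij (σ t)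
  have h2 := intervalIntegral.integral_mono_on zero_le_one hint
    (intervalIntegrable_const (c := (2 : ℝ)))
    fun t ht => norm_direction_le hN hij (hσ t ht).1
  rw [intervalIntegral.integral_const, sub_zero, one_smul] at h1 h2
  refine ⟨ENNReal.one_le_ofReal.2 h1, ?_⟩
  exact (ENNReal.ofReal_le_ofReal h2).trans_eq (ENNReal.ofReal_ofNat 2)

/-- Points of the curve have the addresses given by the expansions of their slopes. -/
theorem isAddress_emb (hN : 2 ≤ N) (hij : i ≠ j) (h : IsSelfSimilar N γ) {ω : ℕ → Fin 2}
    {r : ℕ → ℝ} (hr : ∀ m, r m ∈ Icc (-1 : ℝ) 1)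
    (hω : ∀ m, slope N (sgn (ω m)) (r (m + 1)) = r m) :
    IsAddress N (fun m => ![i, j] (ω m)) (emb i j (γ (r 0))) := by
  have hw : ∀ m, wordMap (S N) (trunc (fun m => ![i, j] (ω m)) m) (emb i j (γ (r m))) =
      emb i j (γ (r 0)) := by
    intro m
    induction m with
    | zero => rfl
    | succ m ih =>
      rw [trunc_succ, Fword_append, ← ih, ← hω m, h.map_slope _ (sgn_eq _) _ (hr _), ← S_emb hij]
  exact isAddress_of_mem hN fun m => ⟨_, edgeCurve_mem_X hN hij h (hr m), hw m⟩

/-- Outside `Ψ(V_*)`, `Z_*` is the projection to the tangent of the curve. -/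
theorem exists_isAddress_tendsto (hN : 2 ≤ N) (hij : i ≠ j) (h : IsSelfSimilar N γ) {s : ℝ}
    (hs : s ∈ Icc (-1 : ℝ) 1) (hsV : emb i j (γ s) ∉ PsiVstar N) :
    Zstar N (emb i j (γ s)) = (ℝ ∙ direction i j s).starProjection ∧
    ∃ ω : ℕ → Fin N, IsAddress N ω (emb i j (γ s)) ∧
      Tendsto (Zm N ω) atTop (𝓝 (ℝ ∙ direction i j s).starProjection) := by
  obtain ⟨ω, r, rfl, hr, hω⟩ :=
    exists_slope_expansion (n := N) (show (2 : ℝ) ≤ N by exact_mod_cast hN) hs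
  have ha := isAddress_emb hN hij h hr hω
  have hlim := tendsto_Zm hN hij hr hω
  refine ⟨?_, _, ha, hlim⟩
  have hex : ∃ τ : ℕ → Fin N, IsAddress N τ (emb i j (γ (r 0))) := ⟨_, ha⟩
  -- The address chosen in `Zstar` is the expansion of the slope, since points outside `Ψ(V_*)` have
  -- no other.
  rw [Zstar, dif_pos hex, hex.choose_spec.unique hN ha hsV]
  exact hlim.limUnder_eq

/-- `Ψ(V_*)` is countable and the abscissa recovers `t` from the point, so only countably many
parameters are lost. -/
theorem ae_edgeGraph_notMem (hij : i ≠ j)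
    (hσ : ∀ t ∈ Icc (0 : ℝ) 1, σ t ∈ Icc (-1 : ℝ) 1 ∧ (γ (σ t)).1 = t - 1 / 2) :
    ∀ᵐ t ∂volume.restrict (Icc (0 : ℝ) 1), edgeGraph i j γ σ t ∉ PsiVstar N := by
  have hcount : {t | t ∈ Icc (0 : ℝ) 1 ∧ edgeGraph i j γ σ t ∈ PsiVstar N}.Countable := by
    refine (countable_PsiVstar.image fun x => inner ℝ (edge i j) x + 1 / 2).mono ?_
    rintro t ⟨ht, htV⟩
    exact ⟨_, htV, inner_edge_edgeGraph hij hσ ht⟩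
  rw [ae_restrict_iff' measurableSet_Icc]
  filter_upwards [hcount.ae_notMem volume] with t ht ht1 htV
  exact ht ⟨ht1, htV⟩

theorem sqrt_inner_Zstar_edgeGraph (hN : 2 ≤ N) (hij : i ≠ j) (h : IsSelfSimilar N γ)
    (hc : Continuous σ)
    (hσ : ∀ t ∈ Icc (0 : ℝ) 1, σ t ∈ Icc (-1 : ℝ) 1 ∧ (γ (σ t)).1 = t - 1 / 2) {t : ℝ}
    (ht : t ∈ Icc (0 : ℝ) 1) (htV : edgeGraph i j γ σ t ∉ PsiVstar N) :
    Real.sqrt (inner ℝ (derivWithin (edgeGraph i j γ σ) (Icc 0 1) t)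
      (Zstar N (edgeGraph i j γ σ t) (derivWithin (edgeGraph i j γ σ) (Icc 0 1) t))) =
      ‖direction i j (σ t)‖ := by
  rw [derivWithin_edgeGraph h hc hσ ht, edgeGraph,
    (exists_isAddress_tendsto hN hij h (hσ t ht).1 htV).1,
    Submodule.starProjection_eq_self_iff.2 (Submodule.mem_span_singleton_self _),
    real_inner_self_eq_norm_sq, Real.sqrt_sq (norm_nonneg _)]

theorem ae_sqrt_inner_Zstar_edgeGraph (hN : 2 ≤ N) (hij : i ≠ j) (h : IsSelfSimilar N γ)
    (hc : Continuous σ)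
    (hσ : ∀ t ∈ Icc (0 : ℝ) 1, σ t ∈ Icc (-1 : ℝ) 1 ∧ (γ (σ t)).1 = t - 1 / 2) :
    ∀ᵐ t ∂volume.restrict (uIoc (0 : ℝ) 1),
      Real.sqrt (inner ℝ (derivWithin (edgeGraph i j γ σ) (Icc 0 1) t)
        (Zstar N (edgeGraph i j γ σ t) (derivWithin (edgeGraph i j γ σ) (Icc 0 1) t))) =
        ‖direction i j (σ t)‖ := by
  have hsub : uIoc (0 : ℝ) 1 ⊆ Icc 0 1 := by
    rw [uIoc_of_le zero_le_one]
    exact Ioc_subset_Icc_self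
  refine ae_restrict_of_ae_restrict_of_subset hsub ?_
  filter_upwards [ae_edgeGraph_notMem hij hσ, ae_restrict_mem measurableSet_Icc] with t htV ht
  exact sqrt_inner_Zstar_edgeGraph hN hij h hc hσ ht htV

end EdgeGeodesic

end HarmonicGasket

theorem theorem2p5 (N : ℕ) (hN : 2 ≤ N) (Γ : Set (HarmonicGasket.Y N))
    (hΓ : Γ = HarmonicGasket.Gam N ⟨0, by omega⟩ ⟨1, by omega⟩) :
    HarmonicGasket.IsGeodesic (HarmonicGasket.X N) Γ
        (HarmonicGasket.p N ⟨0, by omega⟩) (HarmonicGasket.p N ⟨1, by omega⟩) ∧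
    (∃ g : ℝ → HarmonicGasket.Y N,
      ContDiffOn ℝ 1 g (Icc 0 1) ∧
      HarmonicGasket.IsSimpleParam g Γ ∧
      g 0 = HarmonicGasket.p N ⟨0, by omega⟩ ∧
      g 1 = HarmonicGasket.p N ⟨1, by omega⟩ ∧
      -- the integrand is defined almost everywhere
      (∀ᵐ t ∂(volume.restrict (Icc (0 : ℝ) 1)),
        g t ∉ HarmonicGasket.PsiVstar N ∧
        ∃ ω : ℕ → Fin N, HarmonicGasket.IsAddress N ω (g t) ∧
          Tendsto (HarmonicGasket.Zm N ω) atTop (𝓝 (HarmonicGasket.Zstar N (g t)))) ∧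
      IntervalIntegrable (fun t => Real.sqrt (inner ℝ (derivWithin g (Icc 0 1) t)
        (HarmonicGasket.Zstar N (g t) (derivWithin g (Icc 0 1) t)))) volume 0 1 ∧
      HarmonicGasket.arcLength Γ =
        ENNReal.ofReal (∫ t in (0 : ℝ)..1, Real.sqrt (inner ℝ (derivWithin g (Icc 0 1) t)
          (HarmonicGasket.Zstar N (g t) (derivWithin g (Icc 0 1) t))))) ∧
    1 / 3 ≤ HarmonicGasket.arcLength Γ ∧ HarmonicGasket.arcLength Γ ≤ 2 := by
  have hij : (⟨0, by omega⟩ : Fin N) ≠ ⟨1, by omega⟩ := by simp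
  have hN' : (2 : ℝ) ≤ N := by exact_mod_cast hN
  obtain ⟨γ, h⟩ := HarmonicGasket.exists_isSelfSimilar hN'
  obtain ⟨σ, hc, hσ⟩ := h.exists_slopeAt hN'
  have hV := HarmonicGasket.ae_edgeGraph_notMem hij hσ
  have hZ := HarmonicGasket.ae_sqrt_inner_Zstar_edgeGraph hN hij h hc hσ
  subst hΓ
  refine ⟨HarmonicGasket.isGeodesic_Gam hN hij h hc hσ,
    ⟨HarmonicGasket.edgeGraph ⟨0, by omega⟩ ⟨1, by omega⟩ γ σ,
      HarmonicGasket.contDiffOn_edgeGraph h hc hσ,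
      HarmonicGasket.isSimpleParam_edgeGraph hN hij h hc hσ,
      HarmonicGasket.edgeGraph_zero hN h hσ, HarmonicGasket.edgeGraph_one hN h hσ, ?_, ?_, ?_⟩, ?_⟩
  · filter_upwards [hV, ae_restrict_mem measurableSet_Icc] with t htV ht
    obtain ⟨hZt, hex⟩ := HarmonicGasket.exists_isAddress_tendsto hN hij h (hσ t ht).1 htV
    refine ⟨htV, ?_⟩
    rw [HarmonicGasket.edgeGraph, hZt]
    exact hex
  · exact (((HarmonicGasket.continuous_direction.comp hc).norm.intervalIntegrable 0 1)).congr_ae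
      (hZ.mono fun _ ht => ht.symm)
  · rw [HarmonicGasket.arcLength_Gam hN hij h hc hσ]
    rw [intervalIntegral.integral_congr_ae_restrict hZ]
  · obtain ⟨h1, h2⟩ := HarmonicGasket.arcLength_Gam_mem hN hij h hc hσ
    refine ⟨le_trans ?_ h1, h2⟩
    exact ENNReal.div_le_of_le_mul (by norm_num)
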